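/- \textbf{Setting.} A map $t\mapsto\nu_t$ from $[0,\infty)$ to the positive Radon measures on $(0,\infty)$ is a solution of Smoluchowski's coagulation equation with additive kernel $K(x,y)=x+y$ if, with $m_1(t)=\int_0^\infty x\,\nu_t(dx)$: $m_1(0)<\infty$; $t\mapsto\nu_t(B)$ is measurable for every compact $B\subset(0,\infty)$; $\int_0^t m_1(\tau)^2\,d\tau<\infty$ for all $t>0$; and for all $t\ge0$ and all $f\in\mathcal E_1$ the function $f$ is $\nu_t$-integrable and $$\int f\,d\nu_t=\int f\,d\nu_0+\int_0^t\frac12\iint\,[f(x+y)-f(x)-f(y)]\,(x+y)\,\nu_\tau(dx)\,\nu_\tau(dy)\,d\tau .$$ Here $\mathcal E_1$ is the set of $C^1$ functions $f$ on $(0,\infty)$ such that $f$ and $f'$ have finite limits at $0$ and at $\infty$, $f(0^+)=0$, and $|f'(x)|\le Ce^{-\alpha x}$ for some $C$ and some $\alpha>0$. Write $M(t,x)=\int_{(0,x]}y\,\nu_t(dy)$. A positive function $L$ is slowly varying at infinity if $L(tx)/L(x)\to1$ as $x\to\infty$ for all $t>0$. A probability distribution function $M_*$ on $[0,\infty)$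 (proper: $M_*(x)\to1$ as $x\to\infty$) is nontrivial if $M_*(x)<1$ for some $x>0$. For $\rho\in(0,1]$ let $\beta=\rho/(1+\rho)$ and $$n_\rho(x)=\frac1\pi\sum_{k=1}^\infty\frac{(-1)^{k-1}x^{k\beta-2}}{k!}\Gamma(1+k-k\beta)\sin\pi k\beta ,\qquad M_\rho(x)=\sum_{k=1}^\infty\frac{(-1)^{k-1}x^{k\beta}}{k!}\Gamma(1+k-k\beta)\frac{\sin\pi k\beta}{\pi k\beta}.$$ \textbf{Theorem.} Let $\nu_t$ be a solution with $\int_0^\infty x\,\nu_0(dx)=1$. (1) Suppose there are a function $\lambda(t)\to\infty$ as $t\to\infty$ and a nontrivial probability distribution function $M_*$ such that $\lim_{t\to\infty}M(t,\lambda(t)x)=M_*(x)$ at all points of continuity $x>0$ of $M_*$. Then there are $\rho\in(0,1]$ and a function $L$ slowly varying at infinity such that $$\int_{(0,x]}y^2\,\nu_0(dy)\sim x^{1-\rho}L(x)\quad\text{as }x\to\infty.\tag{$*$}$$ (2) Conversely, if $(*)$ holds for some $\rho\in(0,1]$ and some $L$ slowly varying at infinity, then there is a strictly increasing $\lambda:[0,\infty)\to\mathbb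 R$, positive on $(0,\infty)$, with $\lambda(t)\to\infty$ and $$\lim_{t\to\infty}M(t,\lambda(t)x)=M_\rho(x),\qquad 0\le x<\infty.$$ (3) For every $\rho\in(0,1]$, $M_\rho$ is the mass distribution function of a self-similar solution: the series for $M_\rho(x)$ ($x\ge0$) and $n_\rho(x)$ ($x>0$) converge absolutely, $n_\rho\ge0$ on $(0,\infty)$, and $\nu^\rho_t(dx)=e^{-2t/\beta}n_\rho(e^{-t/\beta}x)\,dx$ is a solution with $\int_0^\infty x\,\nu^\rho_t(dx)=1$ and $\int_0^xy\,\nu^\rho_t(dy)=M_\rho(e^{-t/\beta}x)$ for $t,x\ge0$. The function $\varphi_\rho(s)=\int_0^\infty(1-e^{-sx})n_\rho(x)\,dx$ is nonnegative and satisfies $s=\varphi_\rho(s)+\varphi_\rho(s)^{1+\rho}$ for $s\ge0$, and for $s>0$ its derivative is the Laplace transform $\int_0^\infty e^{-sx}x\,n_\rho(x)\,dx$ of the mass distribution. Finally, for $x>0$, $$x\,n_\rho(x)=x^{\beta-1}p(x^\beta;1+\rho,1-\rho),$$ where $p(\,\cdot\,;\alpha,\gamma)$ is the stable density with characteristic function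 $\zeta\mapsto\exp(-|\zeta|^\alpha e^{i(\operatorname{sgn}\zeta)\pi\gamma/2})$, i.e. $p(x;\alpha,\gamma)=\frac1{2\pi}\int_{\mathbb R}e^{-i\zeta x}\exp(-|\zeta|^\alpha e^{i(\operatorname{sgn}\zeta)\pi\gamma/2})\,d\zeta$ (maximally skewed, since $\gamma=2-\alpha$). -/

import Mathlib

open MeasureTheory Set Filter Topology
open scoped ENNReal Asymptotics Nat

noncomputable section

namespace Smoluchowski

/-- A positive Radon measure on the open half-line `(0, ∞)`, regarded as a measure on `ℝ`
that does not charge `(-∞, 0]`. -/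
structure IsRadonOnPos (ν : Measure ℝ) : Prop where
  null_nonpos : ν (Iic 0) = 0
  finite_compact : ∀ B : Set ℝ, IsCompact B → B ⊆ Ioi 0 → ν B < ∞

/-- The test functions for the additive kernel: continuously differentiable functions on `(0, ∞)`
such that `f` and `f'` have finite limits at `0` and at `∞`, with `f(0) = 0`
and with exponentially decaying derivative. -/
structure IsTestFunction (f : ℝ → ℝ) : Prop where
  contDiffOn : ContDiffOn ℝ 1 f (Ioi 0)
  tendsto_zero : Tendsto f (𝓝[>] 0) (𝓝 0)
  limit_top : ∃ l : ℝ, Tendsto f atTop (𝓝 l)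
  deriv_limit_zero : ∃ l : ℝ, Tendsto (deriv f) (𝓝[>] 0) (𝓝 l)
  deriv_limit_top : ∃ l : ℝ, Tendsto (deriv f) atTop (𝓝 l)
  deriv_decay : ∃ C α : ℝ, 0 < α ∧ ∀ x : ℝ, 0 < x → |deriv f x| ≤ C * Real.exp (-α * x)

/-- The total mass `m₁ = ∫ x ν(dx)`, possibly infinite. -/
def totalMass (ν : Measure ℝ) : ℝ≥0∞ := ∫⁻ x, ENNReal.ofReal x ∂ν

/-- The coagulation functional
`⟨f, L(ν)⟩ = (1/2) ∫∫ [f(x+y) - f(x) - f(y)] (x+y) ν(dx) ν(dy)` for the kernel `K(x,y) = x+y`. -/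
def coagulation (f : ℝ → ℝ) (ν : Measure ℝ) : ℝ :=
  (1 / 2) * ∫ x, ∫ y, (f (x + y) - f x - f y) * (x + y) ∂ν ∂ν

/-- `t ↦ ν t`, `0 ≤ t < ∞`, is a (measure valued, weak) solution of Smoluchowski's coagulation
equation with the additive kernel `K(x,y) = x+y`. Values at negative times are irrelevant. -/
structure IsSolution (ν : ℝ → Measure ℝ) : Prop where
  radon : ∀ t : ℝ, 0 ≤ t → IsRadonOnPos (ν t)
  finite_mass : totalMass (ν 0) < ∞
  measurable : ∀ B : Set ℝ, IsCompact B → B ⊆ Ioi 0 → Measurable fun t : Ici (0 : ℝ) => ν t B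
  mass_sq : ∀ t : ℝ, 0 < t → ∫⁻ τ in Ioc 0 t, totalMass (ν τ) ^ 2 < ∞
  integrable : ∀ f : ℝ → ℝ, IsTestFunction f → ∀ t : ℝ, 0 ≤ t → Integrable f (ν t)
  weak : ∀ f : ℝ → ℝ, IsTestFunction f → ∀ t : ℝ, 0 ≤ t →
    ∫ x, f x ∂(ν t) = ∫ x, f x ∂(ν 0) + ∫ τ in (0 : ℝ)..t, coagulation f (ν τ)

/-- The mass distribution function `x ↦ ∫_{(0,x]} y ν(dy)`. -/
def massDist (ν : Measure ℝ) (x : ℝ) : ℝ := ∫ y in Ioc 0 x, y ∂ν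

/-- The truncated second moment `x ↦ ∫_{(0,x]} y² ν(dy)`. -/
def truncSecondMoment (ν : Measure ℝ) (x : ℝ) : ℝ := ∫ y in Ioc 0 x, y ^ 2 ∂ν

/-- `L` is a positive function, slowly varying at infinity. -/
def SlowlyVarying (L : ℝ → ℝ) : Prop :=
  (∀ x : ℝ, 0 < x → 0 < L x) ∧
    ∀ t : ℝ, 0 < t → Tendsto (fun x => L (t * x) / L x) atTop (𝓝 1)

/-- A (proper) probability distribution function on `[0, ∞)` that is not concentrated at `0`. -/
structure IsNontrivialDistribution (F : ℝ → ℝ) : Prop where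
  mono : Monotone F
  right_cont : ∀ x : ℝ, ContinuousWithinAt F (Ici x) x
  zero_of_neg : ∀ x : ℝ, x < 0 → F x = 0
  tendsto_one : Tendsto F atTop (𝓝 1)
  nontrivial : ∃ x : ℝ, 0 < x ∧ F x < 1

/-- The exponent `β = ρ / (1 + ρ)`. -/
def beta (ρ : ℝ) : ℝ := ρ / (1 + ρ)

/-- The term of index `k` (for `k ≥ 1`) of the series for `M_ρ(x)`:
`((-1)^(k-1) x^(kβ) / k!) Γ(1 + k - kβ) sin(πkβ) / (πkβ)`. -/
def massTerm (ρ x : ℝ) (k : ℕ) : ℝ :=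
  (-1) ^ (k - 1) * x ^ (k * beta ρ) / (k ! : ℝ) * Real.Gamma (1 + k - k * beta ρ) *
    (Real.sin (Real.pi * k * beta ρ) / (Real.pi * k * beta ρ))

/-- The function `M_ρ`, the sum of the terms with `k = 1, 2, …`. -/
def massProfile (ρ x : ℝ) : ℝ := ∑' k : ℕ, massTerm ρ x (k + 1)

/-- The term of index `k` (for `k ≥ 1`) of the series for `π n_ρ(x)`:
`((-1)^(k-1) x^(kβ-2) / k!) Γ(1 + k - kβ) sin(πkβ)`. -/
def numberTerm (ρ x : ℝ) (k : ℕ) : ℝ :=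
  (-1) ^ (k - 1) * x ^ (k * beta ρ - 2) / (k ! : ℝ) * Real.Gamma (1 + k - k * beta ρ) *
    Real.sin (Real.pi * k * beta ρ)

/-- The self-similar number density `n_ρ`. -/
def numberProfile (ρ x : ℝ) : ℝ := (1 / Real.pi) * ∑' k : ℕ, numberTerm ρ x (k + 1)

/-- The self-similar solution with number density `n(t,x) = e^(-2t/β) n_ρ(e^(-t/β) x)`. -/
def selfSimilar (ρ t : ℝ) : Measure ℝ :=
  (volume.restrict (Ioi 0)).withDensity fun x =>
    ENNReal.ofReal (Real.exp (-2 * t / beta ρ) * numberProfile ρ (Real.exp (-t / beta ρ) * x))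

/-- The desingularized Laplace transform `φ_ρ(s) = ∫ (1 - e^(-sx)) n_ρ(x) dx`. -/
def phiProfile (ρ s : ℝ) : ℝ := ∫ x in Ioi 0, (1 - Real.exp (-s * x)) * numberProfile ρ x

/-- The characteristic function `exp(-|ζ|^α e^(i (sgn ζ) πγ/2))` of the stable law of index `α`
and skewness `γ` (`1 < α ≤ 2`, `|γ| ≤ 2 - α`; maximally skewed when `|γ| = 2 - α`). -/
def stableCharFun (α γ ζ : ℝ) : ℂ :=
  Complex.exp (-((|ζ| ^ α : ℝ) : ℂ) *
    Complex.exp (((SignType.sign ζ : ℝ) * (Real.pi * γ / 2) : ℝ) * Complex.I))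

/-- The density of the stable law with characteristic function `stableCharFun α γ`, by Fourier
inversion (the characteristic function is integrable for `1 < α ≤ 2`, `|γ| ≤ 2 - α`). -/
def stableDensity (α γ x : ℝ) : ℝ :=
  (1 / (2 * Real.pi)) *
    (∫ ζ : ℝ, Complex.exp (-((ζ * x : ℝ) : ℂ) * Complex.I) * stableCharFun α γ ζ).re

end Smoluchowski

end

/-!
The additive kernel is solvable in terms of the mass measures `m_t(dx) = x ν_t(dx)`. Testing the
equation with `1 - e^{-sx}` shows that the Laplace exponents `φ(t,s) = ∫ (1 - e^{-sx}) ν_t(dx)`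
solve `∂ₜφ = -φ (m₁(t) - ∂ₛφ)`. Letting `s → 0` gives conservation of mass
(`IsSolution.totalMass_eq_one`), and for unit mass the equation is solved by characteristics:
`φ(t, s₀ - (1 - e^{-t}) φ₀(s₀)) = e^{-t} φ₀(s₀)` (`IsLapFlow.characteristic`). Consequently `e^t`
times the excess `R(s) = s/φ₀(s) - 1` at the start of a characteristic is the excess of `φ(t,·)` at
its end, and the large-time behaviour is governed by `R` near `0`.

A scaling limit therefore forces the ratios `R(cs)/R(s)` to converge
(`IsLapFlow.tendsto_excess_ratio`), and monotone functions with this property are regularly varying,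
which gives `s - φ₀(s)` the index `1 + ρ` with `0 < ρ ≤ 1` (`IsLapFlow.exists_index`). Conversely,
regular variation of `s - φ₀(s)` makes the rescaled exponents converge to the inverse of
`w ↦ w + w^{1+ρ}`, and the distribution functions converge with them (`IsLapFlow.exists_scale`).
The link with `∫_{(0,x]} y² ν₀(dy)` is an Abelian theorem (`tendsto_sub_lapExp_ratio`), proved by
dominated convergence in a layer-cake formula, and a Tauberian theorem
(`exists_truncMoment_limit`). The latter, like all passages from exponents to distribution
functions, rests on the continuity theorem `tendsto_measureReal_Iic_of_laplace`, which is a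
consequence of the Weierstrass theorem in the variable `e^{-x}`.

It remains to identify the limit. Expanding the Fourier integral of the maximally skewed stable
density and evaluating the terms as Gamma integrals along a complex ray yields its power series
(`hasSum_stableDensity`), which is the series for `n_ρ` up to a change of variables. So `x n_ρ(x)`
is an integral of exponentials over the imaginary axis; its Laplace transform is the integral of
`1 / (s - w - w^{1+ρ})` over that axis, and the residue at the zero `w` of the denominator is
`1 / (1 + (1 + ρ) w^ρ)` (`laplace_mul_numberProfile_eq`), the reciprocal of `ds/dw`. This
function of `w` is completely monotone. Hence so is the Laplace transform as a function of `s`, and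
`n_ρ ≥ 0` (`numberProfile_nonneg`), since the kernels `x^k e^{-sx}` concentrate at any given
point. Integration in `s` shows that `φ_ρ` is the inverse of `w ↦ w + w^{1+ρ}`
(`lapExp_profileMeasure_add_rpow`), and termwise integration identifies `M_ρ`
(`massProfile_eq`). Finally, the dilations of `n_ρ` satisfy the weak form for the functions
`1 - e^{-sx}` by an ordinary differential equation for `φ_ρ`. For general test functions the
derivative is approximated uniformly by polynomials in `e^{-x}` without constant term
(`weak_of_exp`).
-/

/-! ### Convergence of Laplace transforms -/

lemma integrable_exp_neg_mul_comp {μ : Measure ℝ} (hμ : μ (Iio 0) = 0)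
    (hi : Integrable (fun x => Real.exp (-x)) μ) {g : ℝ → ℝ} (hg : Continuous g) :
    Integrable (fun x => Real.exp (-x) * g (Real.exp (-x))) μ := by
  obtain ⟨C, hC⟩ := (isCompact_Icc (a := (0 : ℝ)) (b := 1)).exists_bound_of_continuousOn
    hg.continuousOn
  have hae : ∀ᵐ x ∂μ, 0 ≤ x := by
    rw [ae_iff]; simpa [Iio, not_le] using hμ
  refine (hi.mul_const C).mono' (by fun_prop) ?_
  filter_upwards [hae] with x hx
  rw [norm_mul, Real.norm_eq_abs, Real.abs_exp]
  exact mul_le_mul_of_nonneg_left (hC _ ⟨(Real.exp_pos _).le, by simpa using hx⟩)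
    (Real.exp_pos _).le

/-- Polynomials without constant term in `e^{-x}` determine the limit. -/
lemma tendsto_integral_polynomial_exp_neg {ι : Type*} {l : Filter ι} {μ : ι → Measure ℝ}
    {μ₀ : Measure ℝ} (hμ : ∀ i, μ i (Iio 0) = 0) (hμ₀ : μ₀ (Iio 0) = 0)
    (hi : ∀ i, Integrable (fun x => Real.exp (-x)) (μ i))
    (hi₀ : Integrable (fun x => Real.exp (-x)) μ₀)
    (hlap : ∀ k : ℕ, Tendsto (fun i => ∫ x, Real.exp (-(k + 1) * x) ∂μ i) l
      (𝓝 (∫ x, Real.exp (-(k + 1) * x) ∂μ₀))) (p : Polynomial ℝ) :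
    Tendsto (fun i => ∫ x, Real.exp (-x) * p.eval (Real.exp (-x)) ∂μ i) l
      (𝓝 (∫ x, Real.exp (-x) * p.eval (Real.exp (-x)) ∂μ₀)) := by
  have key : ∀ m : Measure ℝ, Integrable (fun x => Real.exp (-x)) m → m (Iio 0) = 0 →
      ∫ x, Real.exp (-x) * p.eval (Real.exp (-x)) ∂m =
        ∑ k ∈ p.support, p.coeff k * ∫ x, Real.exp (-(k + 1) * x) ∂m := by
    intro m hm hm0
    simp_rw [← integral_const_mul]
    rw [← integral_finsetSum]
    · congr 1; ext x
      rw [Polynomial.eval_eq_sum, Polynomial.sum, Finset.mul_sum]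
      refine Finset.sum_congr rfl fun k _ => ?_
      rw [← Real.exp_nat_mul, mul_left_comm, ← Real.exp_add]
      congr 2; ring
    · intro k _
      have := integrable_exp_neg_mul_comp hm0 hm (g := fun u => p.coeff k * u ^ k) (by fun_prop)
      refine this.congr (ae_of_all _ fun x => ?_)
      simp only [← Real.exp_nat_mul]
      rw [mul_left_comm, ← Real.exp_add]
      congr 2; ring
  simp_rw [key _ (hi _) (hμ _)]
  rw [key _ hi₀ hμ₀]
  exact tendsto_finsetSum _ fun k _ => (hlap k).const_mul _

/-- Convergence of the Laplace transforms at the positive integers implies convergence of the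
integrals of `e^{-x} G(e^{-x})` for continuous `G`. -/
lemma tendsto_integral_comp_exp_neg {ι : Type*} {l : Filter ι} {μ : ι → Measure ℝ}
    {μ₀ : Measure ℝ} (hμ : ∀ i, μ i (Iio 0) = 0) (hμ₀ : μ₀ (Iio 0) = 0)
    (hi : ∀ i, Integrable (fun x => Real.exp (-x)) (μ i))
    (hi₀ : Integrable (fun x => Real.exp (-x)) μ₀)
    (hlap : ∀ k : ℕ, Tendsto (fun i => ∫ x, Real.exp (-(k + 1) * x) ∂μ i) l
      (𝓝 (∫ x, Real.exp (-(k + 1) * x) ∂μ₀))) {G : ℝ → ℝ} (hG : Continuous G) :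
    Tendsto (fun i => ∫ x, Real.exp (-x) * G (Real.exp (-x)) ∂μ i) l
      (𝓝 (∫ x, Real.exp (-x) * G (Real.exp (-x)) ∂μ₀)) := by
  have h0 : ∀ m : Measure ℝ, ∫ x, Real.exp (-((0 : ℕ) + 1) * x) ∂m = ∫ x, Real.exp (-x) ∂m := by
    intro m; simp
  have hone := hlap 0
  rw [h0] at hone; simp_rw [h0] at hone
  set A := ∫ x, Real.exp (-x) ∂μ₀ with hA
  have hA0 : 0 ≤ A := integral_nonneg fun x => (Real.exp_pos _).le
  -- replacing `G` by a uniformly close polynomial changes each integral by little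
  have key : ∀ (m : Measure ℝ), Integrable (fun x => Real.exp (-x)) m → m (Iio 0) = 0 →
      ∀ (δ : ℝ), ∀ p : Polynomial ℝ, (∀ x ∈ Icc (0 : ℝ) 1, |p.eval x - G x| < δ) →
      |∫ x, Real.exp (-x) * p.eval (Real.exp (-x)) ∂m - ∫ x, Real.exp (-x) * G (Real.exp (-x)) ∂m|
        ≤ δ * ∫ x, Real.exp (-x) ∂m := by
    intro m hm hm0 δ p hp
    rw [← integral_sub (integrable_exp_neg_mul_comp hm0 hm (g := fun u => p.eval u) (by fun_prop))
      (integrable_exp_neg_mul_comp hm0 hm hG), ← integral_const_mul]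
    refine norm_integral_le_of_norm_le (G := ℝ) (hm.const_mul δ) ?_
    have hae : ∀ᵐ x ∂m, 0 ≤ x := by
      rw [ae_iff]; simpa [Iio, not_le] using hm0
    filter_upwards [hae] with x hx
    rw [← mul_sub, Real.norm_eq_abs, abs_mul, abs_of_pos (Real.exp_pos _), mul_comm]
    exact mul_le_mul_of_nonneg_right (hp _ ⟨(Real.exp_pos _).le, by simpa using hx⟩).le
      (Real.exp_pos _).le
  rw [Metric.tendsto_nhds]
  intro ε hε
  set δ := ε / (3 * (A + 1)) with hδ
  have hδ0 : 0 < δ := by positivity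
  obtain ⟨p, hp⟩ := exists_polynomial_near_of_continuousOn 0 1 G hG.continuousOn δ hδ0
  have hpoly := tendsto_integral_polynomial_exp_neg hμ hμ₀ hi hi₀ hlap p
  rw [Metric.tendsto_nhds] at hpoly
  filter_upwards [hpoly (ε / 3) (by positivity), hone.eventually_lt_const (lt_add_one A)]
    with i hpi hi1
  have k1 := key (μ i) (hi i) (hμ i) δ p hp
  have k2 := key μ₀ hi₀ hμ₀ δ p hp
  have hδA : δ * (A + 1) = ε / 3 := by rw [hδ]; field_simp
  have b1 : δ * ∫ x, Real.exp (-x) ∂μ i ≤ δ * (A + 1) := by gcongr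
  have b2 : δ * ∫ x, Real.exp (-x) ∂μ₀ ≤ δ * (A + 1) := by gcongr; linarith
  have hb2 : δ * ∫ x, Real.exp (-x) ∂μ₀ < ε / 3 := by
    rw [← hδA]; gcongr; linarith
  rw [Real.dist_eq] at hpi ⊢
  rw [abs_le] at k1 k2
  rw [abs_lt] at hpi ⊢
  constructor <;> linarith [k1.1, k1.2, k2.1, k2.2, hpi.1, hpi.2]

/-- **Continuity theorem** for Laplace transforms of measures on `[0, ∞)`, in terms of distribution
functions. The measures need only integrate
`e^{-x}`: no mass is compared at infinity. -/
theorem tendsto_measureReal_Iic_of_laplace {ι : Type*} {l : Filter ι} {μ : ι → Measure ℝ}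
    {μ₀ : Measure ℝ} (hμ : ∀ i, μ i (Iio 0) = 0) (hμ₀ : μ₀ (Iio 0) = 0)
    (hi : ∀ i, Integrable (fun x => Real.exp (-x)) (μ i))
    (hi₀ : Integrable (fun x => Real.exp (-x)) μ₀)
    (hlap : ∀ k : ℕ, Tendsto (fun i => ∫ x, Real.exp (-(k + 1) * x) ∂μ i) l
      (𝓝 (∫ x, Real.exp (-(k + 1) * x) ∂μ₀))) {x : ℝ} (hx : μ₀ {x} = 0) :
    Tendsto (fun i => (μ i).real (Iic x)) l (𝓝 (μ₀.real (Iic x))) := by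
  -- a continuous cut-off between `Iic a` and `Iic b`
  let c : ℝ → ℝ → ℝ → ℝ := fun a b y => max 0 (min 1 ((b - y) / (b - a)))
  have hc1 : ∀ {a b y : ℝ}, a < b → y ≤ a → c a b y = 1 := by
    intro a b y hab hy
    have : 1 ≤ (b - y) / (b - a) := by rw [le_div_iff₀ (by linarith)]; linarith
    simp [c, this]
  have hc0 : ∀ {a b y : ℝ}, a < b → b ≤ y → c a b y = 0 := by
    intro a b y hab hy
    have : (b - y) / (b - a) ≤ 0 := div_nonpos_of_nonpos_of_nonneg (by linarith) (by linarith)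
    simp only [c]; rw [max_eq_left]; exact (min_le_right _ _).trans this
  have hcI : ∀ a b y : ℝ, 0 ≤ c a b y ∧ c a b y ≤ 1 := fun a b y => by simp [c]
  have hcont : ∀ a b : ℝ, Continuous (c a b) := by intro a b; simp only [c]; fun_prop
  -- cut-offs are of the form covered by the preceding lemma
  have hrep : ∀ a b : ℝ, a < b → ∃ G : ℝ → ℝ, Continuous G ∧
      ∀ y, c a b y = Real.exp (-y) * G (Real.exp (-y)) := by
    intro a b hab
    let G : ℝ → ℝ := fun u => c a b (-Real.log (max u (Real.exp (-(b + 1))))) /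
      max u (Real.exp (-(b + 1)))
    have hpos : ∀ u : ℝ, 0 < max u (Real.exp (-(b + 1))) :=
      fun u => lt_max_of_lt_right (Real.exp_pos _)
    refine ⟨G, ?_, fun y => ?_⟩
    · exact Continuous.div ((hcont a b).comp (Continuous.neg (Continuous.log (by fun_prop)
        fun u => (hpos u).ne'))) (by fun_prop) fun u => (hpos u).ne'
    · rcases le_total y (b + 1) with h | h
      · have : max (Real.exp (-y)) (Real.exp (-(b + 1))) = Real.exp (-y) :=
          max_eq_left (by simpa using h)
        simp only [G, this, Real.log_exp, neg_neg]
        field_simp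
      · have : max (Real.exp (-y)) (Real.exp (-(b + 1))) = Real.exp (-(b + 1)) :=
          max_eq_right (by simpa using h)
        simp only [G, this, Real.log_exp, neg_neg]
        rw [hc0 hab (by linarith), hc0 hab (by linarith)]; simp
  have hconv : ∀ a b : ℝ, a < b → Tendsto (fun i => ∫ y, c a b y ∂μ i) l
      (𝓝 (∫ y, c a b y ∂μ₀)) := by
    intro a b hab
    obtain ⟨G, hGc, hGe⟩ := hrep a b hab
    simp_rw [hGe]
    exact tendsto_integral_comp_exp_neg hμ hμ₀ hi hi₀ hlap hGc
  have hint : ∀ m : Measure ℝ, m (Iio 0) = 0 → Integrable (fun x => Real.exp (-x)) m →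
      ∀ a b, a < b → Integrable (c a b) m := by
    intro m hm0 hm a b hab
    obtain ⟨G, hGc, hGe⟩ := hrep a b hab
    exact (integrable_exp_neg_mul_comp hm0 hm hGc).congr (ae_of_all _ fun y => (hGe y).symm)
  have hfin : ∀ m : Measure ℝ, m (Iio 0) = 0 → Integrable (fun x => Real.exp (-x)) m →
      ∀ a, m (Iic a) ≠ ∞ := by
    intro m _ hm a
    have h1 := hm.measure_ge_lt_top (Real.exp_pos (-a))
    refine ((measure_mono fun y (hy : y ≤ a) => ?_).trans_lt h1).ne
    exact Real.exp_le_exp.2 (neg_le_neg hy)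
  have hind : ∀ m : Measure ℝ, m (Iio 0) = 0 → Integrable (fun x => Real.exp (-x)) m →
      ∀ a, Integrable ((Iic a).indicator (1 : ℝ → ℝ)) m := by
    intro m hm0 hm a
    exact (integrable_indicator_iff measurableSet_Iic).2
      (integrableOn_const (hs := hfin m hm0 hm a) (hC := by simp))
  have hlow : ∀ m : Measure ℝ, m (Iio 0) = 0 → Integrable (fun x => Real.exp (-x)) m →
      ∀ a b, a < b → m.real (Iic a) ≤ ∫ y, c a b y ∂m := by
    intro m hm0 hm a b hab
    rw [← integral_indicator_one measurableSet_Iic]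
    refine integral_mono (hind m hm0 hm a) (hint m hm0 hm a b hab) fun y => ?_
    by_cases hy : y ≤ a
    · simp [indicator, hy, hc1 hab hy]
    · simp [indicator, hy, (hcI a b y).1]
  have hupp : ∀ m : Measure ℝ, m (Iio 0) = 0 → Integrable (fun x => Real.exp (-x)) m →
      ∀ a b, a < b → ∫ y, c a b y ∂m ≤ m.real (Iic b) := by
    intro m hm0 hm a b hab
    rw [← integral_indicator_one measurableSet_Iic]
    refine integral_mono (hint m hm0 hm a b hab) (hind m hm0 hm b) fun y => ?_
    by_cases hy : y ≤ b
    · simp [indicator, hy, (hcI a b y).2]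
    · simp [indicator, hy, hc0 hab (le_of_not_ge hy)]
  have hcomp : IsFiniteMeasureOnCompacts μ₀ := ⟨fun K hK => by
    obtain ⟨b, hb⟩ := hK.bddAbove
    exact lt_of_le_of_lt (measure_mono hb) (hfin μ₀ hμ₀ hi₀ b).lt_top⟩
  rw [Metric.tendsto_nhds]
  intro ε hε
  -- the limit has little mass near `x`
  obtain ⟨δ, hδ, hδx⟩ : ∃ δ > 0, μ₀.real (Icc (x - δ) (x + δ)) < ε / 2 := by
    have h1 := tendsto_measure_Icc_nhdsWithin_right μ₀ x
    rw [hx] at h1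
    have h2 := (ENNReal.tendsto_toReal ENNReal.zero_ne_top).comp (h1.mono_left
      (nhdsWithin_mono _ Ioi_subset_Ici_self))
    have h3 := (h2.eventually_lt_const (u := ε / 2) (by simpa using hε)).and self_mem_nhdsWithin
    obtain ⟨δ, h, h'⟩ := h3.exists
    exact ⟨δ, h', h⟩
  have hsub : ∀ a b : ℝ, x - δ ≤ a → b ≤ x + δ → a ≤ b →
      μ₀.real (Iic b) ≤ μ₀.real (Iic a) + μ₀.real (Icc (x - δ) (x + δ)) := by
    intro a b ha hb hab
    refine (measureReal_mono (fun y hy => ?_) ?_).trans (measureReal_union_le _ _)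
    swap
    · exact (measure_union_lt_top (hfin μ₀ hμ₀ hi₀ a).lt_top
        (isCompact_Icc.measure_lt_top)).ne
    rcases le_or_gt y a with h | h
    · exact Or.inl h
    · exact Or.inr ⟨by linarith, (mem_Iic.1 hy).trans hb⟩
  have e1 := hsub x (x + δ) (by linarith) le_rfl (by linarith)
  have e2 := hsub (x - δ) x le_rfl (by linarith) (by linarith)
  have c1 := hconv x (x + δ) (by linarith)
  have c2 := hconv (x - δ) x (by linarith)
  rw [Metric.tendsto_nhds] at c1 c2
  filter_upwards [c1 (ε / 2) (by positivity), c2 (ε / 2) (by positivity)] with i h1 h2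
  have a1 := hlow (μ i) (hμ i) (hi i) x (x + δ) (by linarith)
  have a2 := hupp (μ i) (hμ i) (hi i) (x - δ) x (by linarith)
  have a3 := hlow μ₀ hμ₀ hi₀ (x - δ) x (by linarith)
  have a4 := hupp μ₀ hμ₀ hi₀ x (x + δ) (by linarith)
  rw [Real.dist_eq, abs_lt] at *
  constructor <;> linarith [h1.1, h1.2, h2.1, h2.2]

/-! ### Convergence of derivatives of concave functions -/

/-- If `f i` are concave with derivatives `d i` (the first two hypotheses record the tangent line
inequalities) and `f i → f` pointwise, then `d i → f'` wherever `f` is differentiable. -/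
lemma tendsto_deriv_of_concave {ι : Type*} {l : Filter ι} {f d : ι → ℝ → ℝ} {g : ℝ → ℝ}
    {s g' : ℝ} (hs : 0 < s)
    (hlow : ∀ᶠ i in l, ∀ a b : ℝ, 0 < a → a < b → d i b * (b - a) ≤ f i b - f i a)
    (hupp : ∀ᶠ i in l, ∀ a b : ℝ, 0 < a → a < b → f i b - f i a ≤ d i a * (b - a))
    (hconv : ∀ x : ℝ, 0 < x → Tendsto (fun i => f i x) l (𝓝 (g x)))
    (hg : HasDerivAt g g' s) : Tendsto (fun i => d i s) l (𝓝 g') := by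
  have hsl := hasDerivAt_iff_tendsto_slope_zero.1 hg
  rw [Metric.tendsto_nhds]
  intro ε hε
  rw [Metric.tendsto_nhdsWithin_nhds] at hsl
  obtain ⟨δ, hδ, hd⟩ := hsl (ε / 2) (by positivity)
  set h := min (δ / 2) (s / 2) with hh
  have hh0 : 0 < h := by positivity
  have hhs : h < s := by linarith [min_le_right (δ / 2) (s / 2)]
  have hhd : h < δ := by linarith [min_le_left (δ / 2) (s / 2)]
  have d1 := hd (x := h) hh0.ne' (by simpa [abs_of_pos hh0] using hhd)
  have d2 := hd (x := -h) (by simpa using hh0.ne') (by simpa [abs_of_pos hh0] using hhd)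
  have c0 := hconv s hs
  have c1 := hconv (s + h) (by linarith)
  have c2 := hconv (s - h) (by linarith)
  have c3 := (c1.sub c0).div_const h
  have c4 := (c0.sub c2).div_const h
  rw [Metric.tendsto_nhds] at c3 c4
  filter_upwards [hlow, hupp, c3 (ε / 2) (by positivity), c4 (ε / 2) (by positivity)]
    with i hl hu e3 e4
  have k1 := hu s (s + h) hs (by linarith)
  have k2 := hl (s - h) s (by linarith) (by linarith)
  have k1' : (f i (s + h) - f i s) / h ≤ d i s := by
    rw [div_le_iff₀ hh0]; simpa using k1
  have k2' : d i s ≤ (f i s - f i (s - h)) / h := by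
    rw [le_div_iff₀ hh0]; simpa using k2
  have r1 : h⁻¹ • (g (s + h) - g s) = (g (s + h) - g s) / h := by
    rw [smul_eq_mul]; ring
  have r2 : (-h)⁻¹ • (g (s + -h) - g s) = (g s - g (s - h)) / h := by
    rw [smul_eq_mul, inv_neg, ← sub_eq_add_neg]; ring
  rw [r1] at d1; rw [r2] at d2
  rw [Real.dist_eq, abs_lt] at *
  constructor <;> linarith [d1.1, d1.2, d2.1, d2.2, e3.1, e3.2, e4.1, e4.2]

/-! ### Monotone functions with multiplicative limits -/

/-- Monotone solutions of Cauchy's functional equation are linear. -/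
lemma eq_mul_of_monotone_of_additive {f : ℝ → ℝ} (hm : Monotone f)
    (ha : ∀ x y, f (x + y) = f x + f y) (x : ℝ) : f x = x * f 1 := by
  let F : ℝ →+ ℝ := AddMonoidHom.mk' f ha
  have hF : ∀ n : ℤ, ∀ y, f (n * y) = n * f y := fun n y => by
    have := map_zsmul F n y
    simpa [zsmul_eq_mul, F] using this
  have h1 : ∀ n : ℕ, |f x - x * f 1| * n ≤ f 1 := by
    intro n
    have a1 : (⌊n * x⌋ : ℝ) ≤ n * x := Int.floor_le _
    have a2 : n * x ≤ ((⌊n * x⌋ + 1 : ℤ) : ℝ) := by push_cast; exact (Int.lt_floor_add_one _).le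
    have b1 := hm a1
    have b2 := hm a2
    have c1 := hF ⌊n * x⌋ 1
    have c2 := hF (⌊n * x⌋ + 1) 1
    have c3 := hF n x
    rw [mul_one] at c1 c2
    rw [c1] at b1; rw [c2] at b2
    simp only [Int.cast_natCast] at c3
    rw [c3] at b1 b2
    have hf1 : 0 ≤ f 1 := by
      have h0 : f 0 = 0 := by have := ha 0 0; simp at this; exact this
      rw [← h0]; exact hm zero_le_one
    push_cast at a2 b2
    have a1' : (⌊n * x⌋ : ℝ) * f 1 ≤ n * x * f 1 := by gcongr
    have a2' : n * x * f 1 ≤ (⌊n * x⌋ + 1 : ℝ) * f 1 := by gcongr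
    have : |(f x - x * f 1) * n| ≤ f 1 := by
      rw [abs_le]; constructor <;> nlinarith
    rwa [abs_mul, Nat.abs_cast] at this
  by_contra hne
  have hpos : 0 < |f x - x * f 1| := abs_pos.2 (sub_ne_zero.2 hne)
  obtain ⟨n, hn⟩ := exists_nat_gt (f 1 / |f x - x * f 1|)
  rw [div_lt_iff₀ hpos] at hn
  linarith [h1 n, mul_comm (n : ℝ) |f x - x * f 1|]

/-- A positive monotone function near `0` all of whose ratios `R(cs)/R(s)`, `0 < c < 1`, have
positive limits is regularly varying at `0`. -/
theorem exists_rpow_limit_of_monotone {R : ℝ → ℝ} (hpos : ∀ s, 0 < s → 0 < R s)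
    (hmono : MonotoneOn R (Ioi 0))
    (hlim : ∀ c, 0 < c → c < 1 → ∃ r, 0 < r ∧ Tendsto (fun s => R (c * s) / R s) (𝓝[>] 0) (𝓝 r)) :
    ∃ ρ : ℝ, ∀ c, 0 < c → Tendsto (fun s => R (c * s) / R s) (𝓝[>] 0) (𝓝 (c ^ ρ)) := by
  have hscale : ∀ c : ℝ, 0 < c → Tendsto (fun s => c * s) (𝓝[>] 0) (𝓝[>] 0) := by
    intro c hc
    refine tendsto_nhdsWithin_iff.2 ⟨?_, ?_⟩
    · have : Tendsto (fun s : ℝ => c * s) (𝓝 0) (𝓝 (c * 0)) := by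
        exact (continuous_const.mul continuous_id).tendsto 0
      rw [mul_zero] at this
      exact this.mono_left nhdsWithin_le_nhds
    · filter_upwards [self_mem_nhdsWithin] with s hs
      exact mul_pos hc hs
  have hpos_ev : ∀ᶠ s : ℝ in 𝓝[>] 0, 0 < s := self_mem_nhdsWithin
  have hall : ∀ c, 0 < c → ∃ r, 0 < r ∧ Tendsto (fun s => R (c * s) / R s) (𝓝[>] 0) (𝓝 r) := by
    intro c hc
    rcases lt_trichotomy c 1 with h | h | h
    · exact hlim c hc h
    · refine ⟨1, one_pos, ?_⟩
      refine tendsto_const_nhds.congr' ?_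
      filter_upwards [hpos_ev] with s hs
      rw [h, one_mul, div_self (hpos s hs).ne']
    · obtain ⟨r, hr, hl⟩ := hlim c⁻¹ (inv_pos.2 hc) (inv_lt_one_of_one_lt₀ h)
      refine ⟨r⁻¹, inv_pos.2 hr, ?_⟩
      refine ((hl.comp (hscale c hc)).inv₀ hr.ne').congr fun s => ?_
      simp only [Function.comp]
      rw [inv_div, ← mul_assoc, inv_mul_cancel₀ hc.ne', one_mul]
  choose! r hr hrl using hall
  have hmul : ∀ a b, 0 < a → 0 < b → r (a * b) = r a * r b := by
    intro a b ha hb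
    refine tendsto_nhds_unique (hrl (a * b) (mul_pos ha hb)) ?_
    refine (((hrl a ha).comp (hscale b hb)).mul (hrl b hb)).congr' ?_
    filter_upwards [hpos_ev] with s hs
    simp only [Function.comp]
    rw [div_mul_div_cancel₀ (hpos _ (mul_pos hb hs)).ne', mul_assoc]
  have hmon : ∀ a b, 0 < a → a ≤ b → r a ≤ r b := by
    intro a b ha hab
    have hb := ha.trans_le hab
    refine le_of_tendsto_of_tendsto (hrl a ha) (hrl b hb) ?_
    filter_upwards [hpos_ev] with s hs
    have := hmono (mem_Ioi.2 (mul_pos ha hs)) (mem_Ioi.2 (mul_pos hb hs)) (by gcongr)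
    exact div_le_div_of_nonneg_right this (hpos s hs).le
  have key := eq_mul_of_monotone_of_additive (f := fun x => Real.log (r (Real.exp x)))
    (fun x y hxy => Real.log_le_log (hr _ (Real.exp_pos _))
      (hmon _ _ (Real.exp_pos _) (Real.exp_le_exp.2 hxy)))
    (fun x y => by
      rw [Real.exp_add, hmul _ _ (Real.exp_pos _) (Real.exp_pos _),
        Real.log_mul (hr _ (Real.exp_pos _)).ne' (hr _ (Real.exp_pos _)).ne'])
  refine ⟨Real.log (r (Real.exp 1)), fun c hc => ?_⟩
  have := key (Real.log c)
  simp only [Real.exp_log hc] at this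
  rw [Real.rpow_def_of_pos hc, ← this, Real.exp_log (hr c hc)]
  exact hrl c hc

/-! ### Layer-cake formulas for Laplace exponents -/

namespace Smoluchowski

/-- The kernel `(1 - e^{-z}) / z`, whose integral against the mass measure is `φ(s) / s`. -/
noncomputable def kerOne (z : ℝ) : ℝ := (1 - Real.exp (-z)) / z

/-- The density `-kerOne'`. -/
noncomputable def kerOneDensity (z : ℝ) : ℝ := (1 - (1 + z) * Real.exp (-z)) / z ^ 2

/-- The kernel `(z - 1 + e^{-z}) / z²`, whose integral against `y² ν(dy)` is `(s - φ(s)) / s²`. -/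
noncomputable def kerTwo (z : ℝ) : ℝ := (z - 1 + Real.exp (-z)) / z ^ 2

/-- The density `-kerTwo'`. -/
noncomputable def kerTwoDensity (z : ℝ) : ℝ := (z - 2 + (z + 2) * Real.exp (-z)) / z ^ 3

lemma one_add_mul_exp_neg_lt {z : ℝ} (hz : 0 < z) : (1 + z) * Real.exp (-z) < 1 := by
  rw [Real.exp_neg, ← div_eq_mul_inv, div_lt_one (Real.exp_pos _)]
  linarith [Real.add_one_lt_exp hz.ne']

lemma exp_neg_le_quadratic {z : ℝ} (hz : 0 ≤ z) : Real.exp (-z) ≤ 1 - z + z ^ 2 / 2 := by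
  have h := Real.quadratic_le_exp_of_nonneg hz
  have h0 : 0 < 1 - z + z ^ 2 / 2 := by nlinarith [sq_nonneg (z - 1)]
  rw [Real.exp_neg, inv_le_comm₀ (Real.exp_pos _) h0, inv_le_iff_one_le_mul₀ h0]
  nlinarith [sq_nonneg (z ^ 2), mul_le_mul_of_nonneg_right h h0.le]

lemma kerOneDensity_pos {z : ℝ} (hz : 0 < z) : 0 < kerOneDensity z :=
  div_pos (by linarith [one_add_mul_exp_neg_lt hz]) (by positivity)

lemma kerTwoDensity_nonneg {z : ℝ} (hz : 0 < z) : 0 ≤ kerTwoDensity z := by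
  have h : MonotoneOn (fun z : ℝ => z - 2 + (z + 2) * Real.exp (-z)) (Ici 0) := by
    refine monotoneOn_of_hasDerivWithinAt_nonneg (convex_Ici 0) (by fun_prop)
      (f' := fun z => 1 + (1 * Real.exp (-z) + (z + 2) * (Real.exp (-z) * (-1)))) ?_ ?_
    · intro x _
      exact (((hasDerivAt_id x).sub_const 2).add (((hasDerivAt_id x).add_const 2).mul
        (hasDerivAt_neg x).exp)).hasDerivWithinAt
    · intro x hx
      rw [interior_Ici] at hx
      have := one_add_mul_exp_neg_lt hx
      nlinarith
  have := h self_mem_Ici hz.le hz.le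
  norm_num at this
  exact div_nonneg this (by positivity)

lemma kerTwoDensity_le_half {z : ℝ} (hz : 0 < z) : kerTwoDensity z ≤ 1 / 2 := by
  rw [kerTwoDensity, div_le_iff₀ (by positivity)]
  nlinarith [mul_le_mul_of_nonneg_left (exp_neg_le_quadratic hz.le) (by linarith : 0 ≤ z + 2)]

lemma kerTwoDensity_le_inv_sq {z : ℝ} (hz : 0 < z) : kerTwoDensity z ≤ 1 / z ^ 2 := by
  rw [kerTwoDensity, div_le_div_iff₀ (by positivity) (by positivity)]
  have h1 := one_add_mul_exp_neg_lt hz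
  have h2 : Real.exp (-z) ≤ 1 := by simpa using hz.le
  have : z - 2 + (z + 2) * Real.exp (-z) ≤ z := by nlinarith
  nlinarith [mul_le_mul_of_nonneg_right this (by positivity : 0 ≤ z ^ 2)]

lemma hasDerivAt_kerOne {z : ℝ} (hz : 0 < z) : HasDerivAt kerOne (-kerOneDensity z) z := by
  have := ((hasDerivAt_neg z).exp.const_sub 1).div (hasDerivAt_id z) hz.ne'
  refine this.congr_deriv ?_
  simp only [kerOneDensity, id]
  field_simp
  ring

lemma hasDerivAt_kerTwo {z : ℝ} (hz : 0 < z) : HasDerivAt kerTwo (-kerTwoDensity z) z := by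
  have := (((hasDerivAt_id z).sub_const 1).add (hasDerivAt_neg z).exp).div (hasDerivAt_pow 2 z)
    (by positivity)
  refine this.congr_deriv ?_
  simp only [kerTwoDensity, id, Pi.add_apply]
  field_simp
  push_cast
  ring

lemma kerOne_nonneg {z : ℝ} (hz : 0 < z) : 0 ≤ kerOne z :=
  div_nonneg (by simpa using hz.le) hz.le

lemma kerOne_le_one {z : ℝ} (hz : 0 < z) : kerOne z ≤ 1 := by
  rw [kerOne, div_le_one hz]; linarith [Real.add_one_le_exp (-z)]

lemma tendsto_kerOne_atTop : Tendsto kerOne atTop (𝓝 0) := by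
  refine squeeze_zero' (g := fun z => 1 / z) ?_ ?_ (by simpa using tendsto_inv_atTop_zero)
  · filter_upwards [eventually_gt_atTop 0] with z hz using kerOne_nonneg hz
  · filter_upwards [eventually_gt_atTop 0] with z hz
    exact div_le_div_of_nonneg_right (by linarith [Real.exp_pos (-z)]) hz.le

lemma tendsto_kerTwo_atTop : Tendsto kerTwo atTop (𝓝 0) := by
  refine squeeze_zero' (g := fun z => 1 / z) ?_ ?_ (by simpa using tendsto_inv_atTop_zero)
  · filter_upwards with z
    exact div_nonneg (by linarith [Real.add_one_le_exp (-z)]) (by positivity)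
  · filter_upwards [eventually_gt_atTop 0] with z hz
    rw [kerTwo, div_le_div_iff₀ (by positivity) hz]
    have : Real.exp (-z) ≤ 1 := by simpa using hz.le
    nlinarith

lemma tendsto_kerOne_zero : Tendsto kerOne (𝓝[>] 0) (𝓝 1) := by
  have h := hasDerivAt_iff_tendsto_slope_zero.1 (hasDerivAt_neg (0 : ℝ)).exp.neg
  have h' := h.mono_left (nhdsWithin_mono (0 : ℝ) (fun x (hx : 0 < x) => hx.ne') :
    𝓝[>] (0 : ℝ) ≤ 𝓝[≠] 0)
  norm_num at h'
  refine h'.congr' ?_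
  filter_upwards with x
  rw [kerOne]; ring

lemma strictAntiOn_kerOne : StrictAntiOn kerOne (Ioi 0) := by
  refine strictAntiOn_of_hasDerivWithinAt_neg (convex_Ioi 0)
    (fun x hx => (hasDerivAt_kerOne hx).continuousAt.continuousWithinAt)
    (f' := fun z => -kerOneDensity z) ?_ ?_
  · intro x hx; rw [interior_Ioi] at hx
    exact (hasDerivAt_kerOne hx).hasDerivWithinAt
  · intro x hx; rw [interior_Ioi] at hx
    simpa using kerOneDensity_pos hx

lemma measurable_kerOne : Measurable kerOne := by unfold kerOne; fun_prop

lemma measurable_kerTwo : Measurable kerTwo := by unfold kerTwo; fun_prop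

lemma measurable_kerOneDensity : Measurable kerOneDensity := by unfold kerOneDensity; fun_prop

lemma measurable_kerTwoDensity : Measurable kerTwoDensity := by unfold kerTwoDensity; fun_prop

/-- `kerOneDensity` is a probability density on `(0, ∞)`. -/
lemma integrable_integral_kerOneDensity :
    IntegrableOn kerOneDensity (Ioi 0) ∧ ∫ z in Ioi 0, kerOneDensity z = 1 := by
  have h0 : ContinuousWithinAt (fun z => -Function.update kerOne 0 1 z) (Ici 0) 0 := by
    refine ContinuousWithinAt.neg (continuousWithinAt_update_same.2 ?_)
    rw [Ici_sdiff_left]; exact tendsto_kerOne_zero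
  have hev : ∀ x ∈ Ioi (0 : ℝ), HasDerivAt (fun z => -Function.update kerOne 0 1 z)
      (kerOneDensity x) x := by
    intro x hx
    have h := (hasDerivAt_kerOne hx).neg
    rw [neg_neg] at h
    refine h.congr_of_eventuallyEq ?_
    filter_upwards [lt_mem_nhds (show (0 : ℝ) < x from hx)] with y hy
    simp [Function.update_of_ne hy.ne']
  have hlim : Tendsto (fun z => -Function.update kerOne 0 1 z) atTop (𝓝 0) := by
    rw [← neg_zero]
    refine tendsto_kerOne_atTop.neg.congr' ?_
    filter_upwards [eventually_gt_atTop 0] with y hy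
    simp [Function.update_of_ne hy.ne']
  have hpos : ∀ x ∈ Ioi (0 : ℝ), 0 ≤ kerOneDensity x := fun x hx => (kerOneDensity_pos hx).le
  refine ⟨integrableOn_Ioi_deriv_of_nonneg h0 hev hpos hlim, ?_⟩
  rw [integral_Ioi_of_hasDerivAt_of_nonneg h0 hev hpos hlim]
  simp

/-- Layer-cake formula for a decreasing kernel `k` with density `w = -k'`. -/
lemma integral_kernel_eq {k w : ℝ → ℝ} (hw : ∀ z, 0 < z → 0 ≤ w z) (hwm : Measurable w)
    (hk : ∀ z, 0 < z → HasDerivAt k (-w z) z) (hk0 : Tendsto k atTop (𝓝 0))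
    (hkm : Measurable k) {μ : Measure ℝ} [SFinite μ]
    (hμ : μ (Iic 0) = 0) (hfin : ∀ c, μ (Iic c) ≠ ∞) {s : ℝ} (hs : 0 < s) :
    ∫ y, k (s * y) ∂μ = ∫ z in Ioi 0, w z * μ.real (Iic (z / s)) := by
  have hae : ∀ᵐ y ∂μ, 0 < y := by
    rw [ae_iff]; simpa [Iic, not_lt] using hμ
  have hrep : ∀ x : ℝ, 0 < x → IntegrableOn w (Ioi x) ∧ ∫ z in Ioi x, w z = k x := by
    intro x hx
    have h1 : ContinuousWithinAt (fun z => -k z) (Ici x) x :=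
      (hk x hx).continuousAt.neg.continuousWithinAt
    have h2 : ∀ z ∈ Ioi x, HasDerivAt (fun z => -k z) (w z) z := fun z hz => by
      have := (hk z (hx.trans hz)).neg
      rwa [neg_neg] at this
    have h3 : ∀ z ∈ Ioi x, 0 ≤ w z := fun z hz => hw z (hx.trans hz)
    have h4 : Tendsto (fun z => -k z) atTop (𝓝 0) := by simpa using hk0.neg
    refine ⟨integrableOn_Ioi_deriv_of_nonneg h1 h2 h3 h4, ?_⟩
    rw [integral_Ioi_of_hasDerivAt_of_nonneg h1 h2 h3 h4]; simp
  have hrepl : ∀ x : ℝ, 0 < x → ENNReal.ofReal (k x) = ∫⁻ z in Ici x, ENNReal.ofReal (w z) := by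
    intro x hx
    rw [← (hrep x hx).2, ofReal_integral_eq_lintegral_ofReal (hrep x hx).1,
      restrict_Ioi_eq_restrict_Ici]
    filter_upwards [ae_restrict_mem measurableSet_Ioi] with z hz using hw z (hx.trans hz)
  have hknn : ∀ x : ℝ, 0 < x → 0 ≤ k x := by
    intro x hx
    rw [← (hrep x hx).2]
    exact setIntegral_nonneg measurableSet_Ioi fun z hz => hw z (hx.trans hz)
  rw [integral_eq_lintegral_of_nonneg_ae, integral_eq_lintegral_of_nonneg_ae]
  · congr 1
    have e1 : ∫⁻ y, ENNReal.ofReal (k (s * y)) ∂μ =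
        ∫⁻ y, (∫⁻ z in Ioi 0, (Ici (s * y)).indicator (fun z => ENNReal.ofReal (w z)) z) ∂μ := by
      refine lintegral_congr_ae ?_
      filter_upwards [hae] with y hy
      have hsy : 0 < s * y := mul_pos hs hy
      rw [hrepl _ hsy, lintegral_indicator measurableSet_Ici, Measure.restrict_restrict
        measurableSet_Ici, inter_eq_left.2 (Ici_subset_Ioi.2 hsy)]
    rw [e1, lintegral_lintegral_swap]
    · refine lintegral_congr_ae ?_
      filter_upwards [ae_restrict_mem measurableSet_Ioi] with z hz
      have : ∀ y, (Ici (s * y)).indicator (fun z => ENNReal.ofReal (w z)) z =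
          (Iic (z / s)).indicator (fun _ => ENNReal.ofReal (w z)) y := by
        intro y
        simp only [indicator, mem_Ici, mem_Iic, le_div_iff₀ hs, mul_comm]
      simp_rw [this]
      rw [lintegral_indicator_const measurableSet_Iic, ENNReal.ofReal_mul (hw z hz),
        ofReal_measureReal (hfin _)]
    · have hset : MeasurableSet {p : ℝ × ℝ | s * p.1 ≤ p.2} :=
        measurableSet_le (by fun_prop) (by fun_prop)
      have : Function.uncurry (fun y z => (Ici (s * y)).indicator
          (fun z => ENNReal.ofReal (w z)) z) =
          {p : ℝ × ℝ | s * p.1 ≤ p.2}.indicator fun p => ENNReal.ofReal (w p.2) := by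
        ext ⟨y, z⟩; simp [indicator, Function.uncurry]
      rw [this]
      exact ((hwm.comp measurable_snd).ennreal_ofReal.indicator hset).aemeasurable
  · filter_upwards [ae_restrict_mem measurableSet_Ioi] with z hz
    exact mul_nonneg (hw z hz) measureReal_nonneg
  · refine (hwm.mul ?_).aestronglyMeasurable
    have hmono : Monotone fun c => μ.real (Iic c) := fun a b hab =>
      measureReal_mono (Iic_subset_Iic.2 hab) (hfin b)
    exact hmono.measurable.comp (measurable_id.div_const s)
  · filter_upwards [hae] with y hy using hknn _ (mul_pos hs hy)
  · exact (hkm.comp (measurable_const_mul s)).aestronglyMeasurable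

/-! ### Laplace exponents of probability measures on `(0, ∞)` -/

/-- The exponent `φ(s) = ∫ (1 - e^{-sx}) x⁻¹ m(dx)`; here `m` is the mass measure `x ν(dx)`. -/
noncomputable def lapExp (m : Measure ℝ) (s : ℝ) : ℝ := ∫ x, (1 - Real.exp (-(s * x))) / x ∂m

/-- The Laplace transform `ψ(s) = ∫ e^{-sx} m(dx)`. -/
noncomputable def lapTr (m : Measure ℝ) (s : ℝ) : ℝ := ∫ x, Real.exp (-(s * x)) ∂m

lemma ae_pos_of_null_Iic {m : Measure ℝ} (hm : m (Iic 0) = 0) : ∀ᵐ x ∂m, 0 < x := by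
  rw [ae_iff]; simpa [Iic, not_lt] using hm

/-- Strict monotonicity of the integral against a nonzero measure. -/
lemma integral_lt_integral_of_ae_lt {m : Measure ℝ} [IsProbabilityMeasure m] {f g : ℝ → ℝ}
    (hf : Integrable f m) (hg : Integrable g m) (h : ∀ᵐ x ∂m, f x < g x) :
    ∫ x, f x ∂m < ∫ x, g x ∂m := by
  rw [← sub_pos, ← integral_sub hg hf, integral_pos_iff_support_of_nonneg_ae (f := fun x => g x - f x)
    (h.mono fun x hx => by simpa using hx.le) (hg.sub hf)]
  have : Function.support (fun x => g x - f x) =ᵐ[m] univ := by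
    filter_upwards [h] with x hx
    exact eq_true (show x ∈ Function.support (fun x => g x - f x) by
      simpa using (sub_pos.2 hx).ne')
  rw [measure_congr this]; simp

lemma exp_kernel_bounds {a b x : ℝ} (hx : 0 < x) :
    Real.exp (-(b * x)) * (b - a) ≤
      (1 - Real.exp (-(b * x))) / x - (1 - Real.exp (-(a * x))) / x ∧
    (1 - Real.exp (-(b * x))) / x - (1 - Real.exp (-(a * x))) / x ≤
      Real.exp (-(a * x)) * (b - a) := by
  rw [← sub_div, le_div_iff₀ hx, div_le_iff₀ hx]
  have e1 : Real.exp (-(a * x)) = Real.exp (-(b * x)) * Real.exp ((b - a) * x) := by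
    rw [← Real.exp_add]; congr 1; ring
  have e2 : Real.exp (-(b * x)) = Real.exp (-(a * x)) * Real.exp (-((b - a) * x)) := by
    rw [← Real.exp_add]; congr 1; ring
  constructor
  · have := mul_le_mul_of_nonneg_left (Real.add_one_le_exp ((b - a) * x))
      (Real.exp_pos (-(b * x))).le
    rw [← e1] at this; linarith
  · have := mul_le_mul_of_nonneg_left (Real.add_one_le_exp (-((b - a) * x)))
      (Real.exp_pos (-(a * x))).le
    rw [← e2] at this; linarith

lemma lapExp_eq_mul_kerOne {m : Measure ℝ} {s : ℝ} (hs : 0 < s) :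
    lapExp m s = s * ∫ x, kerOne (s * x) ∂m := by
  rw [lapExp, ← integral_const_mul]
  congr 1; ext x
  rw [kerOne, ← mul_div_assoc, mul_div_mul_left _ _ hs.ne']

section LapExp
variable {m : Measure ℝ} [IsProbabilityMeasure m]

lemma integrable_lapTr (hm : m (Iic 0) = 0) {s : ℝ} (hs : 0 ≤ s) :
    Integrable (fun x => Real.exp (-(s * x))) m := by
  refine Integrable.of_bound (by fun_prop) 1 ?_
  filter_upwards [ae_pos_of_null_Iic hm] with x hx
  rw [Real.norm_eq_abs, Real.abs_exp, Real.exp_le_one_iff]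
  nlinarith

lemma integrable_lapExp (hm : m (Iic 0) = 0) {s : ℝ} (hs : 0 ≤ s) :
    Integrable (fun x => (1 - Real.exp (-(s * x))) / x) m := by
  refine Integrable.of_bound (Measurable.aestronglyMeasurable (by fun_prop)) s ?_
  filter_upwards [ae_pos_of_null_Iic hm] with x hx
  have h := exp_kernel_bounds (a := 0) (b := s) hx
  have h2 : 0 ≤ Real.exp (-(s * x)) * s := by positivity
  simp at h
  rw [Real.norm_eq_abs, abs_of_nonneg (h2.trans h.1)]; exact h.2

@[simp] lemma lapExp_zero (m : Measure ℝ) : lapExp m 0 = 0 := by simp [lapExp]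

lemma lapTr_mul_le (hm : m (Iic 0) = 0) {a b : ℝ} (ha : 0 ≤ a) (hab : a ≤ b) :
    lapTr m b * (b - a) ≤ lapExp m b - lapExp m a := by
  rw [lapTr, lapExp, lapExp, ← integral_mul_const,
    ← integral_sub (integrable_lapExp hm (ha.trans hab)) (integrable_lapExp hm ha)]
  refine integral_mono_ae ((integrable_lapTr hm (ha.trans hab)).mul_const _)
    ((integrable_lapExp hm (ha.trans hab)).sub (integrable_lapExp hm ha)) ?_
  filter_upwards [ae_pos_of_null_Iic hm] with x hx using (exp_kernel_bounds hx).1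

lemma le_lapTr_mul (hm : m (Iic 0) = 0) {a b : ℝ} (ha : 0 ≤ a) (hab : a ≤ b) :
    lapExp m b - lapExp m a ≤ lapTr m a * (b - a) := by
  rw [lapTr, lapExp, lapExp, ← integral_mul_const,
    ← integral_sub (integrable_lapExp hm (ha.trans hab)) (integrable_lapExp hm ha)]
  refine integral_mono_ae ((integrable_lapExp hm (ha.trans hab)).sub (integrable_lapExp hm ha))
    ((integrable_lapTr hm ha).mul_const _) ?_
  filter_upwards [ae_pos_of_null_Iic hm] with x hx using (exp_kernel_bounds hx).2

lemma lapTr_pos (hm : m (Iic 0) = 0) {s : ℝ} (hs : 0 ≤ s) : 0 < lapTr m s := by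
  have := integral_lt_integral_of_ae_lt (integrable_zero ℝ ℝ m) (integrable_lapTr hm hs)
    (ae_of_all _ fun x => Real.exp_pos _)
  simpa [lapTr] using this

lemma lapTr_le_one (hm : m (Iic 0) = 0) {s : ℝ} (hs : 0 ≤ s) : lapTr m s ≤ 1 := by
  have := integral_mono_ae (integrable_lapTr hm hs) (integrable_const (1 : ℝ)) (by
    filter_upwards [ae_pos_of_null_Iic hm] with x hx
    rw [Real.exp_le_one_iff]; nlinarith)
  simpa [lapTr] using this

lemma lapTr_anti (hm : m (Iic 0) = 0) {a b : ℝ} (ha : 0 ≤ a) (hab : a ≤ b) :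
    lapTr m b ≤ lapTr m a := by
  refine integral_mono_ae (integrable_lapTr hm (ha.trans hab)) (integrable_lapTr hm ha) ?_
  filter_upwards [ae_pos_of_null_Iic hm] with x hx
  exact Real.exp_le_exp.2 (by nlinarith)

lemma lapExp_strictMonoOn (hm : m (Iic 0) = 0) : StrictMonoOn (lapExp m) (Ici 0) := by
  intro a ha b hb hab
  have := lapTr_mul_le hm ha hab.le
  nlinarith [mul_pos (lapTr_pos hm hb) (sub_pos.2 hab)]

lemma lapExp_nonneg (hm : m (Iic 0) = 0) {s : ℝ} (hs : 0 ≤ s) : 0 ≤ lapExp m s := by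
  have := (lapExp_strictMonoOn hm).monotoneOn self_mem_Ici hs hs
  simpa using this

lemma lapExp_pos (hm : m (Iic 0) = 0) {s : ℝ} (hs : 0 < s) : 0 < lapExp m s := by
  have := (lapExp_strictMonoOn hm) self_mem_Ici hs.le hs
  simpa using this

lemma lapExp_sub_le (hm : m (Iic 0) = 0) {a b : ℝ} (ha : 0 ≤ a) (hab : a ≤ b) :
    lapExp m b - lapExp m a ≤ b - a := by
  have := le_lapTr_mul hm ha hab
  nlinarith [lapTr_le_one hm ha]

lemma lapExp_le_self (hm : m (Iic 0) = 0) {s : ℝ} (hs : 0 ≤ s) : lapExp m s ≤ s := by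
  simpa using lapExp_sub_le hm le_rfl hs

lemma abs_lapExp_sub_le (hm : m (Iic 0) = 0) {a b : ℝ} (ha : 0 ≤ a) (hb : 0 ≤ b) :
    |lapExp m a - lapExp m b| ≤ |a - b| := by
  rcases le_total a b with h | h
  · rw [abs_sub_comm, abs_sub_comm a b, abs_of_nonneg (sub_nonneg.2 h), abs_of_nonneg]
    · exact lapExp_sub_le hm ha h
    · exact sub_nonneg.2 ((lapExp_strictMonoOn hm).monotoneOn ha hb h)
  · rw [abs_of_nonneg (sub_nonneg.2 h), abs_of_nonneg]
    · exact lapExp_sub_le hm hb h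
    · exact sub_nonneg.2 ((lapExp_strictMonoOn hm).monotoneOn hb ha h)

lemma continuousOn_lapExp (hm : m (Iic 0) = 0) : ContinuousOn (lapExp m) (Ici 0) := by
  refine (LipschitzOnWith.of_dist_le_mul (K := 1) fun a ha b hb => ?_).continuousOn
  simpa [Real.dist_eq] using abs_lapExp_sub_le hm ha hb

lemma continuousOn_lapTr (hm : m (Iic 0) = 0) : ContinuousOn (lapTr m) (Ici 0) := by
  refine continuousOn_of_dominated (bound := fun _ => 1) (fun s _ => by fun_prop) ?_
    (integrable_const _) (ae_of_all _ fun x => by fun_prop)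
  intro s hs
  filter_upwards [ae_pos_of_null_Iic hm] with x hx
  rw [Real.norm_eq_abs, Real.abs_exp, Real.exp_le_one_iff]
  have := mul_nonneg (mem_Ici.1 hs) hx.le
  linarith

lemma hasDerivAt_lapExp (hm : m (Iic 0) = 0) {s : ℝ} (hs : 0 < s) :
    HasDerivAt (lapExp m) (lapTr m s) s := by
  refine (hasDerivAt_integral_of_dominated_loc_of_deriv_le (μ := m) (bound := fun _ => 1)
    (F := fun s x => (1 - Real.exp (-(s * x))) / x) (F' := fun s x => Real.exp (-(s * x)))
    (Ioi_mem_nhds hs)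
    (Eventually.of_forall fun r => Measurable.aestronglyMeasurable (by fun_prop))
    (integrable_lapExp hm hs.le) (Measurable.aestronglyMeasurable (by fun_prop)) ?_ (integrable_const _) ?_).2
  · filter_upwards [ae_pos_of_null_Iic hm] with x hx r hr
    rw [Real.norm_eq_abs, Real.abs_exp, Real.exp_le_one_iff]
    have := mul_pos (mem_Ioi.1 hr) hx
    linarith
  · filter_upwards [ae_pos_of_null_Iic hm] with x hx r hr
    have := ((((hasDerivAt_id r).mul_const x).neg.exp).const_sub 1).div_const x
    refine this.congr_deriv ?_
    simp only [id, Pi.neg_apply]; field_simp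

lemma integrable_kerOne (hm : m (Iic 0) = 0) {s : ℝ} (hs : 0 < s) :
    Integrable (fun x => kerOne (s * x)) m := by
  refine Integrable.of_bound (measurable_kerOne.comp (by fun_prop)).aestronglyMeasurable 1 ?_
  filter_upwards [ae_pos_of_null_Iic hm] with x hx
  rw [Real.norm_eq_abs, abs_of_nonneg (kerOne_nonneg (mul_pos hs hx))]
  exact kerOne_le_one (mul_pos hs hx)

lemma lapExp_div_strictAntiOn (hm : m (Iic 0) = 0) :
    StrictAntiOn (fun s => lapExp m s / s) (Ioi 0) := by
  intro a ha b hb hab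
  simp only [lapExp_eq_mul_kerOne (mem_Ioi.1 ha), lapExp_eq_mul_kerOne (mem_Ioi.1 hb),
    mul_div_cancel_left₀ _ (mem_Ioi.1 ha).ne', mul_div_cancel_left₀ _ (mem_Ioi.1 hb).ne']
  refine integral_lt_integral_of_ae_lt (integrable_kerOne hm hb) (integrable_kerOne hm ha) ?_
  filter_upwards [ae_pos_of_null_Iic hm] with x hx
  exact strictAntiOn_kerOne (mul_pos (mem_Ioi.1 ha) hx) (mul_pos (mem_Ioi.1 hb) hx) (by gcongr)

lemma tendsto_lapTr_zero (hm : m (Iic 0) = 0) : Tendsto (lapTr m) (𝓝[>] 0) (𝓝 1) := by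
  have h := (continuousOn_lapTr hm 0 self_mem_Ici).tendsto.mono_left
    (nhdsWithin_mono _ Ioi_subset_Ici_self)
  simpa [lapTr] using h

lemma tendsto_lapExp_div_zero (hm : m (Iic 0) = 0) :
    Tendsto (fun s => lapExp m s / s) (𝓝[>] 0) (𝓝 1) := by
  refine tendsto_of_tendsto_of_tendsto_of_le_of_le' (tendsto_lapTr_zero hm) tendsto_const_nhds ?_ ?_
  · filter_upwards [self_mem_nhdsWithin] with s hs
    rw [le_div_iff₀ hs]; simpa using lapTr_mul_le hm le_rfl (mem_Ioi.1 hs).le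
  · filter_upwards [self_mem_nhdsWithin] with s hs
    rw [div_le_one hs]; exact lapExp_le_self hm (mem_Ioi.1 hs).le

lemma lapExp_lt_self (hm : m (Iic 0) = 0) {s : ℝ} (hs : 0 < s) : lapExp m s < s := by
  have h1 := lapExp_div_strictAntiOn hm (half_pos hs) hs (half_lt_self hs)
  have h2 : lapExp m (s / 2) / (s / 2) ≤ 1 := by
    rw [div_le_one (half_pos hs)]; exact lapExp_le_self hm (half_pos hs).le
  simpa [div_lt_one hs] using h1.trans_le h2

lemma tendsto_lapExp_div_atTop (hm : m (Iic 0) = 0) :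
    Tendsto (fun s => lapExp m s / s) atTop (𝓝 0) := by
  have h : Tendsto (fun s => ∫ x, kerOne (s * x) ∂m) atTop (𝓝 (∫ _, 0 ∂m)) := by
    refine tendsto_integral_filter_of_dominated_convergence (fun _ => 1)
      (Eventually.of_forall fun s =>
        (measurable_kerOne.comp (measurable_const_mul s)).aestronglyMeasurable) ?_
      (integrable_const _) ?_
    · filter_upwards [eventually_gt_atTop 0] with s hs
      filter_upwards [ae_pos_of_null_Iic hm] with x hx
      rw [Real.norm_eq_abs, abs_of_nonneg (kerOne_nonneg (mul_pos hs hx))]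
      exact kerOne_le_one (mul_pos hs hx)
    · filter_upwards [ae_pos_of_null_Iic hm] with x hx
      exact tendsto_kerOne_atTop.comp (tendsto_id.atTop_mul_const hx)
  rw [integral_zero] at h
  refine h.congr' ?_
  filter_upwards [eventually_gt_atTop 0] with s hs
  rw [lapExp_eq_mul_kerOne hs, mul_div_cancel_left₀ _ hs.ne']

end LapExp

/-! ### The mass measure -/

/-- The mass measure `x ν(dx)`. -/
noncomputable def massMeasure (ν : Measure ℝ) : Measure ℝ :=
  ν.withDensity fun x => ENNReal.ofReal x

lemma massMeasure_null {ν : Measure ℝ} (h0 : ν (Iic 0) = 0) : massMeasure ν (Iic 0) = 0 :=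
  withDensity_absolutelyContinuous _ _ h0

lemma isProbabilityMeasure_massMeasure {ν : Measure ℝ} (h : totalMass ν = 1) :
    IsProbabilityMeasure (massMeasure ν) :=
  ⟨by rw [massMeasure, withDensity_apply _ MeasurableSet.univ, Measure.restrict_univ]; exact h⟩

lemma integral_massMeasure {ν : Measure ℝ} (h0 : ν (Iic 0) = 0) (g : ℝ → ℝ) :
    ∫ x, g x ∂(massMeasure ν) = ∫ x, x * g x ∂ν := by
  rw [massMeasure, integral_withDensity_eq_integral_toReal_smul (by fun_prop)
    (ae_of_all _ fun x => ENNReal.ofReal_lt_top)]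
  refine integral_congr_ae ?_
  filter_upwards [ae_pos_of_null_Iic h0] with x hx
  rw [ENNReal.toReal_ofReal hx.le, smul_eq_mul]

lemma lapExp_massMeasure {ν : Measure ℝ} (h0 : ν (Iic 0) = 0) (s : ℝ) :
    lapExp (massMeasure ν) s = ∫ x, (1 - Real.exp (-(s * x))) ∂ν := by
  rw [lapExp, integral_massMeasure h0]
  refine integral_congr_ae ?_
  filter_upwards [ae_pos_of_null_Iic h0] with x hx
  field_simp

lemma lapTr_massMeasure {ν : Measure ℝ} (h0 : ν (Iic 0) = 0) (s : ℝ) :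
    lapTr (massMeasure ν) s = ∫ x, x * Real.exp (-(s * x)) ∂ν := by
  rw [lapTr, integral_massMeasure h0]

lemma massDist_eq {ν : Measure ℝ} (h0 : ν (Iic 0) = 0) (x : ℝ) :
    massDist ν x = (massMeasure ν).real (Iic x) := by
  have h1 : ν.restrict (Ioc 0 x) = ν.restrict (Iic x) := by
    refine Measure.restrict_congr_set ?_
    filter_upwards [ae_pos_of_null_Iic h0] with y hy
    exact propext ⟨fun h => h.2, fun h => ⟨hy, h⟩⟩
  rw [massDist, h1, measureReal_def, massMeasure, withDensity_apply _ measurableSet_Iic,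
    integral_eq_lintegral_of_nonneg_ae _ measurable_id'.aestronglyMeasurable]
  exact ae_restrict_of_ae ((ae_pos_of_null_Iic h0).mono fun y hy => hy.le)

lemma truncSecondMoment_eq {ν : Measure ℝ} (h0 : ν (Iic 0) = 0) (x : ℝ) :
    truncSecondMoment ν x = ∫ y in Iic x, y ∂(massMeasure ν) := by
  rw [truncSecondMoment, ← integral_indicator measurableSet_Iic, integral_massMeasure h0,
    ← integral_indicator measurableSet_Ioc]
  refine integral_congr_ae ?_
  filter_upwards [ae_pos_of_null_Iic h0] with y hy
  by_cases h : y ≤ x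
  · simp [indicator, hy, h]; ring
  · simp [indicator, h]

lemma integrable_id_of_totalMass {ν : Measure ℝ} (h0 : ν (Iic 0) = 0) (h : totalMass ν < ∞) :
    Integrable (fun x => x) ν := by
  refine ⟨measurable_id.aestronglyMeasurable, ?_⟩
  refine lt_of_le_of_lt (lintegral_mono_ae ?_) h
  filter_upwards [ae_pos_of_null_Iic h0] with x hx
  rw [← ofReal_norm, Real.norm_eq_abs, abs_of_pos hx]

/-! ### The coagulation functional on exponentials -/

lemma isTestFunction_exp {s : ℝ} (hs : 0 < s) :
    IsTestFunction fun x => 1 - Real.exp (-(s * x)) := by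
  have hd : deriv (fun x => 1 - Real.exp (-(s * x))) = fun x => s * Real.exp (-(s * x)) := by
    ext x
    have := (((hasDerivAt_id x).const_mul s).neg.exp).const_sub 1
    rw [show (fun x => 1 - Real.exp (-(s * x))) =
      (fun x => 1 - Real.exp ((-fun y => s * id y) x)) from rfl, this.deriv]
    simp only [id, Pi.neg_apply]; ring
  have hexp : Tendsto (fun x => Real.exp (-(s * x))) atTop (𝓝 0) :=
    Real.tendsto_exp_neg_atTop_nhds_zero.comp (tendsto_id.const_mul_atTop hs)
  refine ⟨ContDiff.contDiffOn (by fun_prop), ?_, ⟨1, ?_⟩, ?_, ?_, ⟨s, s, hs, ?_⟩⟩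
  · have : Continuous fun x => 1 - Real.exp (-(s * x)) := by fun_prop
    have h := this.tendsto 0
    simp only [mul_zero, neg_zero, Real.exp_zero, sub_self] at h
    exact h.mono_left nhdsWithin_le_nhds
  · simpa using hexp.const_sub 1
  · rw [hd]
    have : Continuous fun x => s * Real.exp (-(s * x)) := by fun_prop
    exact ⟨_, (this.tendsto 0).mono_left nhdsWithin_le_nhds⟩
  · rw [hd]; exact ⟨_, hexp.const_mul s⟩
  · intro x _
    rw [hd, abs_of_pos (by positivity)]
    simp

lemma one_sub_exp_bounds {s x : ℝ} (hs : 0 < s) (hx : 0 < x) :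
    0 ≤ 1 - Real.exp (-(s * x)) ∧ 1 - Real.exp (-(s * x)) ≤ s * x := by
  have h := Real.add_one_le_exp (-(s * x))
  have h2 : Real.exp (-(s * x)) ≤ 1 := by
    rw [Real.exp_le_one_iff]; nlinarith [mul_pos hs hx]
  constructor <;> linarith

lemma integrable_one_sub_exp {ν : Measure ℝ} (h0 : ν (Iic 0) = 0) (h : totalMass ν < ∞)
    {s : ℝ} (hs : 0 < s) : Integrable (fun x => 1 - Real.exp (-(s * x))) ν := by
  refine ((integrable_id_of_totalMass h0 h).const_mul s).mono' (by fun_prop) ?_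
  filter_upwards [ae_pos_of_null_Iic h0] with x hx
  rw [Real.norm_eq_abs, abs_of_nonneg (one_sub_exp_bounds hs hx).1]
  exact (one_sub_exp_bounds hs hx).2

lemma integrable_mul_one_sub_exp {ν : Measure ℝ} (h0 : ν (Iic 0) = 0) (h : totalMass ν < ∞)
    {s : ℝ} (hs : 0 < s) : Integrable (fun x => x * (1 - Real.exp (-(s * x)))) ν := by
  refine (integrable_id_of_totalMass h0 h).mono' (by fun_prop) ?_
  filter_upwards [ae_pos_of_null_Iic h0] with x hx
  have h1 := one_sub_exp_bounds hs hx
  rw [Real.norm_eq_abs, abs_of_nonneg (mul_nonneg hx.le h1.1)]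
  nlinarith [Real.exp_pos (-(s * x))]

/-- The increment of `1 - e^{-sx}` factorizes as `-(1 - e^{-sx}) (1 - e^{-sy})`, and so does the
coagulation functional. -/
lemma coagulation_exp {ν : Measure ℝ} (h0 : ν (Iic 0) = 0) (h : totalMass ν < ∞)
    {s : ℝ} (hs : 0 < s) :
    coagulation (fun x => 1 - Real.exp (-(s * x))) ν =
      -((∫ x, (1 - Real.exp (-(s * x))) ∂ν) * ∫ x, x * (1 - Real.exp (-(s * x))) ∂ν) := by
  have ha := integrable_one_sub_exp h0 h hs
  have hb := integrable_mul_one_sub_exp h0 h hs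
  set A := ∫ x, (1 - Real.exp (-(s * x))) ∂ν with hA
  set B := ∫ x, x * (1 - Real.exp (-(s * x))) ∂ν with hB
  have inner : ∀ x, ∫ y, ((1 - Real.exp (-(s * (x + y)))) - (1 - Real.exp (-(s * x))) -
      (1 - Real.exp (-(s * y)))) * (x + y) ∂ν =
      -(x * (1 - Real.exp (-(s * x))) * A + (1 - Real.exp (-(s * x))) * B) := by
    intro x
    rw [hA, hB, ← integral_const_mul, ← integral_const_mul,
      ← integral_add (ha.const_mul _) (hb.const_mul _), ← integral_neg]
    congr 1; ext y
    rw [show -(s * (x + y)) = -(s * x) + -(s * y) by ring, Real.exp_add]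
    ring
  rw [coagulation]
  simp_rw [inner]
  rw [integral_neg, integral_add (hb.mul_const _) (ha.mul_const _), integral_mul_const,
    integral_mul_const, ← hA, ← hB]
  ring

/-! ### Measurability and conservation of mass -/

namespace IsSolution
variable {ν : ℝ → Measure ℝ}

/-- Measurability in time is extended from compact to Borel sets, by the `π`-`λ` theorem inside
each of the compact intervals `[1/(n+1), n+1]`. -/
lemma measurable_measure (hν : IsSolution ν) : Measurable fun t : Ici (0 : ℝ) => ν t := by
  set K : ℕ → Set ℝ := fun n => Icc (1 / (n + 1 : ℝ)) (n + 1) with hK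
  have hKc : ∀ n, IsCompact (K n) := fun n => isCompact_Icc
  have hKpos : ∀ n, K n ⊆ Ioi 0 := fun n x hx =>
    lt_of_lt_of_le (by positivity : (0 : ℝ) < 1 / (n + 1 : ℝ)) hx.1
  have hKm : ∀ n, MeasurableSet (K n) := fun n => measurableSet_Icc
  have hfin : ∀ (n : ℕ) (t : Ici (0 : ℝ)), ν t (K n) < ∞ := fun n t =>
    (hν.radon t t.2).finite_compact _ (hKc n) (hKpos n)
  have step : ∀ n : ℕ, ∀ B : Set ℝ, MeasurableSet B →
      Measurable fun t : Ici (0 : ℝ) => ν t (B ∩ K n) := by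
    intro n B hB
    refine MeasurableSpace.induction_on_inter (C := fun B _ => Measurable fun t : Ici (0 : ℝ) =>
      ν t (B ∩ K n)) (BorelSpace.measurable_eq.trans borel_eq_generateFrom_isClosed)
      isPiSystem_isClosed ?_ ?_ ?_ ?_ B hB
    · simp
    · intro C hC
      exact hν.measurable _ ((hKc n).inter_left hC) (inter_subset_right.trans (hKpos n))
    · intro C hC ih
      have : ∀ t : Ici (0 : ℝ), ν t (Cᶜ ∩ K n) = ν t (K n) - ν t (C ∩ K n) := by
        intro t
        rw [← measure_sdiff inter_subset_right (hC.inter (hKm n)).nullMeasurableSet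
          ((measure_mono inter_subset_right).trans_lt (hfin n t)).ne]
        congr 1; ext x; simp; tauto
      simp_rw [this]
      exact (hν.measurable _ (hKc n) (hKpos n)).sub ih
    · intro f hd hf ih
      have : ∀ t : Ici (0 : ℝ), ν t ((⋃ i, f i) ∩ K n) = ∑' i, ν t (f i ∩ K n) := by
        intro t
        rw [iUnion_inter, measure_iUnion]
        · exact fun i j hij => (hd hij).mono inter_subset_left inter_subset_left
        · exact fun i => (hf i).inter (hKm n)
      simp_rw [this]
      exact Measurable.tsum ih
  refine Measure.measurable_of_measurable_coe _ fun B hB => ?_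
  have hmono : Monotone fun n => B ∩ K n := by
    intro a b hab
    refine inter_subset_inter_right _ (Icc_subset_Icc ?_ (by gcongr))
    gcongr
  have : ∀ t : Ici (0 : ℝ), ν t B = ⨆ n, ν t (B ∩ K n) := by
    intro t
    rw [← hmono.measure_iUnion]
    refine measure_congr ?_
    filter_upwards [ae_pos_of_null_Iic (hν.radon t t.2).null_nonpos] with x hx
    refine propext ⟨fun h => mem_iUnion.2 ?_, fun h => ?_⟩
    · obtain ⟨n, hn⟩ := exists_nat_ge (max x (1 / x))
      refine ⟨n, h, ?_, ?_⟩
      · rw [one_div_le (by positivity) hx]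
        linarith [le_max_right x (1 / x)]
      · linarith [le_max_left x (1 / x)]
    · obtain ⟨n, hn⟩ := mem_iUnion.1 h
      exact hn.1
  simp_rw [this]
  exact Measurable.iSup fun n => step n B hB

/-- Frozen at time `0` for negative times, the solution is measurable on the whole line. -/
lemma measurable_max (hν : IsSolution ν) : Measurable fun t : ℝ => ν (max t 0) :=
  hν.measurable_measure.comp (f := fun t : ℝ => (⟨max t 0, mem_Ici.2 (le_max_right t 0)⟩ : Ici (0 : ℝ)))
    (Measurable.subtype_mk (by fun_prop))

lemma measurable_integral (hν : IsSolution ν) {g : ℝ → ℝ} (hg : Measurable g)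
    (hg0 : ∀ x, 0 < x → 0 ≤ g x) : Measurable fun t : ℝ => ∫ x, g x ∂(ν (max t 0)) := by
  have : ∀ t : ℝ, ∫ x, g x ∂(ν (max t 0)) =
      (∫⁻ x, ENNReal.ofReal (g x) ∂(ν (max t 0))).toReal := by
    intro t
    rw [integral_eq_lintegral_of_nonneg_ae _ hg.aestronglyMeasurable]
    filter_upwards [ae_pos_of_null_Iic (hν.radon _ (le_max_right t 0)).null_nonpos] with x hx
      using hg0 x hx
  simp_rw [this]
  exact ((Measure.measurable_lintegral hg.ennreal_ofReal).comp hν.measurable_max).ennreal_toReal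

/-- A priori the mass is finite only at almost every time, by square integrability. -/
lemma ae_totalMass_lt_top (hν : IsSolution ν) {t : ℝ} (ht : 0 < t) :
    ∀ᵐ τ ∂volume.restrict (Ioc 0 t), totalMass (ν τ) < ∞ := by
  have hm : Measurable fun τ : ℝ => totalMass (ν (max τ 0)) :=
    (Measure.measurable_lintegral (by fun_prop)).comp hν.measurable_max
  have h1 : ∫⁻ τ in Ioc 0 t, totalMass (ν (max τ 0)) ^ 2 ≠ ∞ := by
    rw [setLIntegral_congr_fun (g := fun τ => totalMass (ν τ) ^ 2) measurableSet_Ioc]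
    · exact (hν.mass_sq t ht).ne
    · intro τ hτ; simp only [max_eq_left hτ.1.le]
  filter_upwards [ae_lt_top (hm.pow_const 2) h1, ae_restrict_mem measurableSet_Ioc] with τ h hτ
  rw [max_eq_left hτ.1.le] at h
  by_contra hc
  rw [not_lt, top_le_iff] at hc
  simp [hc] at h

/-- The bound `φ(t,s) ≤ φ(0,s) ≤ s`, since the coagulation functional of `1 - e^{-sx}` is
nonpositive. -/
lemma integral_exp_le (hν : IsSolution ν) (h1 : totalMass (ν 0) = 1) {t s : ℝ} (ht : 0 ≤ t)
    (hs : 0 < s) : ∫ x, (1 - Real.exp (-(s * x))) ∂(ν t) ≤ s := by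
  have h0 := (hν.radon 0 le_rfl).null_nonpos
  have := isProbabilityMeasure_massMeasure h1
  have hle := lapExp_le_self (massMeasure_null h0) hs.le
  rw [lapExp_massMeasure h0] at hle
  rcases ht.eq_or_lt with rfl | ht
  · exact hle
  have hw := hν.weak _ (isTestFunction_exp hs) t ht.le
  have hneg : ∫ τ in (0 : ℝ)..t, coagulation (fun x => 1 - Real.exp (-(s * x))) (ν τ) ≤ 0 := by
    rw [intervalIntegral.integral_of_le ht.le]
    refine integral_nonpos_of_ae ?_
    filter_upwards [hν.ae_totalMass_lt_top ht, ae_restrict_mem measurableSet_Ioc] with τ hτ hτ0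
    have hn := (hν.radon τ hτ0.1.le).null_nonpos
    rw [coagulation_exp hn hτ hs]
    simp only [Pi.zero_apply, Left.neg_nonpos_iff]
    refine mul_nonneg (integral_nonneg_of_ae ?_) (integral_nonneg_of_ae ?_)
    · filter_upwards [ae_pos_of_null_Iic hn] with x hx using (one_sub_exp_bounds hs hx).1
    · filter_upwards [ae_pos_of_null_Iic hn] with x hx
        using mul_nonneg hx.le (one_sub_exp_bounds hs hx).1
  linarith

lemma tendsto_mul_one_sub_exp (x : ℝ) :
    Tendsto (fun n : ℕ => (n + 1 : ℝ) * (1 - Real.exp (-(1 / (n + 1 : ℝ) * x)))) atTop (𝓝 x) := by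
  have h := hasDerivAt_iff_tendsto_slope_zero.1
    ((((hasDerivAt_id (0 : ℝ)).mul_const x).neg.exp).const_sub 1)
  simp only [id, Pi.neg_apply, zero_add, zero_mul, neg_zero, Real.exp_zero, one_mul, sub_self,
    sub_zero, neg_neg, smul_eq_mul] at h
  have h2 : Tendsto (fun n : ℕ => 1 / (n + 1 : ℝ)) atTop (𝓝[≠] 0) := by
    refine tendsto_nhdsWithin_iff.2 ⟨tendsto_one_div_add_atTop_nhds_zero_nat, ?_⟩
    exact Eventually.of_forall fun n => by
      have : (0 : ℝ) < 1 / (n + 1 : ℝ) := by positivity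
      exact this.ne'
  refine (h.comp h2).congr fun n => ?_
  simp [Function.comp]

/-- Fatou's lemma as `s → 0` in `φ(t,s)/s ≤ 1`; in particular the mass is finite at all times. -/
lemma totalMass_le_one (hν : IsSolution ν) (h1 : totalMass (ν 0) = 1) {t : ℝ} (ht : 0 ≤ t) :
    totalMass (ν t) ≤ 1 := by
  have hn := (hν.radon t ht).null_nonpos
  have hb : ∀ n : ℕ, ∫⁻ x, ENNReal.ofReal ((n + 1 : ℝ) *
      (1 - Real.exp (-(1 / (n + 1 : ℝ) * x)))) ∂(ν t) ≤ 1 := by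
    intro n
    have hs : (0 : ℝ) < 1 / (n + 1 : ℝ) := by positivity
    rw [← ofReal_integral_eq_lintegral_ofReal ((hν.integrable _ (isTestFunction_exp hs) t
      ht).const_mul _), integral_const_mul]
    · rw [← ENNReal.ofReal_one]
      refine ENNReal.ofReal_le_ofReal ?_
      have := hν.integral_exp_le h1 ht hs
      calc _ ≤ (n + 1 : ℝ) * (1 / (n + 1 : ℝ)) := by gcongr
        _ = 1 := by field_simp
    · filter_upwards [ae_pos_of_null_Iic hn] with x hx
      exact mul_nonneg (by positivity) (one_sub_exp_bounds hs hx).1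
  calc totalMass (ν t) = ∫⁻ x, liminf (fun n : ℕ => ENNReal.ofReal ((n + 1 : ℝ) *
      (1 - Real.exp (-(1 / (n + 1 : ℝ) * x))))) atTop ∂(ν t) := by
        refine lintegral_congr fun x => ?_
        exact ((ENNReal.tendsto_ofReal (tendsto_mul_one_sub_exp x)).liminf_eq).symm
    _ ≤ liminf (fun n : ℕ => ∫⁻ x, ENNReal.ofReal ((n + 1 : ℝ) *
      (1 - Real.exp (-(1 / (n + 1 : ℝ) * x)))) ∂(ν t)) atTop :=
        lintegral_liminf_le fun n => by fun_prop
    _ ≤ 1 := by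
        refine liminf_le_of_le (by isBoundedDefault) fun b hb' => ?_
        obtain ⟨n, hn⟩ := hb'.exists
        exact hn.trans (hb n)

lemma coagulation_exp_bounds {μ : Measure ℝ} (h0 : μ (Iic 0) = 0) (h : totalMass μ ≤ 1)
    {s : ℝ} (hs : 0 < s) :
    0 ≤ (∫ x, (1 - Real.exp (-(s * x))) ∂μ) ∧ (∫ x, (1 - Real.exp (-(s * x))) ∂μ) ≤ s ∧
    0 ≤ (∫ x, x * (1 - Real.exp (-(s * x))) ∂μ) ∧
    (∫ x, x * (1 - Real.exp (-(s * x))) ∂μ) ≤ 1 := by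
  have hfin : totalMass μ < ∞ := h.trans_lt ENNReal.one_lt_top
  have hid := integrable_id_of_totalMass h0 hfin
  have hae := ae_pos_of_null_Iic h0
  have hle1 : ∫ x, x ∂μ ≤ 1 := by
    rw [integral_eq_lintegral_of_nonneg_ae (hae.mono fun x hx => hx.le)
      measurable_id.aestronglyMeasurable]
    exact ENNReal.toReal_le_of_le_ofReal zero_le_one (by simpa [totalMass] using h)
  refine ⟨integral_nonneg_of_ae ?_, ?_, integral_nonneg_of_ae ?_, ?_⟩
  · filter_upwards [hae] with x hx using (one_sub_exp_bounds hs hx).1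
  · calc _ ≤ ∫ x, s * x ∂μ := by
          refine integral_mono_ae (integrable_one_sub_exp h0 hfin hs) (hid.const_mul s) ?_
          filter_upwards [hae] with x hx using (one_sub_exp_bounds hs hx).2
      _ ≤ s := by rw [integral_const_mul]; nlinarith
  · filter_upwards [hae] with x hx using mul_nonneg hx.le (one_sub_exp_bounds hs hx).1
  · refine le_trans (integral_mono_ae (integrable_mul_one_sub_exp h0 hfin hs) hid ?_) hle1
    filter_upwards [hae] with x hx
    nlinarith [Real.exp_pos (-(s * x))]

lemma tendsto_integral_mul_one_sub_exp {μ : Measure ℝ} (h0 : μ (Iic 0) = 0)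
    (h : totalMass μ < ∞) :
    Tendsto (fun n : ℕ => ∫ x, x * (1 - Real.exp (-(1 / (n + 1 : ℝ) * x))) ∂μ) atTop (𝓝 0) := by
  have : Tendsto (fun n : ℕ => ∫ x, x * (1 - Real.exp (-(1 / (n + 1 : ℝ) * x))) ∂μ) atTop
      (𝓝 (∫ _, 0 ∂μ)) := by
    refine tendsto_integral_of_dominated_convergence (fun x => x) (fun n => by fun_prop)
      (integrable_id_of_totalMass h0 h) ?_ ?_
    · intro n
      filter_upwards [ae_pos_of_null_Iic h0] with x hx
      have hs : (0 : ℝ) < 1 / (n + 1 : ℝ) := by positivity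
      have h1 := one_sub_exp_bounds hs hx
      rw [Real.norm_eq_abs, abs_of_nonneg (mul_nonneg hx.le h1.1)]
      nlinarith [Real.exp_pos (-(1 / (n + 1 : ℝ) * x))]
    · refine ae_of_all _ fun x => ?_
      have hc : Continuous fun s : ℝ => x * (1 - Real.exp (-(s * x))) := by fun_prop
      have := (hc.tendsto 0).comp tendsto_one_div_add_atTop_nhds_zero_nat
      simpa [Function.comp_def] using this
  simpa using this

/-- The integrated form of `∂ₜφ = -φ (1 - ∂ₛφ)`, before conservation of mass is known. -/
lemma integral_exp_eq (hν : IsSolution ν) (h1 : totalMass (ν 0) = 1) {t s : ℝ} (ht : 0 ≤ t)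
    (hs : 0 < s) : ∫ x, (1 - Real.exp (-(s * x))) ∂(ν t) =
      ∫ x, (1 - Real.exp (-(s * x))) ∂(ν 0) -
      ∫ τ in (0 : ℝ)..t, (∫ x, (1 - Real.exp (-(s * x))) ∂(ν (max τ 0))) *
        ∫ x, x * (1 - Real.exp (-(s * x))) ∂(ν (max τ 0)) := by
  rw [hν.weak _ (isTestFunction_exp hs) t ht, sub_eq_add_neg, ← intervalIntegral.integral_neg]
  congr 1
  refine intervalIntegral.integral_congr fun τ hτ => ?_
  rw [uIcc_of_le ht] at hτ
  simp only [max_eq_left hτ.1]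
  exact coagulation_exp (hν.radon τ hτ.1).null_nonpos
    ((hν.totalMass_le_one h1 hτ.1).trans_lt ENNReal.one_lt_top) hs

/-- **Conservation of mass**: `φ(t,s)/s` has the same limit as `s → 0` for all times, because the
time integral in `integral_exp_eq`, divided by `s`, vanishes in the limit by dominated
convergence. -/
theorem totalMass_eq_one (hν : IsSolution ν) (h1 : totalMass (ν 0) = 1) {t : ℝ} (ht : 0 ≤ t) :
    totalMass (ν t) = 1 := by
  have key : ∀ τ : ℝ, 0 ≤ τ → Tendsto (fun n : ℕ => (n + 1 : ℝ) *
      ∫ x, (1 - Real.exp (-(1 / (n + 1 : ℝ) * x))) ∂(ν τ)) atTop (𝓝 (totalMass (ν τ)).toReal) := by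
    intro τ hτ
    have hn := (hν.radon τ hτ).null_nonpos
    have hid := integrable_id_of_totalMass hn
      ((hν.totalMass_le_one h1 hτ).trans_lt ENNReal.one_lt_top)
    have e : (totalMass (ν τ)).toReal = ∫ x, x ∂(ν τ) := by
      rw [integral_eq_lintegral_of_nonneg_ae ((ae_pos_of_null_Iic hn).mono fun x hx => hx.le)
        measurable_id.aestronglyMeasurable]; rfl
    rw [e]
    simp_rw [← integral_const_mul]
    refine tendsto_integral_of_dominated_convergence (fun x => x) (fun n => by fun_prop) hid ?_
      (ae_of_all _ fun x => tendsto_mul_one_sub_exp x)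
    intro n
    filter_upwards [ae_pos_of_null_Iic hn] with x hx
    have hs : (0 : ℝ) < 1 / (n + 1 : ℝ) := by positivity
    have hb := one_sub_exp_bounds hs hx
    rw [Real.norm_eq_abs, abs_of_nonneg (mul_nonneg (by positivity) hb.1)]
    calc _ ≤ (n + 1 : ℝ) * (1 / (n + 1 : ℝ) * x) := by gcongr; exact hb.2
      _ = x := by field_simp
  have hlim : Tendsto (fun n : ℕ => ∫ τ in (0 : ℝ)..t, (n + 1 : ℝ) *
      ((∫ x, (1 - Real.exp (-(1 / (n + 1 : ℝ) * x))) ∂(ν (max τ 0))) *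
        ∫ x, x * (1 - Real.exp (-(1 / (n + 1 : ℝ) * x))) ∂(ν (max τ 0)))) atTop
      (𝓝 (∫ τ in (0 : ℝ)..t, (0 : ℝ))) := by
    have hcb := fun (n : ℕ) (τ : ℝ) => coagulation_exp_bounds
      (hν.radon _ (le_max_right τ 0)).null_nonpos (hν.totalMass_le_one h1 (le_max_right τ 0))
      (show (0 : ℝ) < 1 / (n + 1 : ℝ) by positivity)
    have hA : ∀ (n : ℕ) (τ : ℝ), (n + 1 : ℝ) *
        (∫ x, (1 - Real.exp (-(1 / (n + 1 : ℝ) * x))) ∂(ν (max τ 0))) ≤ 1 := by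
      intro n τ
      calc _ ≤ (n + 1 : ℝ) * (1 / (n + 1 : ℝ)) := by gcongr; exact (hcb n τ).2.1
        _ = 1 := by field_simp
    refine intervalIntegral.tendsto_integral_filter_of_dominated_convergence (fun _ => 1) ?_ ?_
      intervalIntegrable_const ?_
    · refine Eventually.of_forall fun n => Measurable.aestronglyMeasurable ?_
      have hs : (0 : ℝ) < 1 / (n + 1 : ℝ) := by positivity
      exact ((hν.measurable_integral (by fun_prop) fun x hx => (one_sub_exp_bounds hs hx).1).mul
        (hν.measurable_integral (by fun_prop) fun x hx =>
          mul_nonneg hx.le (one_sub_exp_bounds hs hx).1)).const_mul _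
    · refine Eventually.of_forall fun n => ae_of_all _ fun τ _ => ?_
      obtain ⟨c1, c2, c3, c4⟩ := hcb n τ
      rw [Real.norm_eq_abs, ← mul_assoc, abs_of_nonneg (by positivity)]
      exact mul_le_one₀ (hA n τ) c3 c4
    · refine ae_of_all _ fun τ _ => ?_
      refine squeeze_zero (fun n => ?_) (fun n => ?_) (tendsto_integral_mul_one_sub_exp
        (hν.radon _ (le_max_right τ 0)).null_nonpos
        ((hν.totalMass_le_one h1 (le_max_right τ 0)).trans_lt ENNReal.one_lt_top))
      · obtain ⟨c1, c2, c3, c4⟩ := hcb n τ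
        positivity
      · obtain ⟨c1, c2, c3, c4⟩ := hcb n τ
        rw [← mul_assoc]
        exact mul_le_of_le_one_left c3 (hA n τ)
  have h2 := (key 0 le_rfl).sub hlim
  rw [intervalIntegral.integral_zero, sub_zero] at h2
  have h3 := tendsto_nhds_unique (h2.congr fun n => ?_) (key t ht)
  · rw [h1, ENNReal.toReal_one] at h3
    rw [← ENNReal.toReal_eq_one_iff]; exact h3.symm
  · rw [intervalIntegral.integral_const_mul, ← mul_sub,
      ← hν.integral_exp_eq h1 ht (by positivity)]

end IsSolution
/-! ### Solution by characteristics -/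

/-- A family of probability measures on `(0, ∞)` whose Laplace exponents solve
`∂ₜφ = -φ (1 - ∂ₛφ)` in integrated form, extended by a constant to negative times. -/
structure IsLapFlow (m : ℝ → Measure ℝ) : Prop where
  prob : ∀ t, IsProbabilityMeasure (m t)
  null : ∀ t, m t (Iic 0) = 0
  const : ∀ t, t ≤ 0 → m t = m 0
  measurable_lapExp : ∀ s, 0 < s → Measurable fun t => lapExp (m t) s
  measurable_lapTr : ∀ s, 0 < s → Measurable fun t => lapTr (m t) s
  flow : ∀ t s, 0 ≤ t → 0 < s → lapExp (m t) s =
    lapExp (m 0) s - ∫ τ in (0 : ℝ)..t, lapExp (m τ) s * (1 - lapTr (m τ) s)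

namespace IsLapFlow
variable {m : ℝ → Measure ℝ}

lemma rate_bounds (h : IsLapFlow m) (τ : ℝ) {s : ℝ} (hs : 0 < s) :
    0 ≤ lapExp (m τ) s * (1 - lapTr (m τ) s) ∧ lapExp (m τ) s * (1 - lapTr (m τ) s) ≤ s := by
  have := h.prob τ
  have h1 := lapExp_nonneg (h.null τ) hs.le
  have h2 := lapExp_le_self (h.null τ) hs.le
  have h3 := lapTr_le_one (h.null τ) hs.le
  have h4 := lapTr_pos (h.null τ) hs.le
  refine ⟨mul_nonneg h1 (by linarith), ?_⟩
  nlinarith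

lemma intervalIntegrable (h : IsLapFlow m) {s : ℝ} (hs : 0 < s) (a b : ℝ) :
    IntervalIntegrable (fun τ => lapExp (m τ) s * (1 - lapTr (m τ) s)) volume a b := by
  refine (intervalIntegrable_const (c := s)).mono_fun' (((h.measurable_lapExp s hs).mul
    (measurable_const.sub (h.measurable_lapTr s hs))).aestronglyMeasurable) ?_
  refine ae_of_all _ fun τ => ?_
  obtain ⟨h1, h2⟩ := h.rate_bounds τ hs
  simp only
  rwa [Real.norm_eq_abs, abs_of_nonneg h1]

lemma abs_lapExp_time_sub_le (h : IsLapFlow m) {s : ℝ} (hs : 0 < s) (a b : ℝ) :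
    |lapExp (m a) s - lapExp (m b) s| ≤ s * |a - b| := by
  have key : ∀ a b, 0 ≤ a → 0 ≤ b → |lapExp (m a) s - lapExp (m b) s| ≤ s * |a - b| := by
    intro a b ha hb
    rw [h.flow a s ha hs, h.flow b s hb hs, sub_sub_sub_cancel_left,
      intervalIntegral.integral_interval_sub_left (h.intervalIntegrable hs _ _)
      (h.intervalIntegrable hs _ _), abs_sub_comm]
    refine intervalIntegral.norm_integral_le_of_norm_le_const (E := ℝ) fun τ _ => ?_
    obtain ⟨h1, h2⟩ := h.rate_bounds τ hs
    rwa [Real.norm_eq_abs, abs_of_nonneg h1]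
  have hmax : ∀ t, m t = m (max t 0) := by
    intro t
    rcases le_total t 0 with ht | ht
    · rw [max_eq_right ht, h.const t ht]
    · rw [max_eq_left ht]
  rw [hmax a, hmax b]
  refine (key _ _ (le_max_right _ _) (le_max_right _ _)).trans ?_
  exact mul_le_mul_of_nonneg_left (abs_max_sub_max_le_abs a b 0) hs.le

lemma continuous_lapExp (h : IsLapFlow m) {s : ℝ} (hs : 0 < s) :
    Continuous fun t => lapExp (m t) s := by
  refine (LipschitzWith.of_dist_le_mul (K := ⟨s, hs.le⟩) fun a b => ?_).continuous
  rw [Real.dist_eq, Real.dist_eq]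
  exact h.abs_lapExp_time_sub_le hs a b

/-- Continuity in time of the Laplace transform, from the concavity of the exponent. -/
lemma continuous_lapTr (h : IsLapFlow m) {s : ℝ} (hs : 0 < s) :
    Continuous fun t => lapTr (m t) s := by
  refine continuous_iff_continuousAt.2 fun t => ?_
  have := h.prob
  exact tendsto_deriv_of_concave (f := fun t s => lapExp (m t) s) (d := fun t s => lapTr (m t) s)
    (g := lapExp (m t)) hs
    (Eventually.of_forall fun i a b ha hab => lapTr_mul_le (h.null i) ha.le hab.le)
    (Eventually.of_forall fun i a b ha hab => le_lapTr_mul (h.null i) ha.le hab.le)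
    (fun x hx => (h.continuous_lapExp hx).tendsto t) (hasDerivAt_lapExp (h.null t) hs)

lemma continuousAt_uncurry_lapExp (h : IsLapFlow m) (t : ℝ) {s : ℝ} (hs : 0 < s) :
    ContinuousAt (fun p : ℝ × ℝ => lapExp (m p.1) p.2) (t, s) := by
  have := h.prob
  have h1 : Tendsto (fun p : ℝ × ℝ => |p.2 - s| + |lapExp (m p.1) s - lapExp (m t) s|)
      (𝓝 (t, s)) (𝓝 0) := by
    have c := h.continuous_lapExp hs
    have : Continuous fun p : ℝ × ℝ => |p.2 - s| + |lapExp (m p.1) s - lapExp (m t) s| :=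
      (by fun_prop : Continuous fun p : ℝ × ℝ => |p.2 - s|).add
        ((c.comp continuous_fst).sub continuous_const).abs
    simpa using this.tendsto (t, s)
  rw [ContinuousAt, tendsto_iff_dist_tendsto_zero]
  refine squeeze_zero' (Eventually.of_forall fun _ => dist_nonneg) ?_ h1
  have hev : ∀ᶠ p : ℝ × ℝ in 𝓝 (t, s), 0 < p.2 := continuous_snd.continuousAt.eventually_const_lt hs
  filter_upwards [hev] with p hp
  rw [Real.dist_eq]
  refine (_root_.abs_sub_le _ (lapExp (m p.1) s) _).trans ?_
  exact add_le_add (abs_lapExp_sub_le (h.null _) hp.le hs.le) le_rfl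

/-- Joint continuity, from continuity in time and monotonicity in `s`. -/
lemma continuousAt_uncurry_lapTr (h : IsLapFlow m) (t : ℝ) {s : ℝ} (hs : 0 < s) :
    ContinuousAt (fun p : ℝ × ℝ => lapTr (m p.1) p.2) (t, s) := by
  have := h.prob
  rw [ContinuousAt, Metric.tendsto_nhds]
  intro ε hε
  have hc : ContinuousAt (lapTr (m t)) s :=
    (continuousOn_lapTr (h.null t)).continuousAt (Ici_mem_nhds hs)
  obtain ⟨δ, hδ, hd⟩ := Metric.continuousAt_iff.1 hc (ε / 2) (by positivity)
  set η := min (δ / 2) (s / 2)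
  have hη : 0 < η := by positivity
  have hηs : η < s := by linarith [min_le_right (δ / 2) (s / 2)]
  have hηd : η < δ := by linarith [min_le_left (δ / 2) (s / 2)]
  have d1 := hd (x := s + η) (by simpa [Real.dist_eq, abs_of_pos hη] using hηd)
  have d2 := hd (x := s - η) (by simpa [Real.dist_eq, abs_of_pos hη] using hηd)
  have c1 := ((h.continuous_lapTr (show 0 < s + η by linarith)).comp
    (continuous_fst (X := ℝ) (Y := ℝ))).tendsto (t, s)
  have c2 := ((h.continuous_lapTr (show 0 < s - η by linarith)).comp
    (continuous_fst (X := ℝ) (Y := ℝ))).tendsto (t, s)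
  rw [Metric.tendsto_nhds] at c1 c2
  have e1 : ∀ᶠ p : ℝ × ℝ in 𝓝 (t, s), p.2 < s + η :=
    continuous_snd.continuousAt.eventually_lt_const (by simpa using hη)
  have e2 : ∀ᶠ p : ℝ × ℝ in 𝓝 (t, s), s - η < p.2 :=
    continuous_snd.continuousAt.eventually_const_lt (by simpa using hη)
  filter_upwards [e1, e2, c1 (ε / 2) (by positivity), c2 (ε / 2) (by positivity)]
    with p p1 p2 p3 p4
  have a1 := lapTr_anti (h.null p.1) (show 0 ≤ p.2 by linarith) p1.le
  have a2 := lapTr_anti (h.null p.1) (show 0 ≤ s - η by linarith) p2.le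
  simp only [Function.comp] at p3 p4
  rw [Real.dist_eq, abs_lt] at *
  constructor <;> linarith [d1.1, d1.2, d2.1, d2.2, p3.1, p3.2, p4.1, p4.2]

lemma hasDerivAt_time (h : IsLapFlow m) {t s : ℝ} (ht : 0 < t) (hs : 0 < s) :
    HasDerivAt (fun t => lapExp (m t) s) (-(lapExp (m t) s * (1 - lapTr (m t) s))) t := by
  have hc : Continuous fun τ => lapExp (m τ) s * (1 - lapTr (m τ) s) :=
    (h.continuous_lapExp hs).mul (continuous_const.sub (h.continuous_lapTr hs))
  have h1 := ((hc.integral_hasStrictDerivAt 0 t).hasDerivAt).const_sub (lapExp (m 0) s)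
  refine h1.congr_of_eventuallyEq ?_
  filter_upwards [lt_mem_nhds ht] with τ hτ using h.flow τ s hτ.le hs

/-- The chain rule along a curve `s = c(t)`; both partial derivatives are continuous. -/
lemma hasDerivAt_along (h : IsLapFlow m) {t : ℝ} (ht : 0 < t) {c : ℝ → ℝ} {c' : ℝ}
    (hc : HasDerivAt c c' t) (hct : 0 < c t) :
    HasDerivAt (fun τ => lapExp (m τ) (c τ))
      (-(lapExp (m t) (c t) * (1 - lapTr (m t) (c t))) + lapTr (m t) (c t) * c') t := by
  have hprob := h.prob
  have ev : ∀ᶠ v : ℝ × ℝ in 𝓝 (t, c t), 0 < v.1 ∧ 0 < v.2 :=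
    ((continuous_fst.tendsto (t, c t)).eventually_const_lt ht).and
      ((continuous_snd.tendsto (t, c t)).eventually_const_lt hct)
  have hcont : Continuous fun a : ℝ => (ContinuousLinearMap.toSpanSingleton ℝ a : ℝ →L[ℝ] ℝ) :=
    (ContinuousLinearMap.toSpanSingletonCLE (𝕜 := ℝ) (E := ℝ)).continuous
  have key := hasStrictFDerivAt_uncurry_coprod (𝕜 := ℝ) (u := (t, c t))
    (f := fun t s => lapExp (m t) s)
    (f₁ := fun t s => ContinuousLinearMap.toSpanSingleton ℝ
      (-(lapExp (m t) s * (1 - lapTr (m t) s))))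
    (f₂ := fun t s => ContinuousLinearMap.toSpanSingleton ℝ (lapTr (m t) s))
    (ev.mono fun v hv => (h.hasDerivAt_time hv.1 hv.2).hasFDerivAt)
    (ev.mono fun v hv => (hasDerivAt_lapExp (h.null v.1) hv.2).hasFDerivAt)
    (hcont.continuousAt.comp (f := fun p : ℝ × ℝ => -(lapExp (m p.1) p.2 * (1 - lapTr (m p.1) p.2)))
      ((h.continuousAt_uncurry_lapExp t hct).mul
        (continuousAt_const.sub (h.continuousAt_uncurry_lapTr t hct))).neg)
    (hcont.continuousAt.comp (f := fun p : ℝ × ℝ => lapTr (m p.1) p.2)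
      (h.continuousAt_uncurry_lapTr t hct))
  have := key.hasFDerivAt.comp_hasDerivAt t ((hasDerivAt_id t).prodMk hc)
  refine this.congr_deriv ?_
  simp [Function.HasUncurry.uncurry, mul_comm]

/-- The Laplace exponent decays exponentially along the characteristics
`s(t) = s₀ - (1 - e^{-t}) φ(0, s₀)`. -/
theorem characteristic (h : IsLapFlow m) {t s₀ : ℝ} (ht : 0 ≤ t) (hs : 0 < s₀) :
    lapExp (m t) (s₀ - (1 - Real.exp (-t)) * lapExp (m 0) s₀) =
      Real.exp (-t) * lapExp (m 0) s₀ := by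
  have hprob := h.prob
  set A := lapExp (m 0) s₀ with hA
  have hA0 : 0 < A := lapExp_pos (h.null 0) hs
  have hA1 : A ≤ s₀ := lapExp_le_self (h.null 0) hs.le
  set c : ℝ → ℝ := fun t => s₀ - (1 - Real.exp (-t)) * A with hc
  have hcpos : ∀ t, 0 < c t := by
    intro t
    have := Real.exp_pos (-t)
    simp only [hc]; nlinarith
  have hcd : ∀ t, HasDerivAt c (-(Real.exp (-t) * A)) t := by
    intro t
    refine ((((hasDerivAt_neg t).exp.const_sub 1).mul_const A).const_sub s₀).congr_deriv ?_
    ring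
  have hcc : Continuous c := by simp only [hc]; fun_prop
  -- the deviation `g` from the claim satisfies `g' = -(1 - ψ) g`, so that
  -- `g ^ 2` is nonincreasing, with initial value `0`
  set g : ℝ → ℝ := fun t => lapExp (m t) (c t) - Real.exp (-t) * A with hg
  have hgc : Continuous g := by
    refine Continuous.sub (continuous_iff_continuousAt.2 fun t => ?_) (by fun_prop)
    exact ContinuousAt.comp (f := fun t => (t, c t)) (h.continuousAt_uncurry_lapExp t (hcpos t))
      (continuousAt_id.prodMk hcc.continuousAt)
  have hgd : ∀ t, 0 < t → HasDerivAt g (-(1 - lapTr (m t) (c t)) * g t) t := by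
    intro t ht
    refine ((h.hasDerivAt_along ht (hcd t) (hcpos t)).sub
      ((hasDerivAt_neg t).exp.mul_const A)).congr_deriv ?_
    simp only [hg]; ring
  have hanti : AntitoneOn (fun t => g t ^ 2) (Ici 0) := by
    refine antitoneOn_of_hasDerivWithinAt_nonpos (convex_Ici 0) (hgc.pow 2).continuousOn
      (f' := fun t => 2 * g t * (-(1 - lapTr (m t) (c t)) * g t)) ?_ ?_
    · intro x hx; rw [interior_Ici] at hx
      exact (((hgd x hx).pow 2).congr_deriv (by push_cast; ring)).hasDerivWithinAt
    · intro x hx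
      have := lapTr_le_one (h.null x) (hcpos x).le
      nlinarith [sq_nonneg (g x)]
  have h0 : g 0 = 0 := by simp [hg, hc, hA]
  have := hanti self_mem_Ici (mem_Ici.2 ht) ht
  simp only [h0] at this
  have h1 : g t = 0 := by
    have h2 := sq_nonneg (g t)
    exact pow_eq_zero_iff (two_ne_zero) |>.1 (le_antisymm (by simpa using this) h2)
  simp only [hg, hc] at h1
  linarith

end IsLapFlow

/-- The mass measures of a solution, held constant for negative times, form a Laplace flow. -/
lemma IsSolution.isLapFlow {ν : ℝ → Measure ℝ} (hν : IsSolution ν) (h1 : totalMass (ν 0) = 1) :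
    IsLapFlow fun t => massMeasure (ν (max t 0)) := by
  have hn := fun t => (hν.radon _ (le_max_right t 0)).null_nonpos
  have hm := fun t => hν.totalMass_eq_one h1 (le_max_right t 0)
  have hfin : ∀ t, totalMass (ν (max t 0)) < ∞ := fun t => by rw [hm t]; exact ENNReal.one_lt_top
  refine ⟨fun t => isProbabilityMeasure_massMeasure (hm t), fun t => massMeasure_null (hn t),
    fun t ht => by simp only [max_eq_right ht, max_self], ?_, ?_, ?_⟩
  · intro s hs
    simp_rw [lapExp_massMeasure (hn _)]
    exact hν.measurable_integral (by fun_prop) fun x hx => (one_sub_exp_bounds hs hx).1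
  · intro s hs
    simp_rw [lapTr_massMeasure (hn _)]
    exact hν.measurable_integral (by fun_prop) fun x hx => by positivity
  · intro t s ht hs
    simp_rw [lapExp_massMeasure (hn _), lapTr_massMeasure (hn _), max_self, max_eq_left ht]
    rw [hν.integral_exp_eq h1 ht hs]
    congr 1
    refine intervalIntegral.integral_congr fun τ hτ => ?_
    congr 1
    have hid := integrable_id_of_totalMass (hn τ) (hfin τ)
    have e1 : ∫ x, x ∂(ν (max τ 0)) = 1 := by
      rw [integral_eq_lintegral_of_nonneg_ae ((ae_pos_of_null_Iic (hn τ)).mono fun x hx => hx.le)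
        measurable_id.aestronglyMeasurable]
      have := hm τ
      simp only [totalMass] at this
      rw [this, ENNReal.toReal_one]
    have e2 : ∫ x, x * Real.exp (-(s * x)) ∂(ν (max τ 0)) =
        ∫ x, (x - x * (1 - Real.exp (-(s * x)))) ∂(ν (max τ 0)) := by
      congr 1; ext x; ring
    rw [e2, integral_sub hid (integrable_mul_one_sub_exp (hn τ) (hfin τ) hs), e1]
    ring

/-! ### The Abelian theorem for the second moment -/

/-- The truncated first moment `∫_{(0,x]} y m(dy)` of a measure `m`; it is the truncated second
moment of `ν` when `m` is the mass measure of `ν`. -/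
noncomputable def truncMoment (m : Measure ℝ) (x : ℝ) : ℝ := ∫ y in Iic x, y ∂m

instance {m : Measure ℝ} [SFinite m] : SFinite (massMeasure m) := by
  unfold massMeasure; infer_instance

lemma truncMoment_nonneg {m : Measure ℝ} (hm : m (Iic 0) = 0) (x : ℝ) : 0 ≤ truncMoment m x :=
  integral_nonneg_of_ae (ae_restrict_of_ae ((ae_pos_of_null_Iic hm).mono fun _ hy => hy.le))

section
variable {m : Measure ℝ} [IsProbabilityMeasure m]

lemma integrableOn_Iic_id (hm : m (Iic 0) = 0) (x : ℝ) : IntegrableOn (fun y => y) (Iic x) m := by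
  refine Integrable.of_bound measurable_id'.aestronglyMeasurable |x| ?_
  filter_upwards [ae_restrict_of_ae (ae_pos_of_null_Iic hm), ae_restrict_mem measurableSet_Iic]
    with y hy hyx
  rw [Real.norm_eq_abs, abs_of_pos hy]
  exact (mem_Iic.1 hyx).trans (le_abs_self x)

lemma massMeasure_Iic (hm : m (Iic 0) = 0) (x : ℝ) :
    massMeasure m (Iic x) = ENNReal.ofReal (truncMoment m x) := by
  rw [massMeasure, withDensity_apply _ measurableSet_Iic, truncMoment,
    ofReal_integral_eq_lintegral_ofReal (integrableOn_Iic_id hm x)]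
  exact ae_restrict_of_ae ((ae_pos_of_null_Iic hm).mono fun y hy => hy.le)

lemma massMeasure_real_Iic (hm : m (Iic 0) = 0) (x : ℝ) :
    (massMeasure m).real (Iic x) = truncMoment m x := by
  rw [measureReal_def, massMeasure_Iic hm, ENNReal.toReal_ofReal (truncMoment_nonneg hm x)]

lemma truncMoment_mono (hm : m (Iic 0) = 0) : Monotone (truncMoment m) := by
  intro a b hab
  have := measure_mono (μ := massMeasure m) (Iic_subset_Iic.2 hab)
  rw [massMeasure_Iic hm, massMeasure_Iic hm] at this
  exact (ENNReal.ofReal_le_ofReal_iff (truncMoment_nonneg hm b)).1 this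

/-- The gap `s - φ(s)` as an average of the truncated moment. -/
lemma sub_lapExp_eq (hm : m (Iic 0) = 0) {s : ℝ} (hs : 0 < s) :
    s - lapExp m s = s ^ 2 * ∫ z in Ioi 0, kerTwoDensity z * truncMoment m (z / s) := by
  have h1 : s - lapExp m s = s ^ 2 * ∫ y, kerTwo (s * y) ∂(massMeasure m) := by
    rw [integral_massMeasure hm, ← integral_const_mul]
    have : s - lapExp m s = ∫ x, (s - (1 - Real.exp (-(s * x))) / x) ∂m := by
      rw [integral_sub (integrable_const s) (integrable_lapExp hm hs.le), lapExp]; simp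
    rw [this]
    refine integral_congr_ae ?_
    filter_upwards [ae_pos_of_null_Iic hm] with x hx
    rw [kerTwo]; field_simp; ring
  rw [h1, integral_kernel_eq (fun z hz => kerTwoDensity_nonneg hz) measurable_kerTwoDensity
    (fun z hz => hasDerivAt_kerTwo hz) tendsto_kerTwo_atTop measurable_kerTwo
    (massMeasure_null hm) (fun c => by rw [massMeasure_Iic hm]; exact ENNReal.ofReal_ne_top) hs]
  simp_rw [massMeasure_real_Iic hm]

end

/-- `kerTwoDensity` is bounded near `0` and of order `z^{-2}` at infinity. -/
lemma integrableOn_kerTwoDensity_mul_rpow {p : ℝ} (hp0 : 0 ≤ p) (hp1 : p < 1) :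
    IntegrableOn (fun z => kerTwoDensity z * z ^ p) (Ioi 0) := by
  have hmeas : Measurable fun z : ℝ => kerTwoDensity z * z ^ p :=
    measurable_kerTwoDensity.mul (by fun_prop)
  rw [← Ioc_union_Ioi_eq_Ioi zero_le_one]
  refine IntegrableOn.union ?_ ?_
  · refine Measure.integrableOn_of_bounded (M := 1 / 2) (by simp) hmeas.aestronglyMeasurable ?_
    filter_upwards [ae_restrict_mem measurableSet_Ioc] with z hz
    have h1 : z ^ p ≤ 1 := Real.rpow_le_one hz.1.le hz.2 hp0
    have h2 := kerTwoDensity_le_half hz.1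
    have h3 := kerTwoDensity_nonneg hz.1
    have h4 : 0 ≤ z ^ p := Real.rpow_nonneg hz.1.le p
    rw [Real.norm_eq_abs, abs_of_nonneg (by positivity)]
    nlinarith
  · refine (integrableOn_Ioi_rpow_of_lt (show p - 2 < -1 by linarith) one_pos).mono'
      hmeas.aestronglyMeasurable ?_
    filter_upwards [ae_restrict_mem measurableSet_Ioi] with z hz
    have hz0 : (0 : ℝ) < z := one_pos.trans hz
    have h3 := kerTwoDensity_nonneg hz0
    have h4 : 0 ≤ z ^ p := Real.rpow_nonneg hz0.le p
    rw [Real.norm_eq_abs, abs_of_nonneg (by positivity), Real.rpow_sub hz0, Real.rpow_two,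
      div_eq_mul_one_div, mul_comm]
    gcongr
    exact kerTwoDensity_le_inv_sq hz0

/-- A Potter-type bound from a doubling inequality. -/
lemma le_rpow_of_doubling {V : ℝ → ℝ} (hV : Monotone V) (hV0 : ∀ x, 0 ≤ V x) {p x₀ : ℝ}
    (hp : 0 ≤ p) (hx₀ : 0 < x₀) (hd : ∀ x, x₀ ≤ x → V (2 * x) ≤ 2 ^ p * V x) {x y : ℝ}
    (hx : x₀ ≤ x) (hy : 0 ≤ y) : V (y * x) ≤ 2 ^ p * (1 + y ^ p) * V x := by
  have hxpos : 0 < x := hx₀.trans_le hx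
  have h2p : (1 : ℝ) ≤ 2 ^ p := Real.one_le_rpow (by norm_num) hp
  have hyp : 0 ≤ y ^ p := Real.rpow_nonneg hy p
  rcases le_total y 1 with h | h
  · calc V (y * x) ≤ V x := hV (by nlinarith)
      _ ≤ 2 ^ p * (1 + y ^ p) * V x := le_mul_of_one_le_left (hV0 x) (by nlinarith)
  · obtain ⟨n, hn1, hn2⟩ := exists_nat_pow_near h (by norm_num : (1 : ℝ) < 2)
    have hind : ∀ k : ℕ, V (2 ^ k * x) ≤ ((2 : ℝ) ^ k) ^ p * V x := by
      intro k
      induction k with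
      | zero => simp
      | succ k ih =>
        have h1 : x₀ ≤ 2 ^ k * x := hx.trans (le_mul_of_one_le_left hxpos.le
          (one_le_pow₀ (by norm_num)))
        calc V (2 ^ (k + 1) * x) = V (2 * (2 ^ k * x)) := by ring_nf
          _ ≤ 2 ^ p * V (2 ^ k * x) := hd _ h1
          _ ≤ 2 ^ p * (((2 : ℝ) ^ k) ^ p * V x) := by gcongr
          _ = ((2 : ℝ) ^ (k + 1)) ^ p * V x := by
            rw [pow_succ', Real.mul_rpow (by norm_num) (by positivity)]; ring
    calc V (y * x) ≤ V (2 ^ (n + 1) * x) := hV (by gcongr)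
      _ ≤ ((2 : ℝ) ^ (n + 1)) ^ p * V x := hind _
      _ = 2 ^ p * ((2 : ℝ) ^ n) ^ p * V x := by
          rw [pow_succ', Real.mul_rpow (by norm_num) (by positivity)]
      _ ≤ 2 ^ p * (1 + y ^ p) * V x := by
          have : ((2 : ℝ) ^ n) ^ p ≤ y ^ p := Real.rpow_le_rpow (by positivity) hn1 hp
          have h0 := hV0 x
          gcongr
          linarith

/-- **Abelian theorem**: regular variation of the truncated moment at infinity gives regular
variation of `s - φ(s)` at `0`. -/
theorem tendsto_sub_lapExp_ratio {m : Measure ℝ} [IsProbabilityMeasure m] (hm : m (Iic 0) = 0)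
    {ρ : ℝ} (hρ0 : 0 < ρ) (hρ1 : ρ ≤ 1) (hpos : ∀ᶠ x in atTop, 0 < truncMoment m x)
    (hV : ∀ c : ℝ, 0 < c → Tendsto (fun x => truncMoment m (c * x) / truncMoment m x) atTop
      (𝓝 (c ^ (1 - ρ)))) {c : ℝ} (hc : 0 < c) :
    Tendsto (fun s => (c * s - lapExp m (c * s)) / (s - lapExp m s)) (𝓝[>] 0)
      (𝓝 (c ^ (1 + ρ))) := by
  set V := truncMoment m
  -- an exponent between `1 - ρ` and `1`: eventually `V (2 x) ≤ 2 ^ p V x`, while `z ^ p` is still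
  -- integrable against `kerTwoDensity`
  set p := 1 - ρ / 2 with hp
  have hp0 : 0 ≤ p := by linarith
  have hp1 : p < 1 := by linarith
  have hlt : (2 : ℝ) ^ (1 - ρ) < 2 ^ p := Real.rpow_lt_rpow_of_exponent_lt (by norm_num)
    (by linarith)
  obtain ⟨x₀, hx₀⟩ := eventually_atTop.1
    (((hV 2 two_pos).eventually_lt_const hlt).and (hpos.and (eventually_gt_atTop 0)))
  have hx₀0 : 0 < x₀ := (hx₀ x₀ le_rfl).2.2
  have hdoub : ∀ x, x₀ ≤ x → V (2 * x) ≤ 2 ^ p * V x := fun x hx => by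
    have := (hx₀ x hx).1
    rw [div_lt_iff₀ (hx₀ x hx).2.1] at this
    exact this.le
  -- normalized so that `c s - φ(c s) = (c s)² V(1/s) J c (1/s)`
  set J : ℝ → ℝ → ℝ := fun c x => ∫ z in Ioi 0, kerTwoDensity z * (V (z / c * x) / V x) with hJ
  have hJlim : ∀ c, 0 < c → Tendsto (J c) atTop
      (𝓝 (∫ z in Ioi 0, kerTwoDensity z * (z / c) ^ (1 - ρ))) := by
    intro c hc
    have hVm : Measurable V := (truncMoment_mono hm).measurable
    refine tendsto_integral_filter_of_dominated_convergence
      (fun z => kerTwoDensity z * z ^ (0 : ℝ) * 2 ^ p +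
        kerTwoDensity z * z ^ p * (2 ^ p * (c ^ p)⁻¹)) ?_ ?_ ?_ ?_
    · refine Eventually.of_forall fun x => (measurable_kerTwoDensity.mul
        ((hVm.comp (by fun_prop)).div_const _)).aestronglyMeasurable
    · filter_upwards [eventually_ge_atTop x₀] with x hx
      filter_upwards [ae_restrict_mem measurableSet_Ioi] with z hz
      have hzc : 0 ≤ z / c := (div_pos hz hc).le
      have hw := kerTwoDensity_nonneg hz
      have h1 := le_rpow_of_doubling (truncMoment_mono hm) (truncMoment_nonneg hm) hp0 hx₀0
        hdoub hx hzc
      have h2 : V (z / c * x) / V x ≤ 2 ^ p * (1 + (z / c) ^ p) := by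
        rwa [div_le_iff₀ (hx₀ x hx).2.1]
      have h3 : 0 ≤ V (z / c * x) / V x :=
        div_nonneg (truncMoment_nonneg hm _) (truncMoment_nonneg hm _)
      rw [Real.norm_eq_abs, abs_of_nonneg (mul_nonneg hw h3)]
      calc _ ≤ kerTwoDensity z * (2 ^ p * (1 + (z / c) ^ p)) := by gcongr
        _ = _ := by
          rw [Real.div_rpow (le_of_lt hz) hc.le, Real.rpow_zero]; ring
    · exact ((integrableOn_kerTwoDensity_mul_rpow le_rfl one_pos).mul_const _).add
        ((integrableOn_kerTwoDensity_mul_rpow hp0 hp1).mul_const _)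
    · filter_upwards [ae_restrict_mem measurableSet_Ioi] with z hz
      exact (hV _ (div_pos hz hc)).const_mul _
  set C := ∫ z in Ioi 0, kerTwoDensity z * z ^ (1 - ρ) with hC
  have hCeq : ∀ c, 0 < c → ∫ z in Ioi 0, kerTwoDensity z * (z / c) ^ (1 - ρ) =
      C * (c ^ (1 - ρ))⁻¹ := by
    intro c hc
    rw [hC, ← integral_mul_const]
    refine setIntegral_congr_fun measurableSet_Ioi fun z hz => ?_
    simp only [Real.div_rpow (le_of_lt hz) hc.le]
    ring
  have hCpos : 0 < C := by
    have hpos3 : ∀ z : ℝ, z ∈ Ioi (3 : ℝ) → 0 < kerTwoDensity z * z ^ (1 - ρ) := by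
      intro z hz
      have hz3 : (3 : ℝ) < z := hz
      have : 0 < kerTwoDensity z := div_pos (by
        nlinarith [Real.exp_pos (-z)]) (by positivity)
      positivity
    rw [hC, setIntegral_pos_iff_support_of_nonneg_ae]
    · refine lt_of_lt_of_le ?_ (measure_mono (fun z (hz : z ∈ Ioi (3 : ℝ)) =>
        ⟨(hpos3 z hz).ne', mem_Ioi.2 (lt_trans (by norm_num) hz)⟩))
      simp
    · filter_upwards [ae_restrict_mem measurableSet_Ioi] with z hz
      exact mul_nonneg (kerTwoDensity_nonneg hz) (Real.rpow_nonneg (le_of_lt hz) _)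
    · exact integrableOn_kerTwoDensity_mul_rpow (by linarith) (by linarith)
  have hratio : Tendsto (fun x => c ^ 2 * (J c x / J 1 x)) atTop (𝓝 (c ^ (1 + ρ))) := by
    have h := ((hJlim c hc).div (hJlim 1 one_pos) (by
      rw [hCeq 1 one_pos, Real.one_rpow]; simpa using hCpos.ne')).const_mul (c ^ 2)
    have he : c ^ 2 * ((∫ z in Ioi 0, kerTwoDensity z * (z / c) ^ (1 - ρ)) /
        ∫ z in Ioi 0, kerTwoDensity z * (z / 1) ^ (1 - ρ)) = c ^ (1 + ρ) := by
      rw [hCeq c hc, hCeq 1 one_pos, Real.one_rpow, inv_one, mul_one,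
        mul_div_cancel_left₀ _ hCpos.ne', ← Real.rpow_neg hc.le, ← Real.rpow_two,
        ← Real.rpow_add hc]
      ring_nf
    rw [he] at h
    exact h
  have hinv : Tendsto (fun s : ℝ => s⁻¹) (𝓝[>] 0) atTop := tendsto_inv_nhdsGT_zero
  refine (hratio.comp hinv).congr' ?_
  have hev := hinv.eventually (eventually_ge_atTop x₀)
  filter_upwards [self_mem_nhdsWithin, hev] with s hs hs2
  have hs0 : 0 < s := hs
  have hVs : 0 < V s⁻¹ := (hx₀ _ hs2).2.1
  have e : ∀ c, 0 < c → c * s - lapExp m (c * s) = (c * s) ^ 2 * (V s⁻¹ * J c s⁻¹) := by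
    intro c hc
    rw [sub_lapExp_eq hm (mul_pos hc hs0)]
    congr 1
    simp only [hJ]
    rw [← integral_const_mul]
    refine integral_congr_ae (ae_of_all _ fun z => ?_)
    simp only
    rw [show z / c * s⁻¹ = z / (c * s) by field_simp, mul_left_comm, mul_div_cancel₀ _ hVs.ne']
  have e1 := e 1 one_pos
  rw [one_mul] at e1
  simp only [Function.comp]
  rw [e c hc, e1, mul_pow, mul_assoc, mul_div_assoc, mul_div_mul_left _ _ (by positivity),
    mul_div_mul_left _ _ hVs.ne']

/-! ### Rescaled measures -/

/-- The measure `m` in the length unit `l`. -/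
noncomputable def rescale (m : Measure ℝ) (l : ℝ) : Measure ℝ := m.map fun x => x / l

instance {m : Measure ℝ} [IsProbabilityMeasure m] {l : ℝ} : IsProbabilityMeasure (rescale m l) :=
  Measure.isProbabilityMeasure_map (by fun_prop)

lemma rescale_null {m : Measure ℝ} (hm : m (Iic 0) = 0) {l : ℝ} (hl : 0 < l) :
    rescale m l (Iic 0) = 0 := by
  rw [rescale, Measure.map_apply (by fun_prop) measurableSet_Iic]
  convert hm using 2
  ext x; simp [div_nonpos_iff, hl.le, hl.not_ge]

lemma rescale_Iic {m : Measure ℝ} {l : ℝ} (hl : 0 < l) (x : ℝ) :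
    (rescale m l).real (Iic x) = m.real (Iic (l * x)) := by
  rw [measureReal_def, measureReal_def, rescale, Measure.map_apply (by fun_prop) measurableSet_Iic]
  congr 2
  ext y; simp [div_le_iff₀ hl, mul_comm]

lemma integral_rescale {m : Measure ℝ} {l : ℝ} {g : ℝ → ℝ} (hg : Measurable g) :
    ∫ x, g x ∂(rescale m l) = ∫ x, g (x / l) ∂m :=
  integral_map (by fun_prop) hg.aestronglyMeasurable

lemma lapTr_rescale {m : Measure ℝ} {l : ℝ} (s : ℝ) :
    lapTr (rescale m l) s = lapTr m (s / l) := by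
  rw [lapTr, integral_rescale (by fun_prop), lapTr]
  congr 1; ext x; congr 1; ring

lemma lapExp_rescale {m : Measure ℝ} {l : ℝ} (s : ℝ) :
    lapExp (rescale m l) s = l * lapExp m (s / l) := by
  rw [lapExp, integral_rescale (by fun_prop), lapExp, ← integral_const_mul]
  congr 1; ext x
  rw [show s * (x / l) = s / l * x by ring, div_div_eq_mul_div]
  ring

/-- Pointwise convergence of the Laplace exponents implies convergence of distribution functions. -/
lemma tendsto_Iic_of_lapExp {ι : Type*} {l : Filter ι} {μ : ι → Measure ℝ} {μ₀ : Measure ℝ}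
    [∀ i, IsProbabilityMeasure (μ i)] [IsProbabilityMeasure μ₀]
    (hμ : ∀ i, μ i (Iic 0) = 0) (hμ₀ : μ₀ (Iic 0) = 0)
    (hlim : ∀ s, 0 < s → Tendsto (fun i => lapExp (μ i) s) l (𝓝 (lapExp μ₀ s)))
    {x : ℝ} (hx : μ₀ {x} = 0) :
    Tendsto (fun i => (μ i).real (Iic x)) l (𝓝 (μ₀.real (Iic x))) := by
  refine tendsto_measureReal_Iic_of_laplace
    (fun i => measure_mono_null Iio_subset_Iic_self (hμ i))
    (measure_mono_null Iio_subset_Iic_self hμ₀)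
    (fun i => by simpa using integrable_lapTr (hμ i) zero_le_one)
    (by simpa using integrable_lapTr hμ₀ zero_le_one) (fun k => ?_) hx
  have hk : (0 : ℝ) < k + 1 := by positivity
  have := tendsto_deriv_of_concave (f := fun i s => lapExp (μ i) s)
    (d := fun i s => lapTr (μ i) s) (g := lapExp μ₀) hk
    (Eventually.of_forall fun i a b ha hab => lapTr_mul_le (hμ i) ha.le hab.le)
    (Eventually.of_forall fun i a b ha hab => le_lapTr_mul (hμ i) ha.le hab.le)
    hlim (hasDerivAt_lapExp hμ₀ hk)
  simpa only [lapTr, neg_mul] using this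

/-! ### Regular variation implies convergence -/

section Gap
variable {m : Measure ℝ} [IsProbabilityMeasure m]

lemma gap_strictMonoOn (hm : m (Iic 0) = 0) :
    StrictMonoOn (fun s => 1 - lapExp m s / s) (Ioi 0) :=
  fun _ ha _ hb hab => sub_lt_sub_left (lapExp_div_strictAntiOn hm ha hb hab) 1

lemma gap_pos (hm : m (Iic 0) = 0) {s : ℝ} (hs : 0 < s) : 0 < 1 - lapExp m s / s := by
  rw [sub_pos, div_lt_one hs]; exact lapExp_lt_self hm hs

lemma continuousOn_gap (hm : m (Iic 0) = 0) :
    ContinuousOn (fun s => 1 - lapExp m s / s) (Ioi 0) :=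
  continuousOn_const.sub (((continuousOn_lapExp hm).mono Ioi_subset_Ici_self).div continuousOn_id
    fun _ hs => (mem_Ioi.1 hs).ne')

/-- The relative gap `1 - φ(s)/s` takes all values between `0` and `1`. -/
lemma exists_gap_eq (hm : m (Iic 0) = 0) {y : ℝ} (hy0 : 0 < y) (hy1 : y < 1) :
    ∃ s, 0 < s ∧ 1 - lapExp m s / s = y := by
  have h0 : Tendsto (fun s => 1 - lapExp m s / s) (𝓝[>] 0) (𝓝 0) := by
    simpa using (tendsto_lapExp_div_zero hm).const_sub 1
  have h1 : Tendsto (fun s => 1 - lapExp m s / s) atTop (𝓝 1) := by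
    simpa using (tendsto_lapExp_div_atTop hm).const_sub 1
  obtain ⟨a, ha, ha0⟩ := ((h0.eventually_lt_const hy0).and self_mem_nhdsWithin).exists
  obtain ⟨b, hb, hab⟩ := ((h1.eventually_const_lt hy1).and (eventually_gt_atTop a)).exists
  have hsub : Icc a b ⊆ Ioi 0 := fun z hz => lt_of_lt_of_le ha0 hz.1
  obtain ⟨s, hs, hse⟩ := intermediate_value_Icc hab.le ((continuousOn_gap hm).mono hsub)
    ⟨ha.le, hb.le⟩
  exact ⟨s, hsub hs, hse⟩

end Gap

lemma exists_add_rpow_eq {ρ : ℝ} (h0 : 0 < ρ) {s : ℝ} (hs : 0 ≤ s) :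
    ∃ w, 0 ≤ w ∧ w + w ^ (1 + ρ) = s := by
  have hcont : ContinuousOn (fun w : ℝ => w + w ^ (1 + ρ)) (Icc 0 s) :=
    (continuous_id.add (Real.continuous_rpow_const (by linarith))).continuousOn
  obtain ⟨w, hw, hws⟩ := intermediate_value_Icc hs hcont (show s ∈ Icc _ _ from
    ⟨by simpa [Real.zero_rpow (by linarith : 1 + ρ ≠ 0)] using hs, by
      have := Real.rpow_nonneg hs (1 + ρ); linarith⟩)
  exact ⟨w, hw.1, hws⟩

lemma exists_pos_add_rpow_eq {ρ : ℝ} (h0 : 0 < ρ) {s : ℝ} (hs : 0 < s) :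
    ∃ w, 0 < w ∧ w + w ^ (1 + ρ) = s := by
  obtain ⟨w, hw, hws⟩ := exists_add_rpow_eq h0 hs.le
  refine ⟨w, hw.lt_of_ne ?_, hws⟩
  rintro rfl
  rw [Real.zero_rpow (by linarith)] at hws
  linarith

/-- If `s - φ₀(s)` is regularly varying with index `1 + ρ` at `0`, then the rescaled measures
converge to the probability measure whose Laplace exponent inverts `w ↦ w + w^{1+ρ}`. The scale
is `e^t / ε(t)` with `1 - φ₀(ε)/ε = e^{-t}`. -/
theorem IsLapFlow.exists_scale {m : ℝ → Measure ℝ} (h : IsLapFlow m) {ρ : ℝ} (hρ : 0 < ρ)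
    (hreg : ∀ c : ℝ, 0 < c → Tendsto
      (fun s => (c * s - lapExp (m 0) (c * s)) / (s - lapExp (m 0) s)) (𝓝[>] 0) (𝓝 (c ^ (1 + ρ))))
    {μ₀ : Measure ℝ} [IsProbabilityMeasure μ₀] (hμ₀ : μ₀ (Iic 0) = 0) (hatom : ∀ x, μ₀ {x} = 0)
    (hexp : ∀ w : ℝ, 0 < w → lapExp μ₀ (w + w ^ (1 + ρ)) = w) :
    ∃ scale : ℝ → ℝ, StrictMonoOn scale (Ici 0) ∧ (∀ t : ℝ, 0 < t → 0 < scale t) ∧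
      Tendsto scale atTop atTop ∧ ∀ x : ℝ,
        Tendsto (fun t => (m t).real (Iic (scale t * x))) atTop (𝓝 (μ₀.real (Iic x))) := by
  have hprob := h.prob
  have hm0 := h.null 0
  have hex : ∀ t : ℝ, 0 < t → ∃ s, 0 < s ∧ 1 - lapExp (m 0) s / s = Real.exp (-t) := fun t ht =>
    exists_gap_eq hm0 (Real.exp_pos _) (by rw [Real.exp_lt_one_iff]; linarith)
  choose! e he0 he using hex
  have hanti : ∀ a b : ℝ, 0 < a → a < b → e b < e a := by
    intro a b ha hab
    have hb := ha.trans hab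
    refine ((gap_strictMonoOn hm0).lt_iff_lt (he0 b hb) (he0 a ha)).1 ?_
    simp only [he a ha, he b hb]
    exact Real.exp_lt_exp.2 (by linarith)
  have hezero : Tendsto e atTop (𝓝[>] 0) := by
    refine tendsto_nhdsWithin_iff.2 ⟨?_, ?_⟩
    · rw [Metric.tendsto_nhds]
      intro δ hδ
      have h1 : Tendsto (fun t : ℝ => Real.exp (-t)) atTop (𝓝 0) :=
        Real.tendsto_exp_neg_atTop_nhds_zero
      filter_upwards [h1.eventually_lt_const (gap_pos hm0 hδ), eventually_gt_atTop 0] with t ht ht0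
      rw [Real.dist_eq, sub_zero, abs_of_pos (he0 t ht0)]
      rw [← he t ht0] at ht
      exact ((gap_strictMonoOn hm0).lt_iff_lt (he0 t ht0) hδ).1 ht
    · filter_upwards [eventually_gt_atTop 0] with t ht using he0 t ht
  -- the positive scale `l`, equal to the announced one for positive times
  let l : ℝ → ℝ := fun t => if 0 < t then Real.exp t / e t else 1
  have hl : ∀ t, 0 < t → l t = Real.exp t / e t := fun t ht => if_pos ht
  have hlpos : ∀ t, 0 < l t := by
    intro t
    by_cases ht : 0 < t
    · rw [hl t ht]; exact div_pos (Real.exp_pos _) (he0 t ht)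
    · simp [l, ht]
  have hμlim : ∀ σ, 0 < σ → Tendsto (fun t => lapExp (rescale (m t) (l t)) σ) atTop
      (𝓝 (lapExp μ₀ σ)) := by
    intro σ hσ
    obtain ⟨v, hv, hvσ⟩ := exists_pos_add_rpow_eq hρ hσ
    -- since `φ₀(s) ~ s` at `0`, the characteristic from `v e(t)` carries the value `v` in the limit
    have hφv : Tendsto (fun t => lapExp (m 0) (v * e t) / e t) atTop (𝓝 v) := by
      have hsc : Tendsto (fun t => v * e t) atTop (𝓝[>] 0) := by
        refine tendsto_nhdsWithin_iff.2 ⟨?_, ?_⟩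
        · simpa using (tendsto_nhdsWithin_iff.1 hezero).1.const_mul v
        · filter_upwards [eventually_gt_atTop 0] with t ht using mul_pos hv (he0 t ht)
      have := ((tendsto_lapExp_div_zero hm0).comp hsc).const_mul v
      rw [mul_one] at this
      refine this.congr' ?_
      filter_upwards [eventually_gt_atTop 0] with t ht
      have := he0 t ht
      simp only [Function.comp]; field_simp
    -- its position tends to `v ^ (1 + ρ) + v = σ` by regular variation
    have hS : Tendsto (fun t => (v * e t - lapExp (m 0) (v * e t)) / (e t - lapExp (m 0) (e t)) +
        lapExp (m 0) (v * e t) / e t) atTop (𝓝 σ) := by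
      rw [← hvσ, add_comm v]
      exact ((hreg v hv).comp hezero).add hφv
    have hval : ∀ t, 0 < t → lapExp (rescale (m t) (l t))
        ((v * e t - lapExp (m 0) (v * e t)) / (e t - lapExp (m 0) (e t)) +
        lapExp (m 0) (v * e t) / e t) = lapExp (m 0) (v * e t) / e t := by
      intro t ht
      have he1 := he0 t ht
      have hc := h.characteristic ht.le (mul_pos hv he1)
      have hg : e t - lapExp (m 0) (e t) = Real.exp (-t) * e t := by
        rw [← he t ht]; field_simp
      rw [lapExp_rescale, hl t ht, hg]
      have harg : ((v * e t - lapExp (m 0) (v * e t)) / (Real.exp (-t) * e t) +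
          lapExp (m 0) (v * e t) / e t) / (Real.exp t / e t) =
          v * e t - (1 - Real.exp (-t)) * lapExp (m 0) (v * e t) := by
        rw [Real.exp_neg]
        have := Real.exp_pos t
        field_simp
        ring
      rw [harg, hc, Real.exp_neg]
      have := Real.exp_pos t
      field_simp
    -- the exponents have Lipschitz constant `1`, which allows for moving the argument to `σ`
    have hdiff : Tendsto (fun t => lapExp (rescale (m t) (l t)) σ - lapExp (m 0) (v * e t) / e t)
        atTop (𝓝 0) := by
      refine squeeze_zero_norm' ?_ (by simpa using (hS.const_sub σ).abs)
      filter_upwards [eventually_gt_atTop 0, hS.eventually_const_lt hσ] with t ht hpos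
      have := abs_lapExp_sub_le (rescale_null (h.null t) (hlpos t)) hσ.le hpos.le
      rwa [hval t ht] at this
    have := hdiff.add hφv
    simp only [sub_add_cancel, zero_add] at this
    rw [← hvσ, hexp v hv, hvσ]
    exact this
  -- the value `0` at time `0` makes the scale strictly increasing on `[0, ∞)`
  refine ⟨fun t => if 0 < t then Real.exp t / e t else 0, ?_, ?_, ?_, ?_⟩
  · intro a ha b hb hab
    have hb0 : 0 < b := lt_of_le_of_lt ha hab
    rcases (mem_Ici.1 ha).eq_or_lt with h0 | h0
    · simp only [← h0, lt_irrefl, if_false, if_pos hb0]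
      exact div_pos (Real.exp_pos _) (he0 b hb0)
    · simp only [if_pos h0, if_pos hb0]
      exact div_lt_div₀ (Real.exp_lt_exp.2 hab) (hanti a b h0 hab).le (Real.exp_pos _).le
        (he0 b hb0)
  · intro t ht
    simp only [if_pos ht]
    exact div_pos (Real.exp_pos _) (he0 t ht)
  · have h1 : Tendsto (fun t => Real.exp t * (e t)⁻¹) atTop atTop :=
      Real.tendsto_exp_atTop.atTop_mul_atTop₀ (tendsto_inv_nhdsGT_zero.comp hezero)
    refine h1.congr' ?_
    filter_upwards [eventually_gt_atTop 0] with t ht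
    rw [if_pos ht, div_eq_mul_inv]
  · intro x
    refine (tendsto_Iic_of_lapExp (fun t => rescale_null (h.null t) (hlpos t)) hμ₀ hμlim
      (hatom x)).congr' ?_
    filter_upwards [eventually_gt_atTop 0] with t ht
    rw [rescale_Iic (hlpos t), hl t ht, if_pos ht]

/-! ### A scaling limit forces regular variation of the Laplace exponent -/

namespace IsNontrivialDistribution
variable {F : ℝ → ℝ}

lemma nonneg (hF : IsNontrivialDistribution F) (x : ℝ) : 0 ≤ F x := by
  rw [← hF.zero_of_neg (min x 0 - 1) (by linarith [min_le_right x 0])]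
  exact hF.mono (by linarith [min_le_left x 0])

lemma le_one (hF : IsNontrivialDistribution F) (x : ℝ) : F x ≤ 1 :=
  hF.mono.ge_of_tendsto hF.tendsto_one x

lemma ae_continuousAt (hF : IsNontrivialDistribution F) {c : ℝ} (hc : 0 < c) :
    ∀ᵐ z : ℝ, ContinuousAt F (z / c) := by
  have h := hF.mono.countable_not_continuousAt.preimage_of_injOn (f := fun z : ℝ => z / c)
    (fun a _ b _ hab => by simpa [hc.ne'] using hab)
  filter_upwards [h.ae_notMem volume] with z hz
  simpa using hz

lemma exists_continuousAt_pos (hF : IsNontrivialDistribution F) :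
    ∃ x, 0 < x ∧ 0 < F x ∧ ContinuousAt F x := by
  have h := (hF.tendsto_one.eventually_const_lt one_pos).and (eventually_gt_atTop 0)
  obtain ⟨a, ha⟩ := eventually_atTop.1 h
  obtain ⟨x, hx, hx2⟩ := (hF.ae_continuousAt one_pos |> Measure.dense_of_ae).exists_gt a
  exact ⟨x, (ha x hx2.le).2, (ha x hx2.le).1, by simpa using hx⟩

/-- If `M_*` is the limiting distribution, `profileRatio` is the limit of `φ(s)/s`. -/
noncomputable def profileRatio (F : ℝ → ℝ) (σ : ℝ) : ℝ :=
  ∫ z in Ioi 0, kerOneDensity z * F (z / σ)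

lemma integrable_profileRatio (hF : IsNontrivialDistribution F) (σ : ℝ) :
    IntegrableOn (fun z => kerOneDensity z * F (z / σ)) (Ioi 0) := by
  refine integrable_integral_kerOneDensity.1.mono' (measurable_kerOneDensity.mul
    (hF.mono.measurable.comp (measurable_id.div_const σ))).aestronglyMeasurable ?_
  filter_upwards [ae_restrict_mem measurableSet_Ioi] with z hz
  have h1 := (kerOneDensity_pos hz).le
  rw [Real.norm_eq_abs, abs_of_nonneg (mul_nonneg h1 (hF.nonneg _))]
  exact mul_le_of_le_one_right h1 (hF.le_one _)

/-- Bounded a.e. convergence of distribution functions passes to the averages. -/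
lemma tendsto_average (hF : IsNontrivialDistribution F) {ι : Type*} {l : Filter ι}
    [l.IsCountablyGenerated] {σ : ℝ} (hσ : 0 < σ) {f : ι → ℝ → ℝ}
    (hfm : ∀ i, Measurable (f i)) (hf : ∀ᶠ i in l, ∀ z, 0 < z → 0 ≤ f i z ∧ f i z ≤ 1)
    (hlim : ∀ z, 0 < z → ContinuousAt F (z / σ) → Tendsto (fun i => f i z) l (𝓝 (F (z / σ)))) :
    Tendsto (fun i => ∫ z in Ioi 0, kerOneDensity z * f i z) l (𝓝 (profileRatio F σ)) := by
  refine tendsto_integral_filter_of_dominated_convergence kerOneDensity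
    (Eventually.of_forall fun i => (measurable_kerOneDensity.mul (hfm i)).aestronglyMeasurable) ?_
    integrable_integral_kerOneDensity.1 ?_
  · filter_upwards [hf] with i hi
    filter_upwards [ae_restrict_mem measurableSet_Ioi] with z hz
    have h1 := (kerOneDensity_pos hz).le
    rw [Real.norm_eq_abs, abs_of_nonneg (mul_nonneg h1 (hi z hz).1)]
    exact mul_le_of_le_one_right h1 (hi z hz).2
  · filter_upwards [ae_restrict_mem measurableSet_Ioi, ae_restrict_of_ae (hF.ae_continuousAt hσ)]
      with z hz hc
    exact (hlim z hz hc).const_mul _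

lemma continuousOn_profileRatio (hF : IsNontrivialDistribution F) :
    ContinuousOn (profileRatio F) (Ioi 0) := by
  intro σ hσ
  refine ContinuousAt.continuousWithinAt ?_
  refine hF.tendsto_average hσ (fun i => hF.mono.measurable.comp (measurable_id.div_const i))
    (Eventually.of_forall fun i z _ => ⟨hF.nonneg _, hF.le_one _⟩) fun z hz hc => ?_
  have : Tendsto (fun i : ℝ => z / i) (𝓝 σ) (𝓝 (z / σ)) :=
    tendsto_const_nhds.div tendsto_id (mem_Ioi.1 hσ).ne'
  exact hc.tendsto.comp this

/-- Strict monotonicity holds because `F` tends to `1` without being identically `1`, and hence is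
not invariant under any dilation. -/
lemma profileRatio_strictAntiOn (hF : IsNontrivialDistribution F) :
    StrictAntiOn (profileRatio F) (Ioi 0) := by
  intro a ha b hb hab
  have ha0 : 0 < a := ha
  have hb0 : 0 < b := hb
  have hle : ∀ z, 0 < z → F (z / b) ≤ F (z / a) := fun z hz => hF.mono (by gcongr)
  by_contra hcon
  -- otherwise `F` is invariant under the dilation by `b / a`, hence constant
  have hnn : 0 ≤ᵐ[volume.restrict (Ioi 0)] fun z => kerOneDensity z * F (z / a) -
      kerOneDensity z * F (z / b) := by
    filter_upwards [ae_restrict_mem measurableSet_Ioi] with z hz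
    simp only [Pi.zero_apply, sub_nonneg]
    exact mul_le_mul_of_nonneg_left (hle z hz) (kerOneDensity_pos hz).le
  have hzero : ∫ z in Ioi 0, (kerOneDensity z * F (z / a) - kerOneDensity z * F (z / b)) = 0 := by
    refine le_antisymm ?_ (integral_nonneg_of_ae hnn)
    rw [integral_sub (hF.integrable_profileRatio a) (hF.integrable_profileRatio b)]
    exact sub_nonpos.2 (not_lt.1 hcon)
  rw [integral_eq_zero_iff_of_nonneg_ae hnn
    ((hF.integrable_profileRatio a).sub (hF.integrable_profileRatio b))] at hzero
  rw [Filter.EventuallyEq, ae_restrict_iff' measurableSet_Ioi] at hzero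
  have heq : ∀ᵐ z : ℝ, 0 < z → F (z / a) = F (z / b) := by
    filter_upwards [hzero] with z hz h0
    have := hz h0
    simp only [Pi.zero_apply, ← mul_sub, mul_eq_zero, (kerOneDensity_pos h0).ne', false_or] at this
    linarith
  -- from almost every `z` to every `z` by right continuity
  have hall : ∀ z : ℝ, 0 < z → F (z / a) = F (z / b) := by
    intro z hz
    have hcont : ∀ c, 0 < c → Tendsto (fun y => F (y / c)) (𝓝[>] z) (𝓝 (F (z / c))) := by
      intro c hc
      have h1 := hF.right_cont (z / c)
      have h2 : Tendsto (fun y : ℝ => y / c) (𝓝[>] z) (𝓝[≥] (z / c)) := by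
        refine tendsto_nhdsWithin_iff.2 ⟨?_, ?_⟩
        · exact ((continuous_id.div_const c).tendsto z).mono_left nhdsWithin_le_nhds
        · filter_upwards [self_mem_nhdsWithin] with y hy
          exact div_le_div_of_nonneg_right (le_of_lt hy) hc.le
      exact h1.tendsto.comp h2
    have hlim := (hcont a ha0).sub (hcont b hb0)
    by_contra hne
    have hev := hlim.eventually_ne (sub_ne_zero.2 hne)
    obtain ⟨u, hu, hu2⟩ := (mem_nhdsGT_iff_exists_Ioo_subset).1 hev
    obtain ⟨y, hy, hzy, hyu⟩ := (Measure.dense_of_ae heq).exists_between (mem_Ioi.1 hu)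
    exact hu2 ⟨hzy, hyu⟩ (sub_eq_zero.2 (hy (hz.trans hzy)))
  have hq : 1 < b / a := (one_lt_div ha0).2 hab
  have hdil : ∀ y : ℝ, 0 < y → F y = F (b / a * y) := by
    intro y hy
    have := hall (b * y) (mul_pos hb0 hy)
    rw [mul_div_cancel_left₀ _ hb0.ne'] at this
    rw [← this]; congr 1; ring
  have hpow : ∀ y : ℝ, 0 < y → ∀ n : ℕ, F y = F ((b / a) ^ n * y) := by
    intro y hy n
    induction n with
    | zero => simp
    | succ n ih =>
      rw [ih, hdil _ (by positivity), pow_succ']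
      congr 1; ring
  obtain ⟨x, hx, hx1⟩ := hF.nontrivial
  have h1 : Tendsto (fun n : ℕ => F ((b / a) ^ n * x)) atTop (𝓝 1) :=
    hF.tendsto_one.comp ((tendsto_pow_atTop_atTop_of_one_lt hq).atTop_mul_const hx)
  simp_rw [← hpow x hx] at h1
  exact hx1.ne (tendsto_nhds_unique tendsto_const_nhds h1)

lemma profileRatio_nonneg (hF : IsNontrivialDistribution F) (σ : ℝ) : 0 ≤ profileRatio F σ :=
  setIntegral_nonneg measurableSet_Ioi fun _ hz =>
    mul_nonneg (kerOneDensity_pos hz).le (hF.nonneg _)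

lemma profileRatio_pos (hF : IsNontrivialDistribution F) {σ : ℝ} (hσ : 0 < σ) :
    0 < profileRatio F σ :=
  (hF.profileRatio_nonneg (2 * σ)).trans_lt (hF.profileRatio_strictAntiOn hσ
    (mem_Ioi.2 (by linarith)) (by linarith))

lemma profileRatio_lt_one (hF : IsNontrivialDistribution F) {σ : ℝ} (hσ : 0 < σ) :
    profileRatio F σ < 1 := by
  refine (hF.profileRatio_strictAntiOn (mem_Ioi.2 (half_pos hσ)) hσ
    (half_lt_self hσ)).trans_le ?_
  rw [← integrable_integral_kerOneDensity.2]
  refine setIntegral_mono_on (hF.integrable_profileRatio _) integrable_integral_kerOneDensity.1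
    measurableSet_Ioi fun z hz => ?_
  exact mul_le_of_le_one_right (kerOneDensity_pos hz).le (hF.le_one _)

end IsNontrivialDistribution

open IsNontrivialDistribution

lemma lapExp_div_eq {m : Measure ℝ} [IsProbabilityMeasure m] (hm : m (Iic 0) = 0) {s : ℝ}
    (hs : 0 < s) : lapExp m s / s = ∫ z in Ioi 0, kerOneDensity z * m.real (Iic (z / s)) := by
  rw [lapExp_eq_mul_kerOne hs, mul_div_cancel_left₀ _ hs.ne']
  exact integral_kernel_eq (fun z hz => (kerOneDensity_pos hz).le) measurable_kerOneDensity
    (fun z hz => hasDerivAt_kerOne hz) tendsto_kerOne_atTop measurable_kerOne hm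
    (fun c => measure_ne_top _ _) hs

lemma exp_neg_mul_le_lapTr {m : Measure ℝ} [IsProbabilityMeasure m] (hm : m (Iic 0) = 0) {s : ℝ}
    (hs : 0 ≤ s) (x : ℝ) : Real.exp (-(s * x)) * m.real (Iic x) ≤ lapTr m s := by
  calc Real.exp (-(s * x)) * m.real (Iic x) = ∫ _ in Iic x, Real.exp (-(s * x)) ∂m := by
        rw [setIntegral_const, smul_eq_mul, mul_comm]
    _ ≤ ∫ y in Iic x, Real.exp (-(s * y)) ∂m := by
        refine setIntegral_mono_on (integrable_const _).integrableOn
          (integrable_lapTr hm hs).integrableOn measurableSet_Iic fun y hy => ?_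
        exact Real.exp_le_exp.2 (neg_le_neg (mul_le_mul_of_nonneg_left hy hs))
    _ ≤ lapTr m s := setIntegral_le_integral (integrable_lapTr hm hs)
        (ae_of_all _ fun y => (Real.exp_pos _).le)

section Limit
variable {μ : ℝ → Measure ℝ} [∀ t, IsProbabilityMeasure (μ t)] {F : ℝ → ℝ}

lemma tendsto_lapExp_div (hμ : ∀ t, μ t (Iic 0) = 0) (hF : IsNontrivialDistribution F)
    (hconv : ∀ x, 0 < x → ContinuousAt F x →
      Tendsto (fun t => (μ t).real (Iic x)) atTop (𝓝 (F x))) {σ : ℝ} (hσ : 0 < σ) :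
    Tendsto (fun t => lapExp (μ t) σ / σ) atTop (𝓝 (profileRatio F σ)) := by
  simp_rw [fun t => lapExp_div_eq (hμ t) hσ]
  refine hF.tendsto_average hσ (fun t => ?_)
    (Eventually.of_forall fun t z _ => ⟨measureReal_nonneg, measureReal_le_one⟩)
    fun z hz hc => hconv _ (div_pos hz hσ) hc
  have hmono : Monotone fun c => (μ t).real (Iic c) := fun a b hab =>
    measureReal_mono (Iic_subset_Iic.2 hab)
  exact hmono.measurable.comp (measurable_id.div_const σ)

/-- The limit `σ P(σ)` of the rescaled exponents is strictly increasing: their derivatives, the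
Laplace transforms, are bounded below because the limiting distribution has mass near `0`. -/
lemma mul_profileRatio_strictMonoOn (hμ : ∀ t, μ t (Iic 0) = 0) (hF : IsNontrivialDistribution F)
    (hconv : ∀ x, 0 < x → ContinuousAt F x →
      Tendsto (fun t => (μ t).real (Iic x)) atTop (𝓝 (F x))) :
    StrictMonoOn (fun σ => σ * profileRatio F σ) (Ioi 0) := by
  intro a ha b hb hab
  have ha0 : 0 < a := ha
  have hb0 : 0 < b := hb
  obtain ⟨x, hx, hFx, hcx⟩ := hF.exists_continuousAt_pos
  have hlim : ∀ σ, 0 < σ → Tendsto (fun t => lapExp (μ t) σ) atTop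
      (𝓝 (σ * profileRatio F σ)) := fun σ hσ => by
    refine ((tendsto_lapExp_div hμ hF hconv hσ).const_mul σ).congr fun t => ?_
    field_simp
  have h1 : Tendsto (fun t => Real.exp (-(b * x)) * (μ t).real (Iic x) * (b - a)) atTop
      (𝓝 (Real.exp (-(b * x)) * F x * (b - a))) := ((hconv x hx hcx).const_mul _).mul_const _
  have h2 : Real.exp (-(b * x)) * F x * (b - a) ≤ b * profileRatio F b - a * profileRatio F a := by
    refine le_of_tendsto_of_tendsto' h1 ((hlim b hb).sub (hlim a ha)) fun t => ?_
    refine le_trans ?_ (lapTr_mul_le (hμ t) ha0.le hab.le)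
    exact mul_le_mul_of_nonneg_right (exp_neg_mul_le_lapTr (hμ t) hb0.le x) (sub_pos.2 hab).le
  have h3 : 0 < Real.exp (-(b * x)) * F x * (b - a) :=
    mul_pos (mul_pos (Real.exp_pos _) hFx) (sub_pos.2 hab)
  simp only
  linarith

end Limit

/-- The excess ratio `s / φ(s) - 1`. -/
noncomputable def excess (m : Measure ℝ) (s : ℝ) : ℝ := s / lapExp m s - 1

section Excess
variable {m : Measure ℝ} [IsProbabilityMeasure m]

lemma excess_pos (hm : m (Iic 0) = 0) {s : ℝ} (hs : 0 < s) : 0 < excess m s := by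
  rw [excess, sub_pos, one_lt_div (lapExp_pos hm hs)]
  exact lapExp_lt_self hm hs

lemma excess_strictMonoOn (hm : m (Iic 0) = 0) : StrictMonoOn (excess m) (Ioi 0) := by
  intro a ha b hb hab
  have h := lapExp_div_strictAntiOn hm ha hb hab
  have hb' : 0 < lapExp m b / b := div_pos (lapExp_pos hm hb) hb
  have := inv_strictAnti₀ hb' h
  simp only [inv_div] at this
  exact sub_lt_sub_right this 1

lemma tendsto_excess_zero (hm : m (Iic 0) = 0) : Tendsto (excess m) (𝓝[>] 0) (𝓝[>] 0) := by
  refine tendsto_nhdsWithin_iff.2 ⟨?_, ?_⟩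
  · have := ((tendsto_lapExp_div_zero hm).inv₀ one_ne_zero).sub_const 1
    simp only [inv_div, inv_one, sub_self] at this
    exact this
  · filter_upwards [self_mem_nhdsWithin] with s hs using excess_pos hm hs

lemma tendsto_lapExp_ratio (hm : m (Iic 0) = 0) {c : ℝ} (hc : 0 < c) :
    Tendsto (fun s => lapExp m (c * s) / lapExp m s) (𝓝[>] 0) (𝓝 c) := by
  have hsc : Tendsto (fun s => c * s) (𝓝[>] 0) (𝓝[>] 0) := by
    refine tendsto_nhdsWithin_iff.2 ⟨?_, ?_⟩
    · have : Tendsto (fun s : ℝ => c * s) (𝓝 0) (𝓝 (c * 0)) :=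
        (continuous_const.mul continuous_id).tendsto 0
      rw [mul_zero] at this
      exact this.mono_left nhdsWithin_le_nhds
    · filter_upwards [self_mem_nhdsWithin] with s hs using mul_pos hc hs
  have := (((tendsto_lapExp_div_zero hm).comp hsc).div (tendsto_lapExp_div_zero hm)
    one_ne_zero).const_mul c
  rw [div_one, mul_one] at this
  refine this.congr' ?_
  filter_upwards [self_mem_nhdsWithin] with s hs
  have hs0 : 0 < s := hs
  have := lapExp_pos hm hs0
  simp only [Function.comp, Pi.div_apply]
  field_simp

lemma kerTwo_two_mul_le {z : ℝ} (hz : 0 < z) : kerTwo (2 * z) ≤ kerTwo z := by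
  have : AntitoneOn kerTwo (Ioi 0) := by
    refine antitoneOn_of_hasDerivWithinAt_nonpos (convex_Ioi 0)
      (fun x hx => (hasDerivAt_kerTwo hx).continuousAt.continuousWithinAt)
      (f' := fun z => -kerTwoDensity z) ?_ ?_
    · intro x hx; rw [interior_Ioi] at hx
      exact (hasDerivAt_kerTwo hx).hasDerivWithinAt
    · intro x hx; rw [interior_Ioi] at hx
      simpa using kerTwoDensity_nonneg hx
  exact this hz (mem_Ioi.2 (by linarith)) (by linarith)

/-- The gap `s - φ(s)` grows at most quadratically. -/
lemma gap_two_mul_le (hm : m (Iic 0) = 0) {s : ℝ} (hs : 0 < s) :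
    2 * s - lapExp m (2 * s) ≤ 4 * (s - lapExp m s) := by
  have e : ∀ s, 0 < s → s - lapExp m s = ∫ x, (s - (1 - Real.exp (-(s * x))) / x) ∂m := by
    intro s hs
    rw [integral_sub (integrable_const s) (integrable_lapExp hm hs.le), lapExp]; simp
  rw [e s hs, e (2 * s) (by linarith), ← integral_const_mul]
  refine integral_mono_ae ((integrable_const _).sub (integrable_lapExp hm (by linarith)))
    (((integrable_const _).sub (integrable_lapExp hm hs.le)).const_mul 4) ?_
  filter_upwards [ae_pos_of_null_Iic hm] with x hx
  have h := kerTwo_two_mul_le (mul_pos hs hx)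
  have e1 : 4 * (s - (1 - Real.exp (-(s * x))) / x) = 4 * (s ^ 2 * x * kerTwo (s * x)) := by
    rw [kerTwo]; field_simp; ring
  have e2 : 2 * s - (1 - Real.exp (-(2 * s * x))) / x = 4 * (s ^ 2 * x * kerTwo (2 * (s * x))) := by
    rw [kerTwo, ← mul_assoc 2 s x]; field_simp; ring
  rw [e1, e2]
  gcongr

end Excess

end Smoluchowski

namespace Smoluchowski
open IsNontrivialDistribution

/-! ### Convergence along characteristics -/

/-- Every point of the `s`-axis at time `t` is reached by a characteristic. Along it, `e^t` times
the excess of `φ₀` is the excess of `φ(t,·)`. -/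
lemma IsLapFlow.exists_characteristic {m : ℝ → Measure ℝ} (h : IsLapFlow m) {t : ℝ} (ht : 0 ≤ t)
    {l σ : ℝ} (hl : 0 < l) (hσ : 0 < σ) :
    ∃ a, 0 < a ∧ l * Real.exp (-t) * lapExp (m 0) a = lapExp (rescale (m t) l) σ ∧
      Real.exp t * excess (m 0) a = σ / lapExp (rescale (m t) l) σ - 1 := by
  have hprob := h.prob
  have hm0 := h.null 0
  set S := σ / l with hS
  have hS0 : 0 < S := div_pos hσ hl
  set e := Real.exp (-t) with he
  have he0 : 0 < e := Real.exp_pos _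
  have he1 : e ≤ 1 := by rw [he, Real.exp_le_one_iff]; linarith
  have hc : ContinuousOn (fun a => a - (1 - e) * lapExp (m 0) a) (Icc 0 (S / e)) :=
    continuousOn_id.sub (continuousOn_const.mul
      ((continuousOn_lapExp hm0).mono Icc_subset_Ici_self))
  have hb0 : 0 < S / e := div_pos hS0 he0
  have hmem : S ∈ Icc (0 - (1 - e) * lapExp (m 0) 0) (S / e - (1 - e) * lapExp (m 0) (S / e)) := by
    refine ⟨by simpa using hS0.le, ?_⟩
    have h1 := lapExp_le_self hm0 hb0.le
    have h2 : (1 - e) * lapExp (m 0) (S / e) ≤ (1 - e) * (S / e) :=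
      mul_le_mul_of_nonneg_left h1 (by linarith)
    have h3 : (1 - e) * (S / e) = S / e - S := by field_simp
    linarith
  obtain ⟨a, ha, hae⟩ := intermediate_value_Icc hb0.le hc hmem
  simp only at hae
  have ha0 : 0 < a := by
    refine lt_of_le_of_ne ha.1 fun h0 => ?_
    rw [← h0] at hae
    simp at hae
    linarith
  have hch := h.characteristic ht ha0
  rw [← he, hae] at hch
  have hq := lapExp_pos hm0 ha0
  have hu : lapExp (rescale (m t) l) σ = l * (e * lapExp (m 0) a) := by
    rw [lapExp_rescale, ← hS, hch]
  refine ⟨a, ha0, by rw [hu]; ring, ?_⟩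
  have hσe : σ = l * (a - (1 - e) * lapExp (m 0) a) := by
    rw [hae, hS]; field_simp
  have het : Real.exp t = e⁻¹ := by rw [he, Real.exp_neg, inv_inv]
  rw [hu, excess, het]
  nth_rewrite 1 [hσe]
  field_simp
  ring

/-- A scaling limit of the flow makes the excess regularly varying. For small `s` the time is
chosen with `e^t R(s)` constant; since `e^t` varies continuously this needs no regularity of the
scale function. -/
theorem IsLapFlow.tendsto_excess_ratio {m : ℝ → Measure ℝ} (h : IsLapFlow m) {scale F : ℝ → ℝ}
    (hpos : ∀ t, 0 < scale t) (hF : IsNontrivialDistribution F)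
    (hconv : ∀ x, 0 < x → ContinuousAt F x →
      Tendsto (fun t => (rescale (m t) (scale t)).real (Iic x)) atTop (𝓝 (F x)))
    {c : ℝ} (hc0 : 0 < c) (hc1 : c < 1) :
    ∃ r, 0 < r ∧ r < 1 ∧
      Tendsto (fun s => excess (m 0) (c * s) / excess (m 0) s) (𝓝[>] 0) (𝓝 r) := by
  have hprob := h.prob
  have hm0 := h.null 0
  -- `P`, `Q` and `K` are the limits of `φ(σ)/σ`, of `φ(σ)` and of the excess of the rescaled measures
  set P := profileRatio F with hP
  set Q : ℝ → ℝ := fun σ => σ * P σ with hQ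
  set K : ℝ → ℝ := fun σ => (P σ)⁻¹ - 1 with hK
  set R := excess (m 0) with hR
  have hμ : ∀ t, rescale (m t) (scale t) (Iic 0) = 0 := fun t => rescale_null (h.null t) (hpos t)
  have hPpos : ∀ σ, 0 < σ → 0 < P σ := fun σ hσ => hF.profileRatio_pos hσ
  have hKpos : ∀ σ, 0 < σ → 0 < K σ := fun σ hσ =>
    sub_pos.2 ((one_lt_inv₀ (hPpos σ hσ)).2 (hF.profileRatio_lt_one hσ))
  have hKmono : StrictMonoOn K (Ioi 0) := fun a ha b hb hab =>
    sub_lt_sub_right (inv_strictAnti₀ (hPpos b hb) (hF.profileRatio_strictAntiOn ha hb hab)) 1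
  have hQmono : StrictMonoOn Q (Ioi 0) := mul_profileRatio_strictMonoOn hμ hF hconv
  have hPc := hF.continuousOn_profileRatio
  have hQc : ContinuousOn Q (Ioi 0) := continuousOn_id.mul hPc
  have hKc : ContinuousOn K (Ioi 0) :=
    (hPc.inv₀ fun σ hσ => (hPpos σ hσ).ne').sub continuousOn_const
  have hQpos : ∀ σ, 0 < σ → 0 < Q σ := fun σ hσ => mul_pos hσ (hPpos σ hσ)
  have hRpos : ∀ s, 0 < s → 0 < R s := fun s hs => excess_pos hm0 hs
  have hRmono : StrictMonoOn R (Ioi 0) := excess_strictMonoOn hm0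
  -- the time attached to `s`
  set T : ℝ → ℝ := fun s => Real.log (K 1 / R s) with hT
  have hTexp : ∀ s, 0 < s → Real.exp (T s) = K 1 / R s := fun s hs =>
    Real.exp_log (div_pos (hKpos 1 one_pos) (hRpos s hs))
  have hTlim : Tendsto T (𝓝[>] 0) atTop := by
    refine Real.tendsto_log_atTop.comp ?_
    have h1 : Tendsto (fun s => K 1 * (R s)⁻¹) (𝓝[>] 0) atTop :=
      (tendsto_inv_nhdsGT_zero.comp (tendsto_excess_zero hm0)).const_mul_atTop (hKpos 1 one_pos)
    exact h1.congr fun s => (div_eq_mul_inv _ _).symm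
  -- the characteristic through `σ` in the rescaled variable
  have hex : ∀ σ t, 0 < σ → 0 ≤ t → ∃ a, 0 < a ∧
      scale t * Real.exp (-t) * lapExp (m 0) a = lapExp (rescale (m t) (scale t)) σ ∧
      Real.exp t * R a = σ / lapExp (rescale (m t) (scale t)) σ - 1 :=
    fun σ t hσ ht => h.exists_characteristic ht (hpos t) hσ
  choose! A hA0 hA1 hA2 using hex
  have hTnn : ∀ᶠ s in 𝓝[>] 0, 0 ≤ T s := hTlim.eventually_ge_atTop 0
  set b : ℝ → ℝ := fun s => scale (T s) * Real.exp (-T s) with hb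
  have hbpos : ∀ s, 0 < b s := fun s => mul_pos (hpos _) (Real.exp_pos _)
  have hlimφ : ∀ σ, 0 < σ → Tendsto (fun s => b s * lapExp (m 0) (A σ (T s))) (𝓝[>] 0)
      (𝓝 (Q σ)) := by
    intro σ hσ
    have h1 := ((tendsto_lapExp_div hμ hF hconv hσ).comp hTlim).const_mul σ
    refine h1.congr' ?_
    filter_upwards [hTnn] with s hs
    simp only [Function.comp, hb]
    rw [hA1 σ (T s) hσ hs]; field_simp
  have hlimR : ∀ σ, 0 < σ → Tendsto (fun s => R (A σ (T s)) / R s) (𝓝[>] 0)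
      (𝓝 (K σ / K 1)) := by
    intro σ hσ
    have h1 := ((((tendsto_lapExp_div hμ hF hconv hσ).comp hTlim).inv₀
      (hPpos σ hσ).ne').sub_const 1).div_const (K 1)
    refine h1.congr' ?_
    filter_upwards [hTnn, self_mem_nhdsWithin] with s hs hs0
    have h2 := hA2 σ (T s) hσ hs
    rw [hTexp s hs0] at h2
    have hK1 := hKpos 1 one_pos
    have hRs := hRpos s hs0
    simp only [Function.comp, inv_div]
    rw [← h2]; field_simp
  -- `s` lies between the starting points of the characteristics with parameters on either side of
  -- `1`, by monotonicity of the excess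
  have hφs : Tendsto (fun s => b s * lapExp (m 0) s) (𝓝[>] 0) (𝓝 (Q 1)) := by
    have hQ1 : ContinuousAt Q 1 := hQc.continuousAt (Ioi_mem_nhds one_pos)
    refine tendsto_order.2 ⟨fun a ha => ?_, fun a ha => ?_⟩
    · have hev : ∀ᶠ σ in 𝓝[<] (1 : ℝ), a < Q σ ∧ 0 < σ :=
        (((hQ1.eventually_const_lt ha).and (lt_mem_nhds one_pos)).filter_mono nhdsWithin_le_nhds)
      obtain ⟨σ, ⟨h1, hσ⟩, hσ1⟩ := (hev.and self_mem_nhdsWithin).exists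
      have hr : K σ / K 1 < 1 := (div_lt_one (hKpos 1 one_pos)).2 (hKmono hσ (mem_Ioi.2 one_pos) hσ1)
      filter_upwards [(hlimφ σ hσ).eventually_const_lt h1, (hlimR σ hσ).eventually_lt_const hr,
        hTnn, self_mem_nhdsWithin] with s e1 e2 e3 hs
      rw [div_lt_one (hRpos s hs)] at e2
      have hAs := (hRmono.lt_iff_lt (hA0 σ _ hσ e3) hs).1 e2
      refine e1.trans (mul_lt_mul_of_pos_left ?_ (hbpos s))
      exact lapExp_strictMonoOn hm0 (hA0 σ _ hσ e3).le (mem_Ioi.1 hs).le hAs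
    · have hev : ∀ᶠ σ in 𝓝[>] (1 : ℝ), Q σ < a ∧ 0 < σ :=
        (((hQ1.eventually_lt_const ha).and (lt_mem_nhds one_pos)).filter_mono nhdsWithin_le_nhds)
      obtain ⟨σ, ⟨h1, hσ⟩, hσ1⟩ := (hev.and self_mem_nhdsWithin).exists
      have hr : 1 < K σ / K 1 := (one_lt_div (hKpos 1 one_pos)).2 (hKmono (mem_Ioi.2 one_pos) hσ hσ1)
      filter_upwards [(hlimφ σ hσ).eventually_lt_const h1, (hlimR σ hσ).eventually_const_lt hr,
        hTnn, self_mem_nhdsWithin] with s e1 e2 e3 hs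
      rw [one_lt_div (hRpos s hs)] at e2
      have hAs := (hRmono.lt_iff_lt hs (hA0 σ _ hσ e3)).1 e2
      refine lt_trans (mul_lt_mul_of_pos_left ?_ (hbpos s)) e1
      exact lapExp_strictMonoOn hm0 (mem_Ioi.1 hs).le (hA0 σ _ hσ e3).le hAs
  -- the parameter `σ` corresponding to the factor `c`
  have hQ1le : Q 1 < 1 := by simpa [hQ] using hF.profileRatio_lt_one one_pos
  have hQ1 := hQpos 1 one_pos
  obtain ⟨σ, hσ0, hσ1, hσQ⟩ : ∃ σ, 0 < σ ∧ σ < 1 ∧ Q σ = c * Q 1 := by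
    have hle : c * Q 1 ≤ 1 := by nlinarith
    have hcQ : 0 < c * Q 1 := mul_pos hc0 hQ1
    have hsub : Icc (c * Q 1) 1 ⊆ Ioi 0 := fun z hz => lt_of_lt_of_le hcQ hz.1
    have hm1 : Q (c * Q 1) ≤ c * Q 1 :=
      mul_le_of_le_one_right hcQ.le (hF.profileRatio_lt_one hcQ).le
    obtain ⟨σ, hσ, hσe⟩ := intermediate_value_Icc hle (hQc.mono hsub)
      (show c * Q 1 ∈ Icc (Q (c * Q 1)) (Q 1) from ⟨hm1, by nlinarith⟩)
    refine ⟨σ, hsub hσ, lt_of_le_of_ne hσ.2 fun h1 => ?_, hσe⟩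
    rw [h1] at hσe
    nlinarith
  have hK1 := hKpos 1 one_pos
  refine ⟨K σ / K 1, div_pos (hKpos σ hσ0) hK1,
    (div_lt_one hK1).2 (hKmono hσ0 (mem_Ioi.2 one_pos) hσ1), ?_⟩
  have hφcs : Tendsto (fun s => b s * lapExp (m 0) (c * s)) (𝓝[>] 0) (𝓝 (Q σ)) := by
    rw [hσQ]
    refine ((tendsto_lapExp_ratio hm0 hc0).mul hφs).congr' ?_
    filter_upwards [self_mem_nhdsWithin] with s hs
    have := lapExp_pos hm0 hs
    field_simp
  -- `c s` lies between the starting points of the characteristics with parameters on either side of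
  -- `σ`, by monotonicity of the exponent; the excess is monotone, too
  have hKσ : ContinuousAt (fun x => K x / K 1) σ :=
    (hKc.continuousAt (Ioi_mem_nhds hσ0)).div_const _
  refine tendsto_order.2 ⟨fun a ha => ?_, fun a ha => ?_⟩
  · have hev : ∀ᶠ x in 𝓝[<] σ, a < K x / K 1 ∧ 0 < x :=
      (((hKσ.eventually_const_lt ha).and (lt_mem_nhds hσ0)).filter_mono nhdsWithin_le_nhds)
    obtain ⟨x, ⟨h1, hx⟩, hxσ⟩ := (hev.and self_mem_nhdsWithin).exists
    filter_upwards [(hlimφ x hx).eventually_lt hφcs (hQmono hx hσ0 hxσ),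
      (hlimR x hx).eventually_const_lt h1, hTnn, self_mem_nhdsWithin] with s e1 e2 e3 hs
    have hcs : 0 < c * s := mul_pos hc0 hs
    have hlt := (lapExp_strictMonoOn hm0).lt_iff_lt (hA0 x _ hx e3).le hcs.le |>.1
      (lt_of_mul_lt_mul_left e1 (hbpos s).le)
    refine e2.trans (div_lt_div_of_pos_right ?_ (hRpos s hs))
    exact hRmono (hA0 x _ hx e3) hcs hlt
  · have hev : ∀ᶠ x in 𝓝[>] σ, K x / K 1 < a ∧ 0 < x :=
      (((hKσ.eventually_lt_const ha).and (lt_mem_nhds hσ0)).filter_mono nhdsWithin_le_nhds)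
    obtain ⟨x, ⟨h1, hx⟩, hxσ⟩ := (hev.and self_mem_nhdsWithin).exists
    filter_upwards [hφcs.eventually_lt (hlimφ x hx) (hQmono hσ0 hx hxσ),
      (hlimR x hx).eventually_lt_const h1, hTnn, self_mem_nhdsWithin] with s e1 e2 e3 hs
    have hcs : 0 < c * s := mul_pos hc0 hs
    have hlt := (lapExp_strictMonoOn hm0).lt_iff_lt hcs.le (hA0 x _ hx e3).le |>.1
      (lt_of_mul_lt_mul_left e1 (hbpos s).le)
    refine lt_trans (div_lt_div_of_pos_right ?_ (hRpos s hs)) e2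
    exact hRmono hcs (hA0 x _ hx e3) hlt

/-- A scaling limit makes `s - φ₀(s)` regularly varying with index `1 + ρ`. Here `0 < ρ` because
the limiting ratios of the excess are less than `1`, and `ρ ≤ 1` because the gap grows at most
quadratically. -/
theorem IsLapFlow.exists_index {m : ℝ → Measure ℝ} (h : IsLapFlow m) {scale F : ℝ → ℝ}
    (hpos : ∀ t, 0 < scale t) (hF : IsNontrivialDistribution F)
    (hconv : ∀ x, 0 < x → ContinuousAt F x →
      Tendsto (fun t => (rescale (m t) (scale t)).real (Iic x)) atTop (𝓝 (F x))) :
    ∃ ρ : ℝ, 0 < ρ ∧ ρ ≤ 1 ∧ ∀ c : ℝ, 0 < c → Tendsto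
      (fun s => (c * s - lapExp (m 0) (c * s)) / (s - lapExp (m 0) s)) (𝓝[>] 0)
      (𝓝 (c ^ (1 + ρ))) := by
  have hprob := h.prob
  have hm0 := h.null 0
  obtain ⟨ρ, hρ⟩ := exists_rpow_limit_of_monotone (R := excess (m 0))
    (fun s hs => excess_pos hm0 hs) (excess_strictMonoOn hm0).monotoneOn (fun c hc0 hc1 => by
      obtain ⟨r, h1, _, h3⟩ := h.tendsto_excess_ratio hpos hF hconv hc0 hc1
      exact ⟨r, h1, h3⟩)
  have hρ0 : 0 < ρ := by
    obtain ⟨r, _, h2, h3⟩ := h.tendsto_excess_ratio hpos hF hconv (c := 1 / 2) (by norm_num)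
      (by norm_num)
    have he := tendsto_nhds_unique h3 (hρ (1 / 2) (by norm_num))
    rw [he] at h2
    by_contra hcon
    have := Real.one_le_rpow_of_pos_of_le_one_of_nonpos (show (0 : ℝ) < 1 / 2 by norm_num)
      (by norm_num) (not_lt.1 hcon)
    linarith
  have hgap : ∀ s, 0 < s → s - lapExp (m 0) s = excess (m 0) s * lapExp (m 0) s := by
    intro s hs
    have := lapExp_pos hm0 hs
    rw [excess]; field_simp
  have hlim : ∀ c : ℝ, 0 < c → Tendsto
      (fun s => (c * s - lapExp (m 0) (c * s)) / (s - lapExp (m 0) s)) (𝓝[>] 0)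
      (𝓝 (c ^ (1 + ρ))) := by
    intro c hc
    have h1 := (hρ c hc).mul (tendsto_lapExp_ratio hm0 hc)
    rw [add_comm, Real.rpow_add_one hc.ne']
    refine h1.congr' ?_
    filter_upwards [self_mem_nhdsWithin] with s hs
    rw [hgap s hs, hgap (c * s) (mul_pos hc hs), div_mul_div_comm]
  refine ⟨ρ, hρ0, ?_, hlim⟩
  have h4 : (2 : ℝ) ^ (1 + ρ) ≤ 4 := by
    refine le_of_tendsto (hlim 2 two_pos) ?_
    filter_upwards [self_mem_nhdsWithin] with s hs
    rw [div_le_iff₀ (sub_pos.2 (lapExp_lt_self hm0 hs))]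
    exact gap_two_mul_le hm0 hs
  have : (2 : ℝ) ^ (1 + ρ) ≤ 2 ^ (2 : ℝ) := by norm_num at h4 ⊢; exact h4
  have := (Real.rpow_le_rpow_left_iff (by norm_num : (1 : ℝ) < 2)).1 this
  linarith

/-! ### The Tauberian theorem for the second moment -/

/-- The Laplace transform `∫ x e^{-sx} m(dx)` of the second moment measure. -/
noncomputable def lapMom (m : Measure ℝ) (s : ℝ) : ℝ := ∫ x, x * Real.exp (-(s * x)) ∂m

section
variable {m : Measure ℝ} [IsProbabilityMeasure m]

lemma integrable_lapMom (hm : m (Iic 0) = 0) {s : ℝ} (hs : 0 < s) :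
    Integrable (fun x => x * Real.exp (-(s * x))) m := by
  refine Integrable.of_bound (by fun_prop) (1 / s) ?_
  filter_upwards [ae_pos_of_null_Iic hm] with x hx
  rw [Real.norm_eq_abs, abs_of_pos (by positivity), le_div_iff₀ hs, Real.exp_neg]
  have h1 := Real.add_one_le_exp (s * x)
  have h2 := Real.exp_pos (s * x)
  rw [mul_right_comm, ← div_eq_mul_inv, div_le_one h2]
  linarith

lemma lapMom_pos (hm : m (Iic 0) = 0) {s : ℝ} (hs : 0 < s) : 0 < lapMom m s := by
  have := integral_lt_integral_of_ae_lt (integrable_zero ℝ ℝ m) (integrable_lapMom hm hs) (by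
    filter_upwards [ae_pos_of_null_Iic hm] with x hx using by positivity)
  simpa [lapMom] using this

lemma lapMom_mul_le (hm : m (Iic 0) = 0) {a b : ℝ} (ha : 0 < a) (hab : a < b) :
    lapMom m b * (b - a) ≤ lapTr m a - lapTr m b ∧
      lapTr m a - lapTr m b ≤ lapMom m a * (b - a) := by
  have hb := ha.trans hab
  have hia := integrable_lapTr hm ha.le
  have hib := integrable_lapTr hm hb.le
  have key : ∀ x, 0 < x → x * Real.exp (-(b * x)) * (b - a) ≤
      Real.exp (-(a * x)) - Real.exp (-(b * x)) ∧
      Real.exp (-(a * x)) - Real.exp (-(b * x)) ≤ x * Real.exp (-(a * x)) * (b - a) := by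
    intro x hx
    have h := exp_kernel_bounds (a := a) (b := b) hx
    rw [← sub_div, le_div_iff₀ hx, div_le_iff₀ hx] at h
    constructor <;> linarith [h.1, h.2]
  rw [lapTr, lapTr, ← integral_sub hia hib, lapMom, lapMom, ← integral_mul_const,
    ← integral_mul_const]
  constructor
  · refine integral_mono_ae ((integrable_lapMom hm hb).mul_const _) (hia.sub hib) ?_
    filter_upwards [ae_pos_of_null_Iic hm] with x hx using (key x hx).1
  · refine integral_mono_ae (hia.sub hib) ((integrable_lapMom hm ha).mul_const _) ?_
    filter_upwards [ae_pos_of_null_Iic hm] with x hx using (key x hx).2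

end

/-- A measure on `[0, ∞)` with Laplace transform a multiple of `s^{ρ-1}`: a power density for
`ρ < 1` and a point mass at `0` for `ρ = 1`. -/
lemma exists_power_measure {ρ : ℝ} (hρ0 : 0 < ρ) (hρ1 : ρ ≤ 1) :
    ∃ (μ : Measure ℝ) (K : ℝ), 0 < K ∧ μ (Iio 0) = 0 ∧
      (∀ s, 0 < s → ∫ x, Real.exp (-(s * x)) ∂μ = ρ * (1 + ρ) * s ^ (ρ - 1)) ∧
      ∀ x, 0 < x → μ {x} = 0 ∧ μ.real (Iic x) = K * x ^ (1 - ρ) := by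
  rcases hρ1.eq_or_lt with rfl | hlt
  · refine ⟨ENNReal.ofReal 2 • Measure.dirac 0, 2, two_pos, by simp, fun s hs => ?_,
      fun x hx => ⟨by simp [hx.ne], ?_⟩⟩
    · rw [integral_smul_measure]
      simp; norm_num
    · simp [measureReal_def, hx.le]
  · have hΓ : 0 < Real.Gamma (1 - ρ) := Real.Gamma_pos_of_pos (by linarith)
    set k := ρ * (1 + ρ) / Real.Gamma (1 - ρ) with hk
    have hk0 : 0 < k := by positivity
    have hdm : Measurable fun x : ℝ => ENNReal.ofReal (k * x ^ (-ρ)) := by fun_prop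
    set μ := (volume.restrict (Ioi 0)).withDensity fun x : ℝ => ENNReal.ofReal (k * x ^ (-ρ))
    have hac : μ ≪ volume :=
      (withDensity_absolutelyContinuous _ _).trans Measure.absolutelyContinuous_restrict
    refine ⟨μ, k / (1 - ρ), div_pos hk0 (by linarith), ?_, fun s hs => ?_,
      fun x hx => ⟨hac (by simp), ?_⟩⟩
    · refine withDensity_absolutelyContinuous _ _ ?_
      rw [Measure.restrict_apply measurableSet_Iio]
      convert measure_empty (μ := (volume : Measure ℝ))
      ext y; simp; intro h; exact h.le
    · rw [integral_withDensity_eq_integral_toReal_smul hdm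
        (ae_of_all _ fun x => ENNReal.ofReal_lt_top)]
      have h1 := Real.integral_rpow_mul_exp_neg_mul_Ioi (a := 1 - ρ) (r := s) (by linarith) hs
      rw [show 1 - ρ - 1 = -ρ by ring] at h1
      have h2 : ∫ x in Ioi 0, (ENNReal.ofReal (k * x ^ (-ρ))).toReal • Real.exp (-(s * x)) =
          ∫ x in Ioi 0, k * (x ^ (-ρ) * Real.exp (-(s * x))) := by
        refine setIntegral_congr_fun measurableSet_Ioi fun x hx => ?_
        have : 0 ≤ k * x ^ (-ρ) := mul_nonneg hk0.le (Real.rpow_nonneg (le_of_lt hx) _)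
        simp only [ENNReal.toReal_ofReal this, smul_eq_mul]
        ring
      rw [h2, integral_const_mul, h1, hk, one_div, Real.inv_rpow hs.le, ← Real.rpow_neg hs.le,
        neg_sub]
      field_simp
    · have hint : IntegrableOn (fun y : ℝ => k * y ^ (-ρ)) (Ioc 0 x) := by
        have := (intervalIntegral.intervalIntegrable_rpow' (a := 0) (b := x)
          (show -1 < -ρ by linarith)).const_mul k
        exact (intervalIntegrable_iff_integrableOn_Ioc_of_le hx.le).1 this
      have hset : Iic x ∩ Ioi 0 = Ioc 0 x := by ext y; simp [and_comm]
      rw [measureReal_def, withDensity_apply _ measurableSet_Iic,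
        Measure.restrict_restrict measurableSet_Iic, hset,
        ← ofReal_integral_eq_lintegral_ofReal hint, ENNReal.toReal_ofReal,
        ← intervalIntegral.integral_of_le hx.le, intervalIntegral.integral_const_mul,
        integral_rpow (Or.inl (by linarith)), Real.zero_rpow (by linarith),
        show -ρ + 1 = 1 - ρ by ring]
      · ring
      · refine setIntegral_nonneg measurableSet_Ioc fun y hy => ?_
        exact mul_nonneg hk0.le (Real.rpow_nonneg hy.1.le _)
      · filter_upwards [ae_restrict_mem measurableSet_Ioc] with y hy
        exact mul_nonneg hk0.le (Real.rpow_nonneg hy.1.le _)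

/-- **Tauberian theorem**: regular variation of `s - φ(s)` at `0` gives regular variation of the
truncated moment. The exponent is differentiated twice by monotonicity, which turns the asymptotic
relation into convergence of Laplace transforms. -/
theorem exists_truncMoment_limit {m : Measure ℝ} [IsProbabilityMeasure m] (hm : m (Iic 0) = 0)
    {ρ : ℝ} (hρ0 : 0 < ρ) (hρ1 : ρ ≤ 1)
    (hreg : ∀ c : ℝ, 0 < c → Tendsto
      (fun s => (c * s - lapExp m (c * s)) / (s - lapExp m s)) (𝓝[>] 0) (𝓝 (c ^ (1 + ρ)))) :
    ∃ (N : ℝ → ℝ) (K : ℝ), 0 < K ∧ (∀ᶠ l in atTop, 0 < N l) ∧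
      ∀ x, 0 < x → Tendsto (fun l => truncMoment m (l * x) / N l) atTop
        (𝓝 (K * x ^ (1 - ρ))) := by
  set G : ℝ → ℝ := fun l => l⁻¹ - lapExp m l⁻¹ with hG
  have hGpos : ∀ l, 0 < l → 0 < G l := fun l hl => sub_pos.2 (lapExp_lt_self hm (inv_pos.2 hl))
  have h0 : ∀ x, 0 < x → Tendsto (fun l => (x * l⁻¹ - lapExp m (x * l⁻¹)) / G l) atTop
      (𝓝 (x ^ (1 + ρ))) := fun x hx => (hreg x hx).comp tendsto_inv_atTop_nhdsGT_zero
  -- the first derivative of `s - φ(s)` is `1 - ψ(s)`, the second is `lapMom`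
  have h1 : ∀ x, 0 < x → Tendsto (fun l => (1 - lapTr m (x * l⁻¹)) / (l * G l)) atTop
      (𝓝 ((1 + ρ) * x ^ ρ)) := by
    intro x hx
    have hd : HasDerivAt (fun s : ℝ => -s ^ (1 + ρ)) (-((1 + ρ) * x ^ ρ)) x := by
      have := (Real.hasDerivAt_rpow_const (x := x) (p := 1 + ρ) (Or.inl hx.ne')).neg
      rwa [add_sub_cancel_left] at this
    have := tendsto_deriv_of_concave (l := atTop)
      (f := fun l s => -((s * l⁻¹ - lapExp m (s * l⁻¹)) / G l))
      (d := fun l s => -((1 - lapTr m (s * l⁻¹)) / (l * G l))) hx ?_ ?_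
      (fun s hs => (h0 s hs).neg) hd
    · simpa using this.neg
    · filter_upwards [eventually_gt_atTop 0] with l hl a b ha hab
      have hi := inv_pos.2 hl
      have hg := hGpos l hl
      have := lapTr_mul_le hm (mul_pos ha hi).le (mul_le_mul_of_nonneg_right hab.le hi.le)
      have e : -((b * l⁻¹ - lapExp m (b * l⁻¹)) / G l) - -((a * l⁻¹ - lapExp m (a * l⁻¹)) / G l) -
          -((1 - lapTr m (b * l⁻¹)) / (l * G l)) * (b - a) = (lapExp m (b * l⁻¹) -
          lapExp m (a * l⁻¹) - lapTr m (b * l⁻¹) * (b * l⁻¹ - a * l⁻¹)) / G l := by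
        field_simp; ring
      rw [← sub_nonneg, e]
      exact div_nonneg (by linarith) hg.le
    · filter_upwards [eventually_gt_atTop 0] with l hl a b ha hab
      have hi := inv_pos.2 hl
      have hg := hGpos l hl
      have := le_lapTr_mul hm (mul_pos ha hi).le (mul_le_mul_of_nonneg_right hab.le hi.le)
      have e : -((1 - lapTr m (a * l⁻¹)) / (l * G l)) * (b - a) -
          (-((b * l⁻¹ - lapExp m (b * l⁻¹)) / G l) - -((a * l⁻¹ - lapExp m (a * l⁻¹)) / G l))
          = (lapTr m (a * l⁻¹) * (b * l⁻¹ - a * l⁻¹) - (lapExp m (b * l⁻¹) -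
          lapExp m (a * l⁻¹))) / G l := by
        field_simp; ring
      rw [← sub_nonneg, e]
      exact div_nonneg (by linarith) hg.le
  have h2 : ∀ x, 0 < x → Tendsto (fun l => lapMom m (x * l⁻¹) / (l ^ 2 * G l)) atTop
      (𝓝 (ρ * (1 + ρ) * x ^ (ρ - 1))) := by
    intro x hx
    have hd : HasDerivAt (fun s : ℝ => (1 + ρ) * s ^ ρ) (ρ * (1 + ρ) * x ^ (ρ - 1)) x :=
      ((Real.hasDerivAt_rpow_const (x := x) (p := ρ) (Or.inl hx.ne')).const_mul
        (1 + ρ)).congr_deriv (by ring)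
    refine tendsto_deriv_of_concave (l := atTop)
      (f := fun l s => (1 - lapTr m (s * l⁻¹)) / (l * G l))
      (d := fun l s => lapMom m (s * l⁻¹) / (l ^ 2 * G l)) hx ?_ ?_ h1 hd
    all_goals
      filter_upwards [eventually_gt_atTop 0] with l hl a b ha hab
      have hi := inv_pos.2 hl
      have hg := hGpos l hl
      have := lapMom_mul_le hm (mul_pos ha hi) (mul_lt_mul_of_pos_right hab hi)
      rw [← sub_nonneg]
    · have e : (1 - lapTr m (b * l⁻¹)) / (l * G l) - (1 - lapTr m (a * l⁻¹)) / (l * G l) -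
          lapMom m (b * l⁻¹) / (l ^ 2 * G l) * (b - a) = (lapTr m (a * l⁻¹) - lapTr m (b * l⁻¹) -
          lapMom m (b * l⁻¹) * (b * l⁻¹ - a * l⁻¹)) / (l * G l) := by
        field_simp; ring
      rw [e]
      exact div_nonneg (by linarith [this.1]) (by positivity)
    · have e : lapMom m (a * l⁻¹) / (l ^ 2 * G l) * (b - a) -
          ((1 - lapTr m (b * l⁻¹)) / (l * G l) - (1 - lapTr m (a * l⁻¹)) / (l * G l)) =
          (lapMom m (a * l⁻¹) * (b * l⁻¹ - a * l⁻¹) - (lapTr m (a * l⁻¹) - lapTr m (b * l⁻¹))) /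
          (l * G l) := by
        field_simp; ring
      rw [e]
      exact div_nonneg (by linarith [this.2]) (by positivity)
  obtain ⟨μ₀, K, hK, hμ₀, hlap, hdist⟩ := exists_power_measure hρ0 hρ1
  -- the normalized second-moment measures, with the unit of length kept positive
  set L : ℝ → ℝ := fun l => max l 1
  have hL : ∀ l, 0 < L l := fun l => lt_max_of_lt_right one_pos
  have hLev : ∀ᶠ l in atTop, L l = l := (eventually_ge_atTop 1).mono fun l hl => max_eq_left hl
  set N : ℝ → ℝ := fun l => l ^ 2 * G l with hN
  have hNpos : ∀ l, 0 < l → 0 < N l := fun l hl => mul_pos (by positivity) (hGpos l hl)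
  set μ : ℝ → Measure ℝ := fun l =>
    ENNReal.ofReal (N (L l))⁻¹ • rescale (massMeasure m) (L l) with hμ
  have hμint : ∀ l s, ∫ x, Real.exp (-(s * x)) ∂(μ l) = lapMom m (s * (L l)⁻¹) / N (L l) := by
    intro l s
    rw [hμ, integral_smul_measure, ENNReal.toReal_ofReal (inv_pos.2 (hNpos _ (hL l))).le,
      integral_rescale (by fun_prop), integral_massMeasure hm, lapMom, smul_eq_mul,
      div_eq_inv_mul]
    congr 1
    refine integral_congr_ae (ae_of_all _ fun x => ?_)
    simp only
    congr 2; ring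
  have hnull : ∀ l, μ l (Iio 0) = 0 := fun l => by
    have h := measure_mono_null Iio_subset_Iic_self (rescale_null (massMeasure_null hm) (hL l))
    simp only [hμ, Measure.smul_apply, h, smul_zero]
  have hi : ∀ l, Integrable (fun x => Real.exp (-x)) (μ l) := fun l => by
    refine Integrable.of_integral_ne_zero ?_
    have := hμint l 1
    simp only [one_mul] at this
    rw [this]
    exact (div_pos (lapMom_pos hm (inv_pos.2 (hL l))) (hNpos _ (hL l))).ne'
  have hi₀ : Integrable (fun x => Real.exp (-x)) μ₀ := by
    refine Integrable.of_integral_ne_zero ?_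
    have := hlap 1 one_pos
    simp only [one_mul, Real.one_rpow, mul_one] at this
    rw [this]
    positivity
  refine ⟨N, K, hK, (eventually_gt_atTop 0).mono hNpos, fun x hx => ?_⟩
  have hmain := tendsto_measureReal_Iic_of_laplace (l := atTop) hnull hμ₀ hi hi₀ (fun k => ?_) (hdist x hx).1
  · rw [(hdist x hx).2] at hmain
    refine hmain.congr' ?_
    filter_upwards [hLev, eventually_gt_atTop 0] with l hl hl0
    simp only [hμ, hl]
    rw [measureReal_ennreal_smul_apply, ENNReal.toReal_ofReal (inv_pos.2 (hNpos _ hl0)).le,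
      rescale_Iic hl0, massMeasure_real_Iic hm, div_eq_inv_mul]
  · have hk : (0 : ℝ) < k + 1 := by positivity
    simp_rw [neg_mul, hμint, hlap _ hk]
    refine (h2 _ hk).congr' ?_
    filter_upwards [hLev] with l hl
    rw [hl]

/-! ### From Laplace exponents to solutions -/

lemma truncSecondMoment_eq_truncMoment {ν : Measure ℝ} (h0 : ν (Iic 0) = 0) :
    truncSecondMoment ν = truncMoment (massMeasure ν) :=
  funext fun x => truncSecondMoment_eq h0 x

/-- A nontrivial scaling limit forces regular variation of the truncated second moment. -/
theorem IsSolution.exists_isEquivalent {ν : ℝ → Measure ℝ} (hν : IsSolution ν)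
    (h1 : totalMass (ν 0) = 1) {scale F : ℝ → ℝ} (hscale : Tendsto scale atTop atTop)
    (hF : IsNontrivialDistribution F)
    (hconv : ∀ x : ℝ, 0 < x → ContinuousAt F x →
      Tendsto (fun t => massDist (ν t) (scale t * x)) atTop (𝓝 (F x))) :
    ∃ (ρ : ℝ) (L : ℝ → ℝ), 0 < ρ ∧ ρ ≤ 1 ∧ SlowlyVarying L ∧
      truncSecondMoment (ν 0) ~[atTop] fun x => x ^ (1 - ρ) * L x := by
  have hflow := hν.isLapFlow h1
  have hprob := hflow.prob
  have hn := fun t => (hν.radon _ (le_max_right t 0)).null_nonpos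
  -- the scale is bounded below by `1` so as to be positive at all times
  obtain ⟨ρ, hρ0, hρ1, hreg⟩ := hflow.exists_index (scale := fun t => max (scale t) 1)
    (fun t => zero_lt_one.trans_le (le_max_right _ _)) hF (fun x hx hc => by
      refine (hconv x hx hc).congr' ?_
      filter_upwards [hscale.eventually_ge_atTop 1, eventually_ge_atTop 0] with t ht ht0
      rw [max_eq_left ht, rescale_Iic (by linarith), ← massDist_eq (hn t), max_eq_left ht0])
  simp only [max_self] at hreg
  have h00 := (hν.radon 0 le_rfl).null_nonpos
  rw [truncSecondMoment_eq_truncMoment h00]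
  have hp0 := isProbabilityMeasure_massMeasure h1
  have hm0 := massMeasure_null h00
  set V := truncMoment (massMeasure (ν 0)) with hVdef
  obtain ⟨N, K, hK, hN, hlim⟩ := exists_truncMoment_limit hm0 hρ0 hρ1 hreg
  have hlim1 : Tendsto (fun l => V l / N l) atTop (𝓝 K) := by
    simpa using hlim 1 one_pos
  have hVpos : ∀ᶠ x in atTop, 0 < V x := by
    filter_upwards [hN, hlim1.eventually_const_lt hK] with x h1 h2
    simpa [div_pos_iff, h1, h1.not_gt] using h2
  have hratio : ∀ c : ℝ, 0 < c → Tendsto (fun x => V (c * x) / V x) atTop (𝓝 (c ^ (1 - ρ))) := by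
    intro c hc
    have := (hlim c hc).div hlim1 hK.ne'
    rw [mul_div_cancel_left₀ _ hK.ne'] at this
    refine this.congr' ?_
    filter_upwards [hN] with x hx
    simp only [Pi.div_apply]
    rw [div_div_div_cancel_right₀ hx.ne', mul_comm c x]
  classical
  -- the slowly varying factor gets the value `1` where `V` may vanish
  refine ⟨ρ, fun x => if 0 < x ∧ 0 < V x then V x * x ^ (ρ - 1) else 1, hρ0, hρ1, ⟨?_, ?_⟩, ?_⟩
  · intro x hx
    simp only
    split_ifs with h
    · exact mul_pos h.2 (Real.rpow_pos_of_pos h.1 _)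
    · exact one_pos
  · intro t ht
    have := (hratio t ht).mul_const (t ^ (ρ - 1))
    rw [← Real.rpow_add ht, show 1 - ρ + (ρ - 1) = 0 by ring, Real.rpow_zero] at this
    refine this.congr' ?_
    have htx : Tendsto (fun x : ℝ => t * x) atTop atTop := tendsto_id.const_mul_atTop ht
    filter_upwards [hVpos, htx.eventually hVpos, eventually_gt_atTop 0] with x h1 h2 hx
    rw [if_pos ⟨mul_pos ht hx, h2⟩, if_pos ⟨hx, h1⟩, Real.mul_rpow ht.le hx.le]
    have := Real.rpow_pos_of_pos hx (ρ - 1)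
    field_simp
  · refine Filter.EventuallyEq.isEquivalent ?_
    filter_upwards [hVpos, eventually_gt_atTop 0] with x h1 hx
    rw [if_pos ⟨hx, h1⟩, mul_left_comm, ← Real.rpow_add hx,
      show 1 - ρ + (ρ - 1) = 0 by ring, Real.rpow_zero, mul_one]

/-- Regular variation of the truncated second moment implies convergence to the probability
measure whose Laplace exponent inverts `w ↦ w + w ^ (1 + ρ)`. -/
theorem IsSolution.exists_scale {ν : ℝ → Measure ℝ} (hν : IsSolution ν)
    (h1 : totalMass (ν 0) = 1) {ρ : ℝ} {L : ℝ → ℝ} (hρ0 : 0 < ρ) (hρ1 : ρ ≤ 1)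
    (hL : SlowlyVarying L) (hequiv : truncSecondMoment (ν 0) ~[atTop] fun x => x ^ (1 - ρ) * L x)
    {μ₀ : Measure ℝ} [IsProbabilityMeasure μ₀] (hμ₀ : μ₀ (Iic 0) = 0) (hatom : ∀ x, μ₀ {x} = 0)
    (hexp : ∀ w : ℝ, 0 < w → lapExp μ₀ (w + w ^ (1 + ρ)) = w) :
    ∃ scale : ℝ → ℝ, StrictMonoOn scale (Ici 0) ∧ (∀ t : ℝ, 0 < t → 0 < scale t) ∧
      Tendsto scale atTop atTop ∧ ∀ x : ℝ,
        Tendsto (fun t => massDist (ν t) (scale t * x)) atTop (𝓝 (μ₀.real (Iic x))) := by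
  have hflow := hν.isLapFlow h1
  have hn := fun t => (hν.radon _ (le_max_right t 0)).null_nonpos
  have h00 := (hν.radon 0 le_rfl).null_nonpos
  rw [truncSecondMoment_eq_truncMoment h00] at hequiv
  have hp0 := isProbabilityMeasure_massMeasure h1
  have hm0 := massMeasure_null h00
  set V := truncMoment (massMeasure (ν 0)) with hVdef
  set W : ℝ → ℝ := fun x => x ^ (1 - ρ) * L x with hW
  have hWpos : ∀ x, 0 < x → 0 < W x := fun x hx => mul_pos (Real.rpow_pos_of_pos hx _) (hL.1 x hx)
  have hVW : Tendsto (fun x => V x / W x) atTop (𝓝 1) :=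
    (Asymptotics.isEquivalent_iff_tendsto_one
      ((eventually_gt_atTop 0).mono fun x hx => (hWpos x hx).ne')).1 hequiv
  have hVpos : ∀ᶠ x in atTop, 0 < V x := by
    filter_upwards [eventually_gt_atTop 0, hVW.eventually_const_lt one_pos] with x h1 h2
    simpa [div_pos_iff, hWpos x h1, (hWpos x h1).not_gt] using h2
  have hratio : ∀ c : ℝ, 0 < c → Tendsto (fun x => V (c * x) / V x) atTop (𝓝 (c ^ (1 - ρ))) := by
    intro c hc
    have hcx : Tendsto (fun x : ℝ => c * x) atTop atTop := tendsto_id.const_mul_atTop hc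
    have := (((hVW.comp hcx).div hVW one_ne_zero).mul (hL.2 c hc)).mul_const (c ^ (1 - ρ))
    simp only [div_one, one_mul] at this
    refine this.congr' ?_
    filter_upwards [hVpos, eventually_gt_atTop 0] with x h1 hx
    have h2 := hL.1 x hx
    have h3 := hL.1 _ (mul_pos hc hx)
    have h4 := Real.rpow_pos_of_pos hx (1 - ρ)
    have h5 := Real.rpow_pos_of_pos hc (1 - ρ)
    simp only [Pi.div_apply, Function.comp_apply, hW]
    rw [Real.mul_rpow hc.le hx.le]
    field_simp
  obtain ⟨scale, hs1, hs2, hs3, hs4⟩ := hflow.exists_scale hρ0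
    (fun c hc => by
      simpa only [max_self] using tendsto_sub_lapExp_ratio hm0 hρ0 hρ1 hVpos hratio hc)
    hμ₀ hatom hexp
  refine ⟨scale, hs1, hs2, hs3, fun x => (hs4 x).congr' ?_⟩
  filter_upwards [eventually_ge_atTop 0] with t ht
  rw [← massDist_eq (hn t), max_eq_left ht]

/-! ### A complex Gamma integral -/

lemma integrable_rpow_mul_cexp {p q : ℝ} (hp : 0 < p) (hq : -1 < q) {r : ℂ} (hr : 0 < r.re) :
    IntegrableOn (fun x : ℝ => ((x ^ q : ℝ) : ℂ) * Complex.exp (-r * (x ^ p : ℝ))) (Ioi 0) := by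
  refine (integrableOn_rpow_mul_exp_neg_mul_rpow hq hp hr).mono'
    (by fun_prop) ?_
  filter_upwards [ae_restrict_mem measurableSet_Ioi] with x hx
  rw [norm_mul, Complex.norm_exp, Complex.norm_real, Real.norm_of_nonneg (Real.rpow_nonneg hx.le _)]
  simp

/-- The Gamma integral along a ray of complex frequencies, by analytic continuation from real
ones. -/
lemma integral_rpow_mul_cexp {p q : ℝ} (hp : 0 < p) (hq : -1 < q) {r : ℂ} (hr : 0 < r.re) :
    ∫ x in Ioi (0 : ℝ), ((x ^ q : ℝ) : ℂ) * Complex.exp (-r * (x ^ p : ℝ)) =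
      r ^ ((-(q + 1) / p : ℝ) : ℂ) * ((1 / p * Real.Gamma ((q + 1) / p) : ℝ) : ℂ) := by
  set μ : Measure ℝ := (volume.restrict (Ioi 0)).withDensity fun x => ENNReal.ofReal (x ^ q) with hμ
  set X : ℝ → ℝ := fun x => -x ^ p with hX
  have key : ∀ z : ℂ, ProbabilityTheory.complexMGF X μ z =
      ∫ x in Ioi (0 : ℝ), ((x ^ q : ℝ) : ℂ) * Complex.exp (-z * (x ^ p : ℝ)) := by
    intro z
    rw [ProbabilityTheory.complexMGF, hμ, integral_withDensity_eq_integral_toReal_smul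
      (by fun_prop) (ae_of_all _ fun x => ENNReal.ofReal_lt_top)]
    refine setIntegral_congr_fun measurableSet_Ioi fun x hx => ?_
    rw [ENNReal.toReal_ofReal (Real.rpow_nonneg hx.le _), Complex.real_smul, hX]
    push_cast
    ring_nf
  have hint : Ioi 0 ⊆ ProbabilityTheory.integrableExpSet X μ := by
    intro t ht
    simp only [ProbabilityTheory.integrableExpSet, mem_ofPred_eq, hμ]
    rw [integrable_withDensity_iff_integrable_smul' (by fun_prop)
      (ae_of_all _ fun x => ENNReal.ofReal_lt_top)]
    refine (integrableOn_rpow_mul_exp_neg_mul_rpow hq hp ht).congr ?_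
    filter_upwards [ae_restrict_mem measurableSet_Ioi] with x hx
    rw [ENNReal.toReal_ofReal (Real.rpow_nonneg hx.le _), smul_eq_mul, hX]
    ring_nf
  have hint' : Ioi 0 ⊆ interior (ProbabilityTheory.integrableExpSet X μ) :=
    interior_maximal hint isOpen_Ioi
  set U : Set ℂ := {z | 0 < z.re} with hU
  have hUo : IsOpen U := isOpen_lt continuous_const Complex.continuous_re
  have hslit : ∀ z ∈ U, z ∈ Complex.slitPlane := fun z hz => Or.inl hz
  have hf : AnalyticOnNhd ℂ (ProbabilityTheory.complexMGF X μ) U :=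
    ProbabilityTheory.analyticOnNhd_complexMGF.mono fun z hz => hint' hz
  have hg : AnalyticOnNhd ℂ (fun z : ℂ => z ^ ((-(q + 1) / p : ℝ) : ℂ) *
      ((1 / p * Real.Gamma ((q + 1) / p) : ℝ) : ℂ)) U := by
    refine DifferentiableOn.analyticOnNhd (fun z hz => ?_) hUo
    exact (((differentiableAt_id.cpow (differentiableAt_const _)
      (hslit z hz))).mul_const _).differentiableWithinAt
  have hconn : IsPreconnected U := (convex_halfSpace_re_gt 0).isPreconnected
  have hfreq : ∃ᶠ z in 𝓝[≠] (1 : ℂ), ProbabilityTheory.complexMGF X μ z =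
      z ^ ((-(q + 1) / p : ℝ) : ℂ) * ((1 / p * Real.Gamma ((q + 1) / p) : ℝ) : ℂ) := by
    have ht : Tendsto (fun x : ℝ => (x : ℂ)) (𝓝[>] 1) (𝓝[≠] (1 : ℂ)) := by
      refine tendsto_nhdsWithin_iff.2 ⟨?_, ?_⟩
      · have : Tendsto (fun x : ℝ => (x : ℂ)) (𝓝 1) (𝓝 (1 : ℝ)) := Complex.continuous_ofReal.tendsto _
        exact (by simpa using this : Tendsto (fun x : ℝ => (x : ℂ)) (𝓝 1) (𝓝 1)).mono_left
          nhdsWithin_le_nhds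
      · filter_upwards [self_mem_nhdsWithin] with x hx
        simpa using (ne_of_gt hx)
    refine ht.frequently (Eventually.frequently ?_)
    filter_upwards [self_mem_nhdsWithin] with x hx
    have hx0 : (0 : ℝ) < x := one_pos.trans hx
    rw [key, ← Complex.ofReal_cpow hx0.le, ← Complex.ofReal_mul, ← mul_assoc,
      ← integral_rpow_mul_exp_neg_mul_rpow hp hq hx0, ← integral_complex_ofReal]
    push_cast
    rfl
  rw [← key]
  exact hf.eqOn_of_preconnected_of_frequently_eq hg hconn (z₀ := 1) (by simp [hU]) hfreq hr

/-- Logarithmic convexity of the Gamma function between `1` and `k + 1`. -/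
lemma Gamma_le_factorial_rpow {θ : ℝ} (h0 : 0 < θ) (h1 : θ < 1) (k : ℕ) :
    Real.Gamma (1 + k * θ) ≤ (k ! : ℝ) ^ θ := by
  have := Real.Gamma_mul_add_mul_le_rpow_Gamma_mul_rpow_Gamma (s := 1) (t := k + 1) one_pos
    (by positivity) (sub_pos.2 h1) h0 (by ring)
  rw [Real.Gamma_one, Real.one_rpow, one_mul, Real.Gamma_nat_eq_factorial] at this
  convert this using 2
  ring

/-- The series with coefficients `Γ(1 + kθ) / k!`, `θ < 1`, has infinite radius of convergence. -/
lemma summable_Gamma_div_factorial {θ : ℝ} (h0 : 0 < θ) (h1 : θ < 1) {y : ℝ} (hy : 0 ≤ y) :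
    Summable fun k : ℕ => Real.Gamma (1 + k * θ) / (k ! : ℝ) * y ^ k := by
  set δ := 1 - θ with hδ
  have hδ0 : 0 < δ := sub_pos.2 h1
  set z := 2 * y ^ δ⁻¹ with hz
  have hz0 : 0 ≤ z := by positivity
  have hzy : ∀ k : ℕ, y ^ k = (z ^ k) ^ δ * ((1 / 2 : ℝ) ^ δ) ^ k := by
    intro k
    have h2 : z ^ k = 2 ^ k * (y ^ k) ^ δ⁻¹ := by
      rw [hz, mul_pow, ← Real.rpow_natCast (y ^ δ⁻¹), ← Real.rpow_natCast y, ← Real.rpow_mul hy,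
        ← Real.rpow_mul hy, mul_comm δ⁻¹]
    rw [h2, Real.mul_rpow (by positivity) (by positivity), ← Real.rpow_mul (by positivity),
      inv_mul_cancel₀ hδ0.ne', Real.rpow_one, ← Real.rpow_natCast ((1 / 2 : ℝ) ^ δ),
      ← Real.rpow_mul (by norm_num), mul_comm δ, Real.rpow_mul (by norm_num), Real.rpow_natCast,
      mul_right_comm, ← Real.mul_rpow (by positivity) (by positivity), ← mul_pow]
    norm_num
  refine Summable.of_nonneg_of_le (fun k => ?_) (fun k => ?_)
    ((summable_geometric_of_lt_one (r := (1 / 2 : ℝ) ^ δ) (by positivity)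
      (Real.rpow_lt_one (by norm_num) (by norm_num) hδ0)).mul_left (Real.exp z ^ δ))
  · have := Real.Gamma_pos_of_pos (show 0 < 1 + (k : ℝ) * θ by positivity)
    positivity
  · have hk : (0 : ℝ) < k ! := by positivity
    have h3 : z ^ k / k ! ≤ Real.exp z := Real.pow_div_factorial_le_exp _ hz0 k
    calc Real.Gamma (1 + k * θ) / (k ! : ℝ) * y ^ k
        ≤ (k ! : ℝ) ^ θ / (k ! : ℝ) * y ^ k := by
          gcongr; exact Gamma_le_factorial_rpow h0 h1 k
      _ = (z ^ k / k !) ^ δ * ((1 / 2 : ℝ) ^ δ) ^ k := by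
          rw [hzy, ← mul_assoc]
          congr 1
          rw [Real.div_rpow (by positivity) hk.le, hδ, Real.rpow_sub hk, Real.rpow_one]
          field_simp
      _ ≤ _ := by gcongr

/-! ### The maximally skewed stable density -/

/-- A Hermitian function is integrable as soon as it is so on the half-line, and twice the
half-line integral has the same real part as the full integral. -/
lemma integrable_and_re_integral_of_hermitian {f : ℝ → ℂ}
    (hconj : ∀ x, f (-x) = (starRingEnd ℂ) (f x)) (hf : IntegrableOn f (Ioi 0)) :
    Integrable f ∧ (∫ x, f x).re = 2 * (∫ x in Ioi 0, f x).re := by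
  have h1 : IntegrableOn f (Iic 0) := by
    rw [integrableOn_Iic_iff_integrableOn_Iio, ← integrable_indicator_iff measurableSet_Iio]
    have h := ((integrable_indicator_iff measurableSet_Ioi).2 hf).comp_neg
    have h2 := Complex.conjCLE.toContinuousLinearMap.integrable_comp h
    refine h2.congr (ae_of_all _ fun x => ?_)
    by_cases hx : x < 0
    · simp [hx, hconj]
    · simp [hx]
  refine ⟨integrableOn_univ.1 (by simpa using h1.union hf), ?_⟩
  rw [← intervalIntegral.integral_Iic_add_Ioi h1 hf]
  have h3 := integral_comp_neg_Ioi 0 f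
  rw [neg_zero] at h3
  rw [← h3]
  simp_rw [hconj]
  rw [integral_conj, Complex.add_re, Complex.conj_re]
  ring

/-- The unimodular rate `e ^ (i π (1 - ρ) / 2)` in the characteristic function
`exp (-(stableRate ρ) ζ ^ (1 + ρ))`, `ζ > 0`, of the maximally skewed stable law. -/
noncomputable def stableRate (ρ : ℝ) : ℂ :=
  Complex.exp (((Real.pi * (1 - ρ) / 2 : ℝ) : ℂ) * Complex.I)

lemma stableRate_re (ρ : ℝ) : (stableRate ρ).re = Real.cos (Real.pi * (1 - ρ) / 2) := by
  rw [stableRate, Complex.exp_ofReal_mul_I_re]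

lemma stableRate_re_pos {ρ : ℝ} (h0 : 0 < ρ) (h1 : ρ ≤ 1) : 0 < (stableRate ρ).re := by
  rw [stableRate_re]
  apply Real.cos_pos_of_mem_Ioo
  constructor <;> nlinarith [Real.pi_pos]

lemma stableRate_cpow {ρ : ℝ} (h0 : 0 < ρ) (h1 : ρ ≤ 1) (a : ℝ) :
    stableRate ρ ^ (a : ℂ) = Complex.exp (((a * (Real.pi * (1 - ρ) / 2) : ℝ) : ℂ) * Complex.I) := by
  rw [stableRate, Complex.cpow_def_of_ne_zero (Complex.exp_ne_zero _), Complex.log_exp]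
  · congr 1; push_cast; ring
  · simp only [Complex.mul_im, Complex.ofReal_re, Complex.I_im, Complex.ofReal_im, Complex.I_re]
    nlinarith [Real.pi_pos]
  · simp only [Complex.mul_im, Complex.ofReal_re, Complex.I_im, Complex.ofReal_im, Complex.I_re]
    nlinarith [Real.pi_pos]

lemma integrableOn_stable {ρ : ℝ} (h0 : 0 < ρ) (h1 : ρ ≤ 1) (y : ℝ) :
    IntegrableOn (fun ζ : ℝ => Complex.exp (-((ζ * y : ℝ) : ℂ) * Complex.I) *
      Complex.exp (-stableRate ρ * (ζ ^ (1 + ρ) : ℝ))) (Ioi 0) := by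
  have := integrable_rpow_mul_cexp (p := 1 + ρ) (q := 0) (by linarith) (by norm_num)
    (stableRate_re_pos h0 h1)
  simp only [Real.rpow_zero, Complex.ofReal_one, one_mul] at this
  refine this.bdd_mul (c := 1) (by fun_prop) (ae_of_all _ fun ζ => ?_)
  simp [Complex.norm_exp]

/-- The stable density as an integral over the half-line, by Hermitian symmetry. -/
lemma stableDensity_eq_half {ρ : ℝ} (h0 : 0 < ρ) (h1 : ρ ≤ 1) (y : ℝ) :
    stableDensity (1 + ρ) (1 - ρ) y = 1 / Real.pi *
      (∫ ζ in Ioi (0 : ℝ), Complex.exp (-((ζ * y : ℝ) : ℂ) * Complex.I) *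
        Complex.exp (-stableRate ρ * (ζ ^ (1 + ρ) : ℝ))).re := by
  have hpos : ∀ ζ ∈ Ioi (0 : ℝ), Complex.exp (-((ζ * y : ℝ) : ℂ) * Complex.I) *
      Complex.exp (-stableRate ρ * (ζ ^ (1 + ρ) : ℝ)) =
      Complex.exp (-((ζ * y : ℝ) : ℂ) * Complex.I) * stableCharFun (1 + ρ) (1 - ρ) ζ := by
    intro ζ hζ
    rw [stableCharFun, abs_of_pos hζ, sign_pos hζ, stableRate]
    simp only [SignType.coe_one, one_mul]
    congr 2
    ring
  have hf := (integrableOn_stable h0 h1 y).congr_fun hpos measurableSet_Ioi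
  rw [setIntegral_congr_fun measurableSet_Ioi hpos, stableDensity,
    (integrable_and_re_integral_of_hermitian (fun ζ => ?_) hf).2]
  · rw [← mul_assoc]
    congr 1
    field_simp
  · simp only [stableCharFun, map_mul, ← Complex.exp_conj, map_neg, Complex.conj_ofReal,
      Complex.conj_I, abs_neg, Left.sign_neg]
    simp

/-- Termwise integration of the power series of `e^{-iζy}`. -/
lemma hasSum_stable {ρ : ℝ} (h0 : 0 < ρ) (h1 : ρ ≤ 1) (y : ℝ) :
    HasSum (fun k : ℕ => (-((y : ℂ) * Complex.I)) ^ k / (k ! : ℂ) *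
      (stableRate ρ ^ ((-((k : ℝ) + 1) / (1 + ρ) : ℝ) : ℂ) *
        ((1 / (1 + ρ) * Real.Gamma (((k : ℝ) + 1) / (1 + ρ)) : ℝ) : ℂ)))
      (∫ ζ in Ioi (0 : ℝ), Complex.exp (-((ζ * y : ℝ) : ℂ) * Complex.I) *
        Complex.exp (-stableRate ρ * (ζ ^ (1 + ρ) : ℝ))) := by
  have hα : 0 < 1 + ρ := by linarith
  have hr := stableRate_re_pos h0 h1
  set r := stableRate ρ
  set c := r.re
  set F : ℕ → ℝ → ℂ := fun k ζ => (-((y : ℂ) * Complex.I)) ^ k / (k ! : ℂ) *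
    (((ζ ^ (k : ℝ) : ℝ) : ℂ) * Complex.exp (-r * (ζ ^ (1 + ρ) : ℝ))) with hF
  have hk : ∀ k : ℕ, (-1 : ℝ) < k := fun k => by linarith [k.cast_nonneg (α := ℝ)]
  have hint : ∀ k, IntegrableOn (F k) (Ioi 0) := fun k =>
    (integrable_rpow_mul_cexp hα (hk k) hr).const_mul _
  have hnorm : ∀ k, ∫ ζ in Ioi (0 : ℝ), ‖F k ζ‖ = |y| ^ k / (k ! : ℝ) *
      (c ^ (-((k : ℝ) + 1) / (1 + ρ)) * (1 / (1 + ρ)) * Real.Gamma (((k : ℝ) + 1) / (1 + ρ))) := by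
    intro k
    rw [← integral_rpow_mul_exp_neg_mul_rpow hα (hk k) hr, ← integral_const_mul]
    refine setIntegral_congr_fun measurableSet_Ioi fun ζ hζ => ?_
    simp only [hF]
    rw [norm_mul, norm_mul, Complex.norm_exp, Complex.norm_real,
      Real.norm_of_nonneg (Real.rpow_nonneg hζ.le _)]
    simp [c]
  have hsum : Summable fun k => ∫ ζ in Ioi (0 : ℝ), ‖F k ζ‖ := by
    simp_rw [hnorm]
    set θ := 1 / (1 + ρ)
    have hθ0 : 0 < θ := by positivity
    have hθ1 : θ < 1 := by rw [div_lt_one hα]; linarith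
    -- the extra summand of the base absorbs the shift from `k` to `k + 1`
    have hS := (summable_nat_add_iff 1).2 (summable_Gamma_div_factorial hθ0 hθ1
      (y := |y| * c ^ (-θ) + c ^ (-θ)) (by positivity))
    refine Summable.of_nonneg_of_le (fun k => ?_) (fun k => ?_) hS
    · have := Real.Gamma_pos_of_pos (show 0 < ((k : ℝ) + 1) / (1 + ρ) by positivity)
      positivity
    · have hz : ((k : ℝ) + 1) / (1 + ρ) = ((k : ℝ) + 1) * θ := by rw [mul_one_div]
      have hg : Real.Gamma (1 + ((k + 1 : ℕ) : ℝ) * θ) =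
          ((k : ℝ) + 1) * θ * Real.Gamma (((k : ℝ) + 1) * θ) := by
        rw [← Real.Gamma_add_one (by positivity)]; push_cast; congr 1; ring
      have hc : c ^ (-((k : ℝ) + 1) / (1 + ρ)) = (c ^ (-θ)) ^ (k + 1) := by
        rw [← Real.rpow_natCast, ← Real.rpow_mul hr.le]
        congr 1; push_cast; rw [← neg_div', hz]; ring
      have hG := Real.Gamma_pos_of_pos (show 0 < ((k : ℝ) + 1) * θ by positivity)
      rw [hg, hc, hz, Nat.factorial_succ]
      push_cast
      have h1 : |y| ^ k * (c ^ (-θ)) ^ (k + 1) ≤ (|y| * c ^ (-θ) + c ^ (-θ)) ^ (k + 1) := by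
        rw [← add_one_mul, mul_pow]
        gcongr
        calc |y| ^ k ≤ (|y| + 1) ^ k := by gcongr; linarith
          _ ≤ (|y| + 1) ^ (k + 1) := pow_le_pow_right₀ (by linarith [abs_nonneg y]) (by omega)
      calc _ = θ * Real.Gamma (((k : ℝ) + 1) * θ) / (k ! : ℝ) *
            (|y| ^ k * (c ^ (-θ)) ^ (k + 1)) := by ring
        _ ≤ θ * Real.Gamma (((k : ℝ) + 1) * θ) / (k ! : ℝ) *
            (|y| * c ^ (-θ) + c ^ (-θ)) ^ (k + 1) := by gcongr
        _ = _ := by field_simp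
  have := hasSum_integral_of_summable_integral_norm hint hsum
  have hval : ∀ k, ∫ ζ in Ioi (0 : ℝ), F k ζ = (-((y : ℂ) * Complex.I)) ^ k / (k ! : ℂ) *
      (r ^ ((-((k : ℝ) + 1) / (1 + ρ) : ℝ) : ℂ) *
        ((1 / (1 + ρ) * Real.Gamma (((k : ℝ) + 1) / (1 + ρ)) : ℝ) : ℂ)) := fun k => by
    rw [← integral_rpow_mul_cexp hα (hk k) hr, ← integral_const_mul]
  have hlim : ∫ ζ in Ioi (0 : ℝ), ∑' k, F k ζ =
      ∫ ζ in Ioi (0 : ℝ), Complex.exp (-((ζ * y : ℝ) : ℂ) * Complex.I) *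
        Complex.exp (-r * (ζ ^ (1 + ρ) : ℝ)) := by
    refine setIntegral_congr_fun measurableSet_Ioi fun ζ _ => ?_
    simp only [hF]
    rw [Complex.exp_eq_exp_ℂ, NormedSpace.exp_eq_tsum_div, ← tsum_mul_right]
    refine tsum_congr fun k => ?_
    rw [Real.rpow_natCast]
    push_cast
    rw [show -((ζ : ℂ) * y) * Complex.I = -((y : ℂ) * Complex.I) * ζ by ring, mul_pow]
    ring
  simpa only [hval, hlim] using this

/-- The coefficient of `y ^ k` in the power series of `π` times the stable density. -/
noncomputable def stableCoeff (ρ : ℝ) (k : ℕ) : ℝ :=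
  (-1) ^ k / ((k + 1) ! : ℝ) * Real.Gamma (1 + (k + 1) - (k + 1) * beta ρ) *
    Real.sin (Real.pi * (k + 1) * beta ρ)

lemma one_sub_beta {ρ : ℝ} (h0 : 0 < ρ) : 1 - beta ρ = 1 / (1 + ρ) := by
  rw [beta]; field_simp; ring

/-- The power series of the stable density, valid on the whole line. -/
lemma hasSum_stableDensity {ρ : ℝ} (h0 : 0 < ρ) (h1 : ρ ≤ 1) (y : ℝ) :
    HasSum (fun k : ℕ => 1 / Real.pi * (stableCoeff ρ k * y ^ k))
      (stableDensity (1 + ρ) (1 - ρ) y) := by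
  rw [stableDensity_eq_half h0 h1]
  have h := (Complex.hasSum_re (hasSum_stable h0 h1 y)).mul_left (1 / Real.pi)
  have hα : 0 < 1 + ρ := by linarith
  have key : ∀ k : ℕ, 1 / Real.pi * (stableCoeff ρ k * y ^ k) = 1 / Real.pi *
      ((-((y : ℂ) * Complex.I)) ^ k / (k ! : ℂ) *
      (stableRate ρ ^ ((-((k : ℝ) + 1) / (1 + ρ) : ℝ) : ℂ) *
        ((1 / (1 + ρ) * Real.Gamma (((k : ℝ) + 1) / (1 + ρ)) : ℝ) : ℂ))).re := by
    intro k
    have hI : (-((y : ℂ) * Complex.I)) ^ k =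
        ((y ^ k : ℝ) : ℂ) * Complex.exp ((-(k * (Real.pi / 2)) : ℝ) * Complex.I) := by
      have : -Complex.I = Complex.exp ((-(Real.pi / 2) : ℝ) * Complex.I) := by
        rw [Complex.ofReal_neg, neg_mul, Complex.exp_neg]
        push_cast
        rw [Complex.exp_pi_div_two_mul_I, Complex.inv_I]
      rw [← mul_neg, mul_pow, this, ← Complex.exp_nat_mul]
      push_cast
      congr 2
      ring
    rw [hI, stableRate_cpow h0 h1, show ∀ a b c d e : ℂ, a * b / c * (d * e) =
      a * e / c * (b * d) by intros; ring, ← Complex.exp_add, ← add_mul, ← Complex.ofReal_add,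
      ← Complex.ofReal_mul, ← Complex.ofReal_natCast, ← Complex.ofReal_div, Complex.re_ofReal_mul,
      Complex.exp_ofReal_mul_I_re]
    have hang : -(k * (Real.pi / 2)) + -((k : ℝ) + 1) / (1 + ρ) * (Real.pi * (1 - ρ) / 2) =
        Real.pi * (k + 1) * beta ρ - Real.pi / 2 - k * Real.pi := by
      rw [beta]; field_simp; ring
    have hg : Real.Gamma (1 + ((k : ℝ) + 1) - (k + 1) * beta ρ) =
        (k + 1) * (1 / (1 + ρ) * Real.Gamma (((k : ℝ) + 1) / (1 + ρ))) := by
      rw [← mul_assoc, mul_one_div, ← Real.Gamma_add_one (by positivity)]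
      congr 1
      have := one_sub_beta h0
      rw [div_eq_mul_one_div, ← this]; ring
    rw [hang, Real.cos_sub_nat_mul_pi, Real.cos_sub_pi_div_two, stableCoeff, hg,
      Nat.factorial_succ]
    push_cast
    field_simp
  simpa only [key] using h

/-! ### The number density of the self-similar profile -/

lemma beta_pos {ρ : ℝ} (h0 : 0 < ρ) : 0 < beta ρ := by rw [beta]; positivity

lemma numberTerm_succ (ρ : ℝ) {x : ℝ} (hx : 0 < x) (k : ℕ) :
    numberTerm ρ x (k + 1) = x ^ (beta ρ - 2) * (stableCoeff ρ k * (x ^ beta ρ) ^ k) := by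
  have : x ^ (((k : ℝ) + 1) * beta ρ - 2) = x ^ (beta ρ - 2) * (x ^ beta ρ) ^ k := by
    rw [← Real.rpow_natCast, ← Real.rpow_mul hx.le, ← Real.rpow_add hx]
    congr 1; ring
  rw [numberTerm, stableCoeff]
  push_cast
  rw [this]
  ring

lemma summable_stableCoeff {ρ : ℝ} (h0 : 0 < ρ) (h1 : ρ ≤ 1) (y : ℝ) :
    Summable fun k : ℕ => stableCoeff ρ k * y ^ k := by
  have := (hasSum_stableDensity h0 h1 y).summable
  rwa [summable_mul_left_iff (by positivity)] at this

lemma summable_numberTerm {ρ : ℝ} (h0 : 0 < ρ) (h1 : ρ ≤ 1) {x : ℝ} (hx : 0 < x) :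
    Summable fun k : ℕ => numberTerm ρ x (k + 1) := by
  simp_rw [numberTerm_succ ρ hx]
  exact (summable_stableCoeff h0 h1 _).mul_left _

lemma numberProfile_eq {ρ : ℝ} (h0 : 0 < ρ) (h1 : ρ ≤ 1) {x : ℝ} (hx : 0 < x) :
    numberProfile ρ x =
      x ^ (beta ρ - 2) * stableDensity (1 + ρ) (1 - ρ) (x ^ beta ρ) := by
  rw [numberProfile, ← (hasSum_stableDensity h0 h1 (x ^ beta ρ)).tsum_eq, tsum_mul_left]
  simp_rw [numberTerm_succ ρ hx]
  rw [tsum_mul_left]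
  ring

/-- The series for the mass density is the power series of the stable density at `x ^ β`. -/
lemma mul_numberProfile_eq {ρ : ℝ} (h0 : 0 < ρ) (h1 : ρ ≤ 1) {x : ℝ} (hx : 0 < x) :
    x * numberProfile ρ x =
      x ^ (beta ρ - 1) * stableDensity (1 + ρ) (1 - ρ) (x ^ beta ρ) := by
  rw [numberProfile_eq h0 h1 hx, ← mul_assoc]
  congr 1
  nth_rewrite 1 [← Real.rpow_one x]
  rw [← Real.rpow_add hx]
  congr 1; ring

lemma continuous_stableDensity {ρ : ℝ} (h0 : 0 < ρ) (h1 : ρ ≤ 1) :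
    Continuous (stableDensity (1 + ρ) (1 - ρ)) := by
  have : stableDensity (1 + ρ) (1 - ρ) = fun y => 1 / Real.pi *
      (∫ ζ in Ioi (0 : ℝ), Complex.exp (-((ζ * y : ℝ) : ℂ) * Complex.I) *
        Complex.exp (-stableRate ρ * (ζ ^ (1 + ρ) : ℝ))).re :=
    funext fun y => stableDensity_eq_half h0 h1 y
  rw [this]
  refine continuous_const.mul (Complex.continuous_re.comp ?_)
  refine continuous_of_dominated (bound := fun ζ : ℝ =>
    ‖Complex.exp (-((ζ * 0 : ℝ) : ℂ) * Complex.I) *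
        Complex.exp (-stableRate ρ * (ζ ^ (1 + ρ) : ℝ))‖)
    (fun y => (integrableOn_stable h0 h1 y).aestronglyMeasurable)
    (fun y => ae_of_all _ fun ζ => ?_) (integrableOn_stable h0 h1 0).norm
    (ae_of_all _ fun ζ => by fun_prop)
  simp [Complex.norm_exp]

lemma continuousOn_numberProfile {ρ : ℝ} (h0 : 0 < ρ) (h1 : ρ ≤ 1) :
    ContinuousOn (numberProfile ρ) (Ioi 0) := by
  have : ContinuousOn (fun x : ℝ =>
      x ^ (beta ρ - 2) * stableDensity (1 + ρ) (1 - ρ) (x ^ beta ρ)) (Ioi 0) := by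
    refine ContinuousOn.mul (fun x hx => ?_) ?_
    · exact (Real.continuousAt_rpow_const _ _ (Or.inl (ne_of_gt hx))).continuousWithinAt
    · exact ((continuous_stableDensity h0 h1).comp
        (Real.continuous_rpow_const (beta_pos h0).le)).continuousOn
  exact this.congr fun x hx => numberProfile_eq h0 h1 hx

/-- The mass density as an inverse Laplace integral over the imaginary axis, by the substitution
`ζ = x ^ (1 - β) v` in the stable density. -/
lemma mul_numberProfile_eq_integral {ρ : ℝ} (h0 : 0 < ρ) (h1 : ρ ≤ 1) {x : ℝ} (hx : 0 < x) :
    x * numberProfile ρ x = 1 / Real.pi * (∫ v in Ioi (0 : ℝ),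
      Complex.exp (-((v : ℂ) * Complex.I + stableRate ρ * (v ^ (1 + ρ) : ℝ)) * x)).re := by
  rw [mul_numberProfile_eq h0 h1 hx, stableDensity_eq_half h0 h1]
  have ha : 0 < x ^ (1 - beta ρ) := Real.rpow_pos_of_pos hx _
  set g : ℝ → ℂ := fun ζ => Complex.exp (-((ζ * x ^ beta ρ : ℝ) : ℂ) * Complex.I) *
        Complex.exp (-stableRate ρ * (ζ ^ (1 + ρ) : ℝ)) with hg
  have h := integral_comp_mul_left_Ioi g 0 ha
  rw [mul_zero] at h
  have hcongr : ∫ v in Ioi (0 : ℝ), g (x ^ (1 - beta ρ) * v) = ∫ v in Ioi (0 : ℝ),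
      Complex.exp (-((v : ℂ) * Complex.I + stableRate ρ * (v ^ (1 + ρ) : ℝ)) * x) := by
    refine setIntegral_congr_fun measurableSet_Ioi fun v hv => ?_
    have e1 : x ^ (1 - beta ρ) * v * x ^ beta ρ = v * x := by
      rw [mul_right_comm, ← Real.rpow_add hx]; simp [mul_comm]
    have e2 : (x ^ (1 - beta ρ) * v) ^ (1 + ρ) = x * v ^ (1 + ρ) := by
      rw [Real.mul_rpow ha.le (mem_Ioi.1 hv).le, ← Real.rpow_mul hx.le, one_sub_beta h0,
        one_div_mul_cancel (by linarith), Real.rpow_one]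
    simp only [hg]
    rw [e1, e2, ← Complex.exp_add]
    push_cast
    congr 1
    ring
  rw [← hcongr, h, Complex.smul_re, smul_eq_mul]
  have : x ^ (beta ρ - 1) = (x ^ (1 - beta ρ))⁻¹ := by
    rw [← Real.rpow_neg hx.le, neg_sub]
  rw [this]
  ring

lemma integrableOn_inv_add_rpow {α s c : ℝ} (hα : 1 < α) (hs : 0 < s) (hc : 0 < c) :
    IntegrableOn (fun v : ℝ => (s + c * v ^ α)⁻¹) (Ioi 0) := by
  have hpos : ∀ v : ℝ, 0 ≤ v → 0 < s + c * v ^ α := fun v hv => by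
    have := Real.rpow_nonneg hv α
    positivity
  have hm : Measurable fun v : ℝ => (s + c * v ^ α)⁻¹ := by fun_prop
  rw [← Ioc_union_Ioi_eq_Ioi zero_le_one]
  refine IntegrableOn.union ?_ ?_
  · refine Measure.integrableOn_of_bounded (M := s⁻¹) (by simp) hm.aestronglyMeasurable ?_
    filter_upwards [ae_restrict_mem measurableSet_Ioc] with v hv
    rw [Real.norm_of_nonneg (inv_nonneg.2 (hpos v hv.1.le).le)]
    have := Real.rpow_nonneg hv.1.le α
    gcongr
    nlinarith
  · refine ((integrableOn_Ioi_rpow_of_lt (a := -α) (by linarith) one_pos).const_mul c⁻¹).mono'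
      hm.aestronglyMeasurable ?_
    filter_upwards [ae_restrict_mem measurableSet_Ioi] with v hv
    have hv0 : (0 : ℝ) < v := one_pos.trans hv
    rw [Real.norm_of_nonneg (inv_nonneg.2 (hpos v hv0.le).le), Real.rpow_neg hv0.le, ← mul_inv]
    have := Real.rpow_pos_of_pos hv0 α
    gcongr
    linarith

/-- The Laplace transform of the mass density as an integral over the imaginary axis. -/
lemma laplace_mul_numberProfile {ρ : ℝ} (h0 : 0 < ρ) (h1 : ρ ≤ 1) {s : ℝ} (hs : 0 < s) :
    IntegrableOn (fun x => Real.exp (-(s * x)) * (x * numberProfile ρ x)) (Ioi 0) ∧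
    ∫ x in Ioi 0, Real.exp (-(s * x)) * (x * numberProfile ρ x) = 1 / Real.pi *
      (∫ v in Ioi (0 : ℝ), ((s : ℂ) + v * Complex.I + stableRate ρ * (v ^ (1 + ρ) : ℝ))⁻¹).re := by
  have hr := stableRate_re_pos h0 h1
  set r := stableRate ρ
  set μ : Measure ℝ := volume.restrict (Ioi 0) with hμ
  set D : ℝ → ℂ := fun v => (s : ℂ) + v * Complex.I + r * (v ^ (1 + ρ) : ℝ) with hD
  have hDre : ∀ v, (D v).re = s + r.re * v ^ (1 + ρ) := fun v => by simp [hD]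
  have hDpos : ∀ v, 0 < v → 0 < (D v).re := fun v hv => by
    rw [hDre]; have := Real.rpow_nonneg hv.le (1 + ρ); positivity
  set E : ℝ × ℝ → ℂ := fun p => Complex.exp (-D p.2 * p.1) with hE
  have hEn : ∀ p, ‖E p‖ = Real.exp (-(D p.2).re * p.1) := fun p => by
    simp [hE, Complex.norm_exp]
  have hEm : Measurable E := by simp only [hE, hD]; fun_prop
  have hint : Integrable E (μ.prod μ) := by
    rw [integrable_prod_iff' hEm.aestronglyMeasurable]
    constructor
    · filter_upwards [ae_restrict_mem measurableSet_Ioi] with v hv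
      exact integrableOn_exp_mul_complex_Ioi (a := -D v) (by simpa using hDpos v hv) 0
    · refine (integrableOn_inv_add_rpow (by linarith : 1 < 1 + ρ) hs hr).congr ?_
      filter_upwards [ae_restrict_mem measurableSet_Ioi] with v hv
      simp only [hEn]
      rw [hμ, integral_exp_mul_Ioi (by simpa using hDpos v hv), mul_zero, Real.exp_zero, hDre]
      rw [neg_div_neg_eq, one_div]
  have hinner : ∀ x ∈ Ioi (0 : ℝ), Real.exp (-(s * x)) * (x * numberProfile ρ x) =
      1 / Real.pi * (∫ v, E (x, v) ∂μ).re := by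
    intro x hx
    rw [mul_numberProfile_eq_integral h0 h1 hx, mul_left_comm, ← Complex.re_ofReal_mul,
      ← integral_const_mul]
    congr 2
    refine integral_congr_ae (ae_of_all _ fun v => ?_)
    simp only [hE, hD]
    rw [Complex.ofReal_exp, ← Complex.exp_add]
    push_cast
    congr 1
    ring
  have hI : Integrable (fun x => 1 / Real.pi * (∫ v, E (x, v) ∂μ).re) μ :=
    hint.integral_prod_left.re.const_mul _
  refine ⟨IntegrableOn.congr_fun hI (fun x hx => (hinner x hx).symm) measurableSet_Ioi, ?_⟩
  rw [setIntegral_congr_fun measurableSet_Ioi hinner, integral_const_mul]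
  congr 1
  have hre := integral_re (𝕜 := ℂ) hint.integral_prod_left
  simp only [RCLike.re_eq_complex_re] at hre
  rw [hre, integral_integral_swap (f := fun x v => E (x, v)) hint]
  congr 1
  refine setIntegral_congr_fun measurableSet_Ioi fun v hv => ?_
  simp only [hE]
  rw [integral_exp_mul_complex_Ioi (by simpa using hDpos v hv), Complex.ofReal_zero, mul_zero,
    Complex.exp_zero, neg_div_neg_eq, one_div]

/-! ### Residues on the imaginary axis -/

lemma integral_inv_sq_add_sq {a : ℝ} (ha : 0 < a) :
    Integrable (fun y : ℝ => (y ^ 2 + a ^ 2)⁻¹) ∧ ∫ y : ℝ, (y ^ 2 + a ^ 2)⁻¹ = Real.pi / a := by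
  have h : (fun y : ℝ => (y ^ 2 + a ^ 2)⁻¹) = fun y => (a ^ 2)⁻¹ * (1 + (a⁻¹ * y) ^ 2)⁻¹ := by
    ext y
    rw [← mul_inv]
    congr 1
    field_simp
    ring
  rw [h]
  refine ⟨(integrable_inv_one_add_sq.comp_mul_left' (inv_ne_zero ha.ne')).const_mul _, ?_⟩
  rw [integral_const_mul, Measure.integral_comp_mul_left (fun y => (1 + y ^ 2)⁻¹),
    integral_univ_inv_one_add_sq, inv_inv, abs_of_pos ha, smul_eq_mul]
  field_simp

/-- Residue evaluation over the imaginary axis of the reciprocal of a function with a single, simple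
zero in the closed right half-plane and more than linear growth. The pole is removed by means of
divided differences, and the rest is integrated over a large rectangle. -/
lemma integral_inv_imaginary_axis {D : ℂ → ℂ} {w₀ : ℝ} (hw₀ : 0 < w₀) {d : ℂ}
    (hd : HasDerivAt D d w₀) (hd0 : d ≠ 0) (hD0 : D w₀ = 0)
    (hdiff : DifferentiableOn ℂ D {w | 0 < w.re}) (hcont : ContinuousOn D {w | 0 ≤ w.re})
    (hne : ∀ w : ℂ, 0 ≤ w.re → w ≠ w₀ → D w ≠ 0) {α T : ℝ} (hα1 : 1 < α) (hα2 : α ≤ 2)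
    (hgrow : ∀ w : ℂ, 0 ≤ w.re → T ≤ ‖w‖ → ‖w‖ ^ α / 2 ≤ ‖D w‖)
    (hint : Integrable fun y : ℝ => (D (y * Complex.I))⁻¹) :
    ∫ y : ℝ, (D (y * Complex.I))⁻¹ = -(2 * Real.pi) / d := by
  set U : Set ℂ := {w | 0 < w.re} with hU
  set H : Set ℂ := {w | 0 ≤ w.re} with hH
  have hUo : IsOpen U := isOpen_lt continuous_const Complex.continuous_re
  have hUH : U ⊆ H := fun w (hw : 0 < w.re) => show 0 ≤ w.re from hw.le
  have hUn : U ∈ 𝓝 (w₀ : ℂ) := hUo.mem_nhds (by simpa [hU] using hw₀)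
  have hHn : H ∈ 𝓝 (w₀ : ℂ) := mem_of_superset hUn hUH
  -- `D w = (w - w₀) k w`, and `G` is `1 / D` minus a multiple of `1 / (w ^ 2 - w₀ ^ 2)` with the
  -- same residue at `w₀`
  set k := dslope D w₀ with hk
  have hkne : ∀ w ∈ H, k w ≠ 0 := by
    intro w hw
    by_cases h : w = w₀
    · rw [h, hk, dslope_same, hd.deriv]; exact hd0
    · rw [hk, dslope_of_ne _ h, slope_def_field, hD0, sub_zero]
      exact div_ne_zero (hne w hw h) (sub_ne_zero.2 h)
  have hkd : DifferentiableOn ℂ k U := (Complex.differentiableOn_dslope hUn).2 hdiff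
  have hkc : ContinuousOn k H := (continuousOn_dslope hHn).2 ⟨hcont, hd.differentiableAt⟩
  set κ : ℂ → ℂ := fun w => (k w)⁻¹ with hκ
  have hκd : DifferentiableOn ℂ κ U := hkd.inv fun w hw => hkne w (hUH hw)
  have hκc : ContinuousOn κ H := hkc.inv₀ hkne
  have hκ0 : κ w₀ = d⁻¹ := by simp only [hκ, hk, dslope_same, hd.deriv]
  set G : ℂ → ℂ := fun w => dslope κ w₀ w + d⁻¹ / (w + w₀) with hG
  have hadd : ∀ w ∈ H, w + w₀ ≠ 0 := by
    intro w hw h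
    have := congrArg Complex.re h
    simp only [Complex.add_re, Complex.ofReal_re, Complex.zero_re] at this
    have hw' : 0 ≤ w.re := hw
    linarith
  have hGd : DifferentiableOn ℂ G U :=
    ((Complex.differentiableOn_dslope hUn).2 hκd).add
      ((differentiableOn_const _).div (by fun_prop) fun w hw => hadd w (hUH hw))
  have hGc : ContinuousOn G H :=
    ((continuousOn_dslope hHn).2 ⟨hκc, hκd.differentiableAt hUn⟩).add
      (continuousOn_const.div (by fun_prop) hadd)
  have hGeq : ∀ w ∈ H, w ≠ w₀ → G w = (D w)⁻¹ - d⁻¹ * (2 * w₀) / (w ^ 2 - w₀ ^ 2) := by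
    intro w hw h
    have h1 := sub_ne_zero.2 h
    have h2 := hadd w hw
    have h3 := hne w hw h
    simp only [hG]
    rw [dslope_of_ne _ h, slope_def_field, hκ0]
    simp only [hκ, hk]
    rw [dslope_of_ne _ h, slope_def_field, hD0, sub_zero, inv_div, sq_sub_sq]
    field_simp
    ring
  -- decay on the far sides
  set B : ℝ := 2 + 4 * w₀ * ‖d⁻¹‖ with hB
  have hGb : ∀ R : ℝ, T ≤ R → 1 ≤ R → 2 * w₀ ≤ R → ∀ w ∈ H, R ≤ ‖w‖ → ‖G w‖ ≤ B * R ^ (-α) := by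
    intro R hT hR1 hRw w hw hwR
    have ht0 : 0 < ‖w‖ := by linarith
    have hnew : w ≠ w₀ := by
      rintro rfl
      rw [Complex.norm_real, Real.norm_of_nonneg hw₀.le] at hwR
      linarith
    have hpow : ‖w‖ ^ (-α) ≤ R ^ (-α) :=
      Real.rpow_le_rpow_of_nonpos (by linarith) hwR (by linarith)
    have h1 : ‖(D w)⁻¹‖ ≤ 2 * ‖w‖ ^ (-α) := by
      have := hgrow w hw (hT.trans hwR)
      have hp := Real.rpow_pos_of_pos ht0 α
      rw [norm_inv, Real.rpow_neg ht0.le, ← div_eq_mul_inv, ← inv_div]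
      exact inv_anti₀ (by positivity) this
    have h2 : ‖d⁻¹ * (2 * w₀) / (w ^ 2 - w₀ ^ 2)‖ ≤ 4 * w₀ * ‖d⁻¹‖ * ‖w‖ ^ (-α) := by
      have h3 : ‖w‖ ^ 2 / 2 ≤ ‖w ^ 2 - (w₀ : ℂ) ^ 2‖ := by
        have := norm_sub_norm_le (w ^ 2) ((w₀ : ℂ) ^ 2)
        rw [norm_pow, norm_pow, Complex.norm_real, Real.norm_of_nonneg hw₀.le] at this
        nlinarith
      have h4 : ‖w‖ ^ (-2 : ℝ) ≤ ‖w‖ ^ (-α) :=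
        Real.rpow_le_rpow_of_exponent_le (by linarith) (by linarith)
      rw [norm_div, norm_mul, norm_mul, Complex.norm_real, Real.norm_of_nonneg hw₀.le,
        Complex.norm_ofNat]
      calc _ ≤ ‖d⁻¹‖ * (2 * w₀) / (‖w‖ ^ 2 / 2) := by gcongr
        _ = 4 * w₀ * ‖d⁻¹‖ * ‖w‖ ^ (-2 : ℝ) := by
          rw [Real.rpow_neg ht0.le, Real.rpow_two]; field_simp; ring
        _ ≤ _ := by gcongr
    rw [hGeq w hw hnew]
    calc _ ≤ _ := norm_sub_le _ _
      _ ≤ 2 * ‖w‖ ^ (-α) + 4 * w₀ * ‖d⁻¹‖ * ‖w‖ ^ (-α) := add_le_add h1 h2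
      _ = B * ‖w‖ ^ (-α) := by rw [hB]; ring
      _ ≤ _ := by gcongr
  -- Cauchy's theorem on the rectangle `[0, R] × [-R, R]`
  have hrect : ∀ R : ℝ, T ≤ R → 1 ≤ R → 2 * w₀ ≤ R →
      ‖∫ y in (-R)..R, G (y * Complex.I)‖ ≤ 4 * B * R ^ (1 - α) := by
    intro R hT hR1 hRw
    have hR0 : 0 < R := by linarith
    have hC := Complex.integral_boundary_rect_eq_zero_of_continuousOn_of_differentiableOn G
      (⟨0, -R⟩ : ℂ) (⟨R, R⟩ : ℂ) (hGc.mono fun w hw => by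
        have := (Complex.mem_reProdIm.1 hw).1
        rw [uIcc_of_le hR0.le] at this
        exact this.1) (hGd.mono fun w hw => by
        have := (Complex.mem_reProdIm.1 hw).1
        simp only at this
        rw [min_eq_left hR0.le, max_eq_right hR0.le] at this
        exact this.1)
    simp only [Complex.ofReal_zero, zero_add, smul_eq_mul] at hC
    set A1 := ∫ x in (0 : ℝ)..R, G (x + ((-R : ℝ) : ℂ) * Complex.I)
    set A2 := ∫ x in (0 : ℝ)..R, G (x + (R : ℂ) * Complex.I)
    set A3 := ∫ y in (-R)..R, G (R + (y : ℂ) * Complex.I)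
    set A4 := ∫ y in (-R)..R, G ((y : ℂ) * Complex.I)
    have e : Complex.I * A4 = A1 - A2 + Complex.I * A3 := by linear_combination -hC
    have hb := hGb R hT hR1 hRw
    have b1 : ‖A1‖ ≤ B * R ^ (-α) * |R - 0| := by
      refine intervalIntegral.norm_integral_le_of_norm_le_const fun x hx => hb _ ?_ ?_
      · rw [uIoc_of_le hR0.le] at hx
        simpa [hH] using hx.1.le
      · have := Complex.abs_im_le_norm (x + ((-R : ℝ) : ℂ) * Complex.I)
        simpa [abs_of_pos hR0] using this
    have b2 : ‖A2‖ ≤ B * R ^ (-α) * |R - 0| := by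
      refine intervalIntegral.norm_integral_le_of_norm_le_const fun x hx => hb _ ?_ ?_
      · rw [uIoc_of_le hR0.le] at hx
        simpa [hH] using hx.1.le
      · have := Complex.abs_im_le_norm (x + (R : ℂ) * Complex.I)
        simpa [abs_of_pos hR0] using this
    have b3 : ‖A3‖ ≤ B * R ^ (-α) * |R - -R| := by
      refine intervalIntegral.norm_integral_le_of_norm_le_const fun x hx => hb _ ?_ ?_
      · simpa [hH] using hR0.le
      · have := Complex.abs_re_le_norm ((R : ℂ) + (x : ℂ) * Complex.I)
        simpa [abs_of_pos hR0] using this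
    rw [sub_zero, abs_of_pos hR0] at b1 b2
    rw [sub_neg_eq_add, abs_of_pos (by linarith)] at b3
    calc ‖A4‖ = ‖Complex.I * A4‖ := by simp
      _ ≤ ‖A1‖ + ‖A2‖ + ‖A3‖ := by
        rw [e]
        refine (norm_add_le _ _).trans (add_le_add (norm_sub_le _ _) ?_)
        simp
      _ ≤ 4 * B * (R ^ (-α) * R) := by linarith
      _ = 4 * B * R ^ (1 - α) := by
        rw [sub_eq_add_neg, add_comm, Real.rpow_add hR0, Real.rpow_one]
  -- the correction term is explicit on the imaginary axis
  obtain ⟨hqi, hqv⟩ := integral_inv_sq_add_sq hw₀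
  have hax : ∀ y : ℝ, G (y * Complex.I) = (D (y * Complex.I))⁻¹ +
      d⁻¹ * (2 * w₀) * (((y ^ 2 + w₀ ^ 2)⁻¹ : ℝ) : ℂ) := by
    intro y
    have hnew : (y : ℂ) * Complex.I ≠ w₀ := by
      intro h
      have := congrArg Complex.re h
      simp at this
      exact hw₀.ne this
    rw [hGeq _ (by simp [hH]) hnew, mul_pow, Complex.I_sq]
    push_cast
    rw [show (y : ℂ) ^ 2 * -1 - (w₀ : ℂ) ^ 2 = -(y ^ 2 + w₀ ^ 2) by ring, div_neg, sub_neg_eq_add,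
      div_eq_mul_inv]
  have hqc : Integrable fun y : ℝ => d⁻¹ * (2 * w₀) * (((y ^ 2 + w₀ ^ 2)⁻¹ : ℝ) : ℂ) :=
    hqi.ofReal.const_mul _
  have hGi : Integrable fun y : ℝ => G (y * Complex.I) := by
    simp_rw [hax]
    exact hint.add hqc
  have hzero : ∫ y : ℝ, G (y * Complex.I) = 0 := by
    refine tendsto_nhds_unique (intervalIntegral_tendsto_integral hGi tendsto_neg_atTop_atBot
      tendsto_id) (squeeze_zero_norm' (a := fun R => 4 * B * R ^ (1 - α)) ?_ ?_)
    · filter_upwards [eventually_ge_atTop T, eventually_ge_atTop 1,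
        eventually_ge_atTop (2 * w₀)] with R h1 h2 h3 using hrect R h1 h2 h3
    · have := (tendsto_rpow_neg_atTop (sub_pos.2 hα1)).const_mul (4 * B)
      simpa using this
  simp_rw [hax] at hzero
  rw [integral_add hint hqc, integral_const_mul, integral_complex_ofReal,
    hqv] at hzero
  rw [eq_neg_of_add_eq_zero_left hzero]
  push_cast
  have : (w₀ : ℂ) ≠ 0 := by exact_mod_cast hw₀.ne'
  field_simp

/-! ### The Laplace transform of the profile -/

lemma strictMonoOn_add_rpow {ρ : ℝ} (h0 : 0 < ρ) :
    StrictMonoOn (fun w : ℝ => w + w ^ (1 + ρ)) (Ici 0) := fun _ ha _ _ hab =>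
  add_lt_add hab (Real.rpow_lt_rpow ha hab (by linarith))

/-- In the closed right half-plane `w + w ^ (1 + ρ)` is real and positive only on the positive
axis, because the imaginary parts of both terms have the same sign. -/
lemma add_cpow_ne {ρ : ℝ} (h0 : 0 < ρ) (h1 : ρ ≤ 1) {w₀ : ℝ} (hw₀ : 0 < w₀) {w : ℂ}
    (hw : 0 ≤ w.re) (hne : w ≠ w₀) :
    ((w₀ + w₀ ^ (1 + ρ) : ℝ) : ℂ) - w - w ^ ((1 + ρ : ℝ) : ℂ) ≠ 0 := by
  intro h
  have him := congrArg Complex.im h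
  simp only [Complex.sub_im, Complex.ofReal_im, Complex.zero_im, Complex.cpow_ofReal_im] at him
  have harg := abs_le.1 (Complex.abs_arg_le_pi_div_two_iff.2 hw)
  have hnn := Real.rpow_nonneg (norm_nonneg w) (1 + ρ)
  rcases lt_trichotomy w.im 0 with hi | hi | hi
  · have ha := Complex.arg_neg_iff.2 hi
    have := Real.sin_nonpos_of_nonpos_of_neg_pi_le (x := w.arg * (1 + ρ)) (by nlinarith)
      (by nlinarith)
    nlinarith
  · have hwr : w = (w.re : ℂ) := Complex.ext (by simp) (by simp [hi])
    rw [hwr, ← Complex.ofReal_cpow hw, ← Complex.ofReal_sub, ← Complex.ofReal_sub,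
      Complex.ofReal_eq_zero] at h
    have : w.re = w₀ := (strictMonoOn_add_rpow h0).injOn (mem_Ici.2 hw) (mem_Ici.2 hw₀.le)
      (by linarith)
    exact hne (by rw [hwr, this])
  · have ha := Complex.arg_nonneg_iff.2 hi.le
    have := Real.sin_nonneg_of_nonneg_of_le_pi (x := w.arg * (1 + ρ)) (by nlinarith)
      (by nlinarith)
    nlinarith

/-- On the positive imaginary axis the power `w ^ (1 + ρ)` is governed by the rate of the stable law. -/
lemma mul_I_cpow {ρ : ℝ} {v : ℝ} (hv : 0 < v) :
    ((v : ℂ) * Complex.I) ^ ((1 + ρ : ℝ) : ℂ) =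
      -(starRingEnd ℂ) (stableRate ρ * (v ^ (1 + ρ) : ℝ)) := by
  have hI : -(starRingEnd ℂ) (stableRate ρ) =
      Complex.exp (((Real.pi / 2 * (1 + ρ) : ℝ) : ℂ) * Complex.I) := by
    rw [stableRate, ← Complex.exp_conj, map_mul, Complex.conj_ofReal, Complex.conj_I,
      ← mul_neg_one, ← Complex.exp_pi_mul_I, ← Complex.exp_add]
    congr 1
    push_cast
    ring
  rw [map_mul, Complex.conj_ofReal, ← neg_mul, hI, Complex.cpow_def_of_ne_zero
    (mul_ne_zero (by exact_mod_cast hv.ne') Complex.I_ne_zero),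
    Complex.log_ofReal_mul hv Complex.I_ne_zero, Complex.log_I, add_mul, Complex.exp_add,
    Real.rpow_def_of_pos hv, mul_comm]
  push_cast
  congr 2
  ring

/-- The Laplace transform of the mass density, `ψ(w + w ^ (1 + ρ)) = 1 / (1 + (1 + ρ) w ^ ρ)`, as
the residue of `1 / (s - w - w ^ (1 + ρ))` at its only pole in the right half-plane. -/
theorem laplace_mul_numberProfile_eq {ρ : ℝ} (h0 : 0 < ρ) (h1 : ρ ≤ 1) {w₀ : ℝ} (hw₀ : 0 < w₀) :
    ∫ x in Ioi 0, Real.exp (-((w₀ + w₀ ^ (1 + ρ)) * x)) * (x * numberProfile ρ x) =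
      (1 + (1 + ρ) * w₀ ^ ρ)⁻¹ := by
  have hα : 0 < 1 + ρ := by linarith
  have hr := stableRate_re_pos h0 h1
  set s := w₀ + w₀ ^ (1 + ρ) with hs
  have hs0 : 0 < s := by positivity
  rw [(laplace_mul_numberProfile h0 h1 hs0).2]
  set D : ℂ → ℂ := fun w => (s : ℂ) - w - w ^ ((1 + ρ : ℝ) : ℂ) with hD
  set g : ℝ → ℂ := fun v => ((s : ℂ) + v * Complex.I + stableRate ρ * (v ^ (1 + ρ) : ℝ))⁻¹ with hg
  have hgD : ∀ v : ℝ, 0 < v → (D (v * Complex.I))⁻¹ = (starRingEnd ℂ) (g v) := by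
    intro v hv
    simp only [hD, hg]
    rw [mul_I_cpow hv, map_inv₀, map_add, map_add, map_mul _ (v : ℂ), Complex.conj_I,
      Complex.conj_ofReal, Complex.conj_ofReal]
    congr 1
    ring
  have hgi : IntegrableOn g (Ioi 0) := by
    refine (integrableOn_inv_add_rpow (by linarith : 1 < 1 + ρ) hs0 hr).mono' (by fun_prop) ?_
    filter_upwards [ae_restrict_mem measurableSet_Ioi] with v hv
    have := Real.rpow_nonneg (mem_Ioi.1 hv).le (1 + ρ)
    simp only [hg]
    rw [norm_inv]
    refine inv_anti₀ (by positivity) ?_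
    refine le_trans (le_of_eq ?_) (Complex.re_le_norm _)
    simp
  have hherm : ∀ v : ℝ, (D ((-v : ℝ) * Complex.I))⁻¹ = (starRingEnd ℂ) (D (v * Complex.I))⁻¹ := by
    intro v
    have harg : ((v : ℂ) * Complex.I).arg ≠ Real.pi := by
      intro h
      have := (Complex.arg_eq_pi_iff.1 h).1
      simp at this
    have h2 : (((-v : ℝ) : ℂ) * Complex.I) = (starRingEnd ℂ) ((v : ℂ) * Complex.I) := by simp
    simp only [hD]
    rw [h2, Complex.conj_cpow _ _ harg, Complex.conj_ofReal, map_inv₀, map_sub, map_sub,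
      Complex.conj_ofReal]
  have hDi : IntegrableOn (fun v : ℝ => (D (v * Complex.I))⁻¹) (Ioi 0) := by
    have : IntegrableOn (fun v => (starRingEnd ℂ) (g v)) (Ioi 0) :=
      Complex.conjCLE.toContinuousLinearMap.integrable_comp hgi
    exact this.congr_fun (fun v hv => (hgD v hv).symm) measurableSet_Ioi
  obtain ⟨hint, hre⟩ := integrable_and_re_integral_of_hermitian hherm hDi
  have hhalf : (∫ v in Ioi (0 : ℝ), g v).re = (∫ v : ℝ, (D (v * Complex.I))⁻¹).re / 2 := by
    rw [hre, setIntegral_congr_fun measurableSet_Ioi fun v hv => hgD v hv, integral_conj,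
      Complex.conj_re]
    ring
  have hslit : ∀ w : ℂ, 0 < w.re → w ∈ Complex.slitPlane := fun w hw => Or.inl hw
  have hderiv : ∀ w : ℂ, 0 < w.re →
      HasDerivAt D (0 - 1 - ((1 + ρ : ℝ) : ℂ) * w ^ (((1 + ρ : ℝ) : ℂ) - 1) * 1) w := fun w hw =>
    ((hasDerivAt_const w _).sub (hasDerivAt_id w)).sub ((hasDerivAt_id w).cpow_const (hslit w hw))
  have hd := hderiv w₀ (by simpa using hw₀)
  have hdval : (0 - 1 - ((1 + ρ : ℝ) : ℂ) * (w₀ : ℂ) ^ (((1 + ρ : ℝ) : ℂ) - 1) * 1) =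
      ((-(1 + (1 + ρ) * w₀ ^ ρ) : ℝ) : ℂ) := by
    rw [show ((1 + ρ : ℝ) : ℂ) - 1 = (ρ : ℂ) by push_cast; ring, ← Complex.ofReal_cpow hw₀.le]
    push_cast
    ring
  rw [hdval] at hd
  have hpos : 0 < 1 + (1 + ρ) * w₀ ^ ρ := by positivity
  have key := integral_inv_imaginary_axis hw₀ hd (by
      rw [Complex.ofReal_ne_zero]; linarith) (by
      simp only [hD, hs]
      rw [← Complex.ofReal_cpow hw₀.le]
      push_cast
      ring) (fun w hw => (hderiv w hw).differentiableAt.differentiableWithinAt)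
    (fun w hw => ((continuousAt_const.sub continuousAt_id).sub
      (Complex.continuousAt_cpow_const_of_re_pos (Or.inl hw)
        (by simpa using hα))).continuousWithinAt)
    (fun w hw hne => add_cpow_ne h0 h1 hw₀ hw hne) (α := 1 + ρ)
    (T := max 1 ((2 * (1 + s)) ^ ρ⁻¹)) (by linarith) (by linarith) (fun w hw hT => ?_) hint
  · rw [hhalf, key, ← Complex.ofReal_ofNat, ← Complex.ofReal_mul, ← Complex.ofReal_neg,
      ← Complex.ofReal_div, Complex.ofReal_re]
    have := Real.pi_pos
    field_simp
  -- growth: the power dominates the other terms as soon as `2 (1 + s) ≤ ‖w‖ ^ ρ`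
  · set t := ‖w‖ with ht
    have ht1 : 1 ≤ t := (le_max_left _ _).trans hT
    have ht0 : 0 < t := by linarith
    have ht2 : 2 * (1 + s) ≤ t ^ ρ := by
      have := Real.rpow_le_rpow (by positivity) ((le_max_right _ _).trans hT) h0.le
      rwa [← Real.rpow_mul (by positivity), inv_mul_cancel₀ h0.ne', Real.rpow_one] at this
    have htα : t ^ (1 + ρ) = t * t ^ ρ := by rw [Real.rpow_add ht0, Real.rpow_one]
    have hn : ‖w ^ ((1 + ρ : ℝ) : ℂ)‖ = t ^ (1 + ρ) := Complex.norm_cpow_real w (1 + ρ)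
    have h3 : t ^ (1 + ρ) ≤ ‖D w‖ + (s + t) := by
      rw [← hn, show w ^ ((1 + ρ : ℝ) : ℂ) = -D w + (s - w) by simp only [hD]; ring]
      refine (norm_add_le _ _).trans (add_le_add (norm_neg _).le ((norm_sub_le _ _).trans ?_))
      rw [Complex.norm_real, Real.norm_of_nonneg hs0.le]
    nlinarith

/-! ### Complete monotonicity -/

/-- `f` alternates up to order `n` on `(0, ∞)`: `f` and its derivatives up to order `n`, multiplied
by `(-1) ^ k`, are nonnegative there. -/
def Alternating : ℕ → (ℝ → ℝ) → Prop
  | 0, f => ∀ x, 0 < x → 0 ≤ f x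
  | n + 1, f => (∀ x, 0 < x → 0 ≤ f x) ∧
      ∃ g : ℝ → ℝ, (∀ x, 0 < x → HasDerivAt f (-g x) x) ∧ Alternating n g

lemma Alternating.nonneg {n : ℕ} {f : ℝ → ℝ} (h : Alternating n f) : ∀ x, 0 < x → 0 ≤ f x := by
  cases n with
  | zero => exact h
  | succ n => exact h.1

lemma Alternating.congr {n : ℕ} {f g : ℝ → ℝ} (h : Alternating n f)
    (hfg : ∀ x, 0 < x → g x = f x) : Alternating n g := by
  cases n with
  | zero => exact fun x hx => (hfg x hx).symm ▸ h x hx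
  | succ n =>
    obtain ⟨h0, f', hf', hn⟩ := h
    refine ⟨fun x hx => (hfg x hx).symm ▸ h0 x hx, f', fun x hx => ?_, hn⟩
    refine (hf' x hx).congr_of_eventuallyEq ?_
    filter_upwards [Ioi_mem_nhds hx] with y hy using hfg y hy

lemma Alternating.of_succ {n : ℕ} : ∀ {f : ℝ → ℝ}, Alternating (n + 1) f → Alternating n f := by
  induction n with
  | zero => exact fun h => h.1
  | succ n ih =>
    rintro f ⟨h0, g, hg, hn⟩
    exact ⟨h0, g, hg, ih hn⟩

lemma Alternating.add {n : ℕ} : ∀ {f g : ℝ → ℝ}, Alternating n f → Alternating n g →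
    Alternating n fun x => f x + g x := by
  induction n with
  | zero => exact fun hf hg x hx => add_nonneg (hf x hx) (hg x hx)
  | succ n ih =>
    rintro f g ⟨hf0, f', hf', hf⟩ ⟨hg0, g', hg', hg⟩
    refine ⟨fun x hx => add_nonneg (hf0 x hx) (hg0 x hx), fun x => f' x + g' x, fun x hx => ?_,
      ih hf hg⟩
    rw [neg_add]
    exact (hf' x hx).add (hg' x hx)

lemma Alternating.mul {n : ℕ} : ∀ {f g : ℝ → ℝ}, Alternating n f → Alternating n g →
    Alternating n fun x => f x * g x := by
  induction n with
  | zero => exact fun hf hg x hx => mul_nonneg (hf x hx) (hg x hx)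
  | succ n ih =>
    intro f g hf hg
    have hfn := hf.of_succ
    have hgn := hg.of_succ
    obtain ⟨hf0, f', hf', hf⟩ := hf
    obtain ⟨hg0, g', hg', hg⟩ := hg
    refine ⟨fun x hx => mul_nonneg (hf0 x hx) (hg0 x hx), fun x => f' x * g x + f x * g' x,
      fun x hx => ?_, (ih hf hgn).add (ih hfn hg)⟩
    exact ((hf' x hx).mul (hg' x hx)).congr_deriv (by ring)

lemma alternating_rpow (n : ℕ) : ∀ {a p : ℝ}, 0 ≤ a → p ≤ 0 → Alternating n fun x => a * x ^ p := by
  induction n with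
  | zero => exact fun ha _ x hx => mul_nonneg ha (Real.rpow_nonneg hx.le _)
  | succ n ih =>
    intro a p ha hp
    refine ⟨fun x hx => mul_nonneg ha (Real.rpow_nonneg hx.le _), fun x => a * -p * x ^ (p - 1),
      fun x hx => ?_, ih (mul_nonneg ha (neg_nonneg.2 hp)) (by linarith)⟩
    exact ((Real.hasDerivAt_rpow_const (p := p) (Or.inl hx.ne')).const_mul a).congr_deriv (by ring)

lemma alternating_inv_one_add_rpow {a ρ : ℝ} (ha : 0 ≤ a) (h0 : 0 ≤ ρ) (h1 : ρ ≤ 1) (n : ℕ) :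
    Alternating n fun w => (1 + a * w ^ ρ)⁻¹ := by
  have hpos : ∀ w : ℝ, 0 < w → 0 < 1 + a * w ^ ρ := fun w hw => by
    have := Real.rpow_nonneg hw.le ρ
    positivity
  induction n with
  | zero => exact fun w hw => (inv_pos.2 (hpos w hw)).le
  | succ n ih =>
    refine ⟨fun w hw => (inv_pos.2 (hpos w hw)).le,
      fun w => (a * ρ) * w ^ (ρ - 1) * ((1 + a * w ^ ρ)⁻¹ * (1 + a * w ^ ρ)⁻¹), fun w hw => ?_,
      (alternating_rpow n (mul_nonneg ha h0) (by linarith)).mul (ih.mul ih)⟩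
    have := (hpos w hw).ne'
    exact ((((Real.hasDerivAt_rpow_const (p := ρ) (Or.inl hw.ne')).const_mul a).const_add 1).inv
      this).congr_deriv (by field_simp)

/-- The derivative in the definition does not depend on the order. -/
lemma exists_alternating_deriv {f : ℝ → ℝ} (h : ∀ n, Alternating n f) :
    ∃ g : ℝ → ℝ, (∀ x, 0 < x → HasDerivAt f (-g x) x) ∧ ∀ n, Alternating n g := by
  obtain ⟨-, g, hg, -⟩ := h 1
  refine ⟨g, hg, fun n => ?_⟩
  obtain ⟨-, g', hg', hn⟩ := h (n + 1)
  exact hn.congr fun x hx => neg_injective ((hg x hx).unique (hg' x hx))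

lemma integrableOn_pow_mul_exp_mul {q : ℝ → ℝ}
    (hq : ∀ s, 0 < s → IntegrableOn (fun x => Real.exp (-(s * x)) * q x) (Ioi 0)) (k : ℕ) {s : ℝ}
    (hs : 0 < s) : IntegrableOn (fun x => x ^ k * Real.exp (-(s * x)) * q x) (Ioi 0) := by
  have h2 : (fun x => x ^ k * Real.exp (-(s * x)) * q x) =
      fun x => (x ^ k * Real.exp (-(s / 2 * x))) * (Real.exp (-(s / 2 * x)) * q x) := by
    ext x
    rw [show -(s * x) = -(s / 2 * x) + -(s / 2 * x) by ring, Real.exp_add]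
    ring
  rw [h2]
  refine (hq (s / 2) (by linarith)).bdd_mul (c := k ! * (2 / s) ^ k) (by fun_prop) ?_
  filter_upwards [ae_restrict_mem measurableSet_Ioi] with x hx
  have hx0 : (0 : ℝ) < x := hx
  rw [Real.norm_of_nonneg (by positivity), Real.exp_neg, ← div_eq_mul_inv,
    div_le_iff₀ (Real.exp_pos _)]
  have h3 := Real.pow_div_factorial_le_exp (s / 2 * x) (by positivity) k
  rw [div_le_iff₀ (by positivity), mul_pow] at h3
  calc x ^ k = (2 / s) ^ k * ((s / 2) ^ k * x ^ k) := by
        rw [← mul_assoc, ← mul_pow]; field_simp; simp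
    _ ≤ (2 / s) ^ k * (Real.exp (s / 2 * x) * k !) := by gcongr
    _ = _ := by ring

lemma hasDerivAt_integral_pow_mul_exp_mul {q : ℝ → ℝ}
    (hq : ∀ s, 0 < s → IntegrableOn (fun x => Real.exp (-(s * x)) * q x) (Ioi 0)) (k : ℕ) {s : ℝ}
    (hs : 0 < s) :
    HasDerivAt (fun s => ∫ x in Ioi 0, x ^ k * Real.exp (-(s * x)) * q x)
      (-∫ x in Ioi 0, x ^ (k + 1) * Real.exp (-(s * x)) * q x) s := by
  rw [← integral_neg]
  refine (hasDerivAt_integral_of_dominated_loc_of_deriv_le (s := Metric.ball s (s / 2))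
    (bound := fun x => ‖x ^ (k + 1) * Real.exp (-(s / 2 * x)) * q x‖)
    (F := fun s x => x ^ k * Real.exp (-(s * x)) * q x)
    (F' := fun s x => -(x ^ (k + 1) * Real.exp (-(s * x)) * q x))
    (Metric.ball_mem_nhds s (by linarith)) ?_ (integrableOn_pow_mul_exp_mul hq k hs)
    (integrableOn_pow_mul_exp_mul hq (k + 1) hs).neg.aestronglyMeasurable ?_
    (integrableOn_pow_mul_exp_mul hq (k + 1) (by linarith)).norm ?_).2
  · filter_upwards [Ioi_mem_nhds hs] with r hr
    exact (integrableOn_pow_mul_exp_mul hq k hr).aestronglyMeasurable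
  · filter_upwards [ae_restrict_mem measurableSet_Ioi] with x hx r hr
    have hx0 : (0 : ℝ) < x := hx
    have hr2 : s / 2 ≤ r := by
      have := (abs_lt.1 (Real.dist_eq r s ▸ Metric.mem_ball.1 hr)).1
      linarith
    rw [norm_neg, norm_mul, norm_mul, norm_mul, norm_mul, Real.norm_of_nonneg (Real.exp_pos _).le,
      Real.norm_of_nonneg (Real.exp_pos _).le]
    gcongr
  · refine ae_of_all _ fun x r _ => ?_
    have h1 : HasDerivAt (fun r => Real.exp (-(r * x))) (Real.exp (-(r * x)) * -(1 * x)) r :=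
      (((hasDerivAt_id r).mul_const x).neg).exp
    exact ((h1.const_mul (x ^ k)).mul_const (q x)).congr_deriv (by ring)

/-- The function `y e ^ (-y)` increases up to `1` and decreases afterwards. -/
lemma mul_exp_neg_le {a b : ℝ} (hb : 0 < b) (h : 0 ≤ (b - a) * (1 - b)) :
    a * Real.exp (-a) ≤ b * Real.exp (-b) := by
  have h1 : a ≤ b * Real.exp (a - b) := by
    have := Real.add_one_le_exp (a - b)
    nlinarith
  calc a * Real.exp (-a) ≤ b * Real.exp (a - b) * Real.exp (-a) := by gcongr
    _ = _ := by rw [mul_assoc, ← Real.exp_add]; congr 2; ring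

lemma mul_exp_neg_lt {y : ℝ} (h : y ≠ 1) : y * Real.exp (-y) < Real.exp (-1) := by
  have h1 : y < Real.exp (y - 1) := by
    have := Real.add_one_lt_exp (x := y - 1) (sub_ne_zero.2 h)
    linarith
  calc y * Real.exp (-y) < Real.exp (y - 1) * Real.exp (-y) := by gcongr
    _ = _ := by rw [← Real.exp_add]; congr 1; ring

/-- A continuous function is nonnegative on `(0, ∞)` if its integrals against all the kernels
`x ^ k e ^ (-s x)` are: with `s` close to `k / x₀` these kernels concentrate at `x₀`. -/
theorem nonneg_of_integral_pow_mul_exp_nonneg {q : ℝ → ℝ} (hc : ContinuousOn q (Ioi 0))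
    (hq : ∀ s, 0 < s → IntegrableOn (fun x => Real.exp (-(s * x)) * q x) (Ioi 0))
    (hnn : ∀ (k : ℕ) (s : ℝ), 0 < s → 0 ≤ ∫ x in Ioi 0, x ^ k * Real.exp (-(s * x)) * q x)
    {x₀ : ℝ} (hx₀ : 0 < x₀) : 0 ≤ q x₀ := by
  by_contra! hneg
  -- the powers `c ^ k` are the normalized kernels, with maximum at `x₀`
  set c : ℝ → ℝ := fun x => x / x₀ * Real.exp (-(x / x₀)) with hcdef
  have hcc : Continuous c := by simp only [hcdef]; fun_prop
  have hc0 : ∀ x, 0 < x → 0 ≤ c x := fun x hx => by simp only [hcdef]; positivity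
  set δ := -q x₀ / 2 with hδ
  have hδ0 : 0 < δ := by rw [hδ]; linarith
  have hcq : ContinuousAt q x₀ := hc.continuousAt (Ioi_mem_nhds hx₀)
  obtain ⟨η₀, hη₀, hη₀q⟩ := Metric.eventually_nhds_iff.1
    (hcq.eventually_lt_const (show q x₀ < -δ by rw [hδ]; linarith))
  set η := min η₀ (x₀ / 2) with hη
  have hη0 : 0 < η := lt_min hη₀ (by linarith)
  have hηx : η ≤ x₀ / 2 := min_le_right _ _
  have hqη : ∀ x ∈ Ioo (x₀ - η) (x₀ + η), q x ≤ -δ := fun x hx => by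
    refine (hη₀q ?_).le
    rw [Real.dist_eq, abs_lt]
    have := min_le_left η₀ (x₀ / 2)
    constructor <;> linarith [hx.1, hx.2]
  -- away from `x₀` the base `c` is at most `M`, and near `x₀` it is at least some `M' > M`
  set M := max (c (x₀ - η)) (c (x₀ + η)) with hM
  have hM1 : M < Real.exp (-1) := by
    refine max_lt (mul_exp_neg_lt ?_) (mul_exp_neg_lt ?_) <;>
    · rw [Ne, div_eq_one_iff_eq hx₀.ne']; linarith
  have hM0 : 0 < M := lt_max_of_lt_right (by simp only [hcdef]; positivity)
  have hcM : ∀ x, 0 < x → x ∉ Ioo (x₀ - η) (x₀ + η) → c x ≤ M := by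
    intro x hx hxn
    by_cases h : x ≤ x₀ - η
    · refine le_max_of_le_left (mul_exp_neg_le (div_pos (by linarith) hx₀) (mul_nonneg ?_ ?_))
      · rw [sub_nonneg]; gcongr
      · rw [sub_nonneg, div_le_one hx₀]; linarith
    · have h' : x₀ + η ≤ x := by
        by_contra! h2
        exact hxn ⟨not_le.1 h, h2⟩
      refine le_max_of_le_right (mul_exp_neg_le (div_pos (by linarith) hx₀)
        (mul_nonneg_of_nonpos_of_nonpos ?_ ?_))
      · rw [sub_nonpos]; gcongr
      · rw [sub_nonpos, one_le_div hx₀]; linarith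
  obtain ⟨M', hMM', hM'1⟩ := exists_between hM1
  have hcx₀ : c x₀ = Real.exp (-1) := by simp [hcdef, hx₀.ne']
  obtain ⟨ξ₀, hξ₀, hξ₀c⟩ := Metric.eventually_nhds_iff.1
    (hcc.continuousAt.eventually_const_lt (show M' < c x₀ by rwa [hcx₀]))
  set ξ := min ξ₀ η with hξ
  have hξ0 : 0 < ξ := lt_min hξ₀ hη0
  have hcξ : ∀ x ∈ Ioo (x₀ - ξ) (x₀ + ξ), M' ≤ c x := fun x hx => by
    refine (hξ₀c ?_).le
    rw [Real.dist_eq, abs_lt]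
    have := min_le_left ξ₀ η
    constructor <;> linarith [hx.1, hx.2]
  have hξη : Ioo (x₀ - ξ) (x₀ + ξ) ⊆ Ioo (x₀ - η) (x₀ + η) := by
    have := min_le_right ξ₀ η
    exact Ioo_subset_Ioo (by linarith) (by linarith)
  set A := Ioo (x₀ - ξ) (x₀ + ξ)
  have hA0 : A ⊆ Ioi 0 := fun x hx => mem_Ioi.2 (by linarith [(hξη hx).1])
  set Q := ∫ x in Ioi 0, ‖Real.exp (-(1 * x)) * q x‖ with hQ
  set d := δ * Real.exp (-(2 * x₀)) * (2 * ξ) with hd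
  have hd0 : 0 < d := by positivity
  -- the negative contribution near `x₀` is at most `-d M' ^ k`, the rest at most `M ^ k Q`; the
  -- factor `e ^ (-x)` left over from `s = k / x₀ + 1` makes `Q` finite
  have hmain : ∀ k : ℕ, 0 ≤ M ^ k * Q - d * M' ^ k := by
    intro k
    have h1 := hnn k (k / x₀ + 1) (by positivity)
    have h2 : ∀ x, c x ^ k * (Real.exp (-(1 * x)) * q x) =
        (x₀ ^ k)⁻¹ * (x ^ k * Real.exp (-((k / x₀ + 1) * x)) * q x) := by
      intro x
      simp only [hcdef]
      rw [mul_pow, div_pow, ← Real.exp_nat_mul, show -((k / x₀ + 1) * x) =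
        k * -(x / x₀) + -(1 * x) by ring, Real.exp_add]
      ring
    have h3 : 0 ≤ ∫ x in Ioi 0, c x ^ k * (Real.exp (-(1 * x)) * q x) := by
      simp_rw [h2]
      rw [integral_const_mul]
      positivity
    have hi : IntegrableOn (fun x => c x ^ k * (Real.exp (-(1 * x)) * q x)) (Ioi 0) := by
      simp_rw [h2]
      exact (integrableOn_pow_mul_exp_mul hq k (by positivity)).const_mul _
    have hiA : IntegrableOn (fun _ : ℝ => δ * Real.exp (-(2 * x₀)) * M' ^ k) A :=
      integrableOn_const (by simp [A])
    have h4 : ∫ x in Ioi 0, c x ^ k * (Real.exp (-(1 * x)) * q x) ≤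
        ∫ x in Ioi 0, (M ^ k * ‖Real.exp (-(1 * x)) * q x‖ -
          A.indicator (fun _ => δ * Real.exp (-(2 * x₀)) * M' ^ k) x) := by
      refine setIntegral_mono_on hi (((hq 1 one_pos).norm.const_mul _).sub
        ((integrable_indicator_iff measurableSet_Ioo).2
          (hiA.mono_measure Measure.restrict_le_self))) measurableSet_Ioi fun x hx => ?_
      have hx0 : (0 : ℝ) < x := hx
      have hck := pow_nonneg (hc0 x hx0) k
      by_cases hxη : x ∈ Ioo (x₀ - η) (x₀ + η)
      · have hqx := hqη x hxη
        have hnn2 : 0 ≤ M ^ k * ‖Real.exp (-(1 * x)) * q x‖ := by positivity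
        by_cases hxA : x ∈ A
        · rw [indicator_of_mem hxA]
          have h5 : M' ^ k ≤ c x ^ k := pow_le_pow_left₀ (by linarith) (hcξ x hxA) k
          have h6 : Real.exp (-(2 * x₀)) ≤ Real.exp (-(1 * x)) :=
            Real.exp_le_exp.2 (by linarith [hxη.2])
          have h7 : δ * Real.exp (-(2 * x₀)) * M' ^ k ≤ -q x * Real.exp (-(1 * x)) * c x ^ k :=
            mul_le_mul (mul_le_mul (by linarith) h6 (Real.exp_pos _).le (by linarith)) h5
              (pow_nonneg (hM0.trans hMM').le k)
              (mul_nonneg (by linarith) (Real.exp_pos _).le)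
          linarith
        · rw [indicator_of_notMem hxA, sub_zero]
          refine le_trans ?_ hnn2
          exact mul_nonpos_of_nonneg_of_nonpos hck
            (mul_nonpos_of_nonneg_of_nonpos (Real.exp_pos _).le (by linarith))
      · rw [indicator_of_notMem (fun h => hxη (hξη h)), sub_zero]
        calc _ ≤ c x ^ k * ‖Real.exp (-(1 * x)) * q x‖ := by
              gcongr; exact Real.le_norm_self _
          _ ≤ _ := mul_le_mul_of_nonneg_right
            (pow_le_pow_left₀ (hc0 x hx0) (hcM x hx0 hxη) k) (norm_nonneg _)
    have h5 : ∫ x in Ioi 0, (M ^ k * ‖Real.exp (-(1 * x)) * q x‖ -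
          A.indicator (fun _ => δ * Real.exp (-(2 * x₀)) * M' ^ k) x) = M ^ k * Q - d * M' ^ k := by
      rw [integral_sub ((hq 1 one_pos).norm.const_mul _)
        ((integrable_indicator_iff measurableSet_Ioo).2
          (hiA.mono_measure Measure.restrict_le_self)), integral_const_mul,
        integral_indicator measurableSet_Ioo, Measure.restrict_restrict measurableSet_Ioo,
        inter_eq_left.2 hA0, setIntegral_const, Real.volume_real_Ioo_of_le (by linarith),
        smul_eq_mul, hd]
      ring
    linarith
  have hM'0 : 0 < M' := hM0.trans hMM'
  have hlim : Tendsto (fun k : ℕ => (M / M') ^ k * Q) atTop (𝓝 (0 * Q)) :=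
    (tendsto_pow_atTop_nhds_zero_of_lt_one (by positivity) ((div_lt_one hM'0).2 hMM')).mul_const Q
  rw [zero_mul] at hlim
  obtain ⟨k, hk⟩ := (hlim.eventually_lt_const hd0).exists
  have := hmain k
  rw [div_pow, div_mul_eq_mul_div, div_lt_iff₀ (by positivity)] at hk
  linarith

/-! ### Nonnegativity of the profile -/

lemma hasDerivAt_add_rpow {ρ : ℝ} {w : ℝ} (hw : 0 < w) :
    HasDerivAt (fun w : ℝ => w + w ^ (1 + ρ)) (1 + (1 + ρ) * w ^ ρ) w := by
  refine ((hasDerivAt_id w).add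
    (Real.hasDerivAt_rpow_const (p := 1 + ρ) (Or.inl hw.ne'))).congr_deriv ?_
  rw [add_sub_cancel_left]

/-- In the variable `w`, with `s = w + w ^ (1 + ρ)`, all derivatives of the Laplace transform of the
mass density alternate in sign: differentiation in `s` is differentiation in `w` followed by
multiplication by `(ds/dw)⁻¹`, and the latter function is completely monotone. -/
lemma exists_alternating_moment {ρ : ℝ} (h0 : 0 < ρ) (h1 : ρ ≤ 1) (k : ℕ) :
    ∃ f : ℝ → ℝ, (∀ n, Alternating n f) ∧ ∀ w, 0 < w →
      ∫ x in Ioi 0, x ^ k * Real.exp (-((w + w ^ (1 + ρ)) * x)) * (x * numberProfile ρ x) =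
        f w := by
  have hinv := alternating_inv_one_add_rpow (a := 1 + ρ) (by linarith) h0.le h1
  have hpos : ∀ w : ℝ, 0 < w → 0 < w + w ^ (1 + ρ) := fun w hw => by positivity
  induction k with
  | zero =>
    refine ⟨_, hinv, fun w hw => ?_⟩
    simpa using laplace_mul_numberProfile_eq h0 h1 hw
  | succ k ih =>
    obtain ⟨f, hf, hfw⟩ := ih
    obtain ⟨g, hg, hgn⟩ := exists_alternating_deriv hf
    refine ⟨_, fun n => (hgn n).mul (hinv n), fun w hw => ?_⟩
    have hd := (hasDerivAt_integral_pow_mul_exp_mul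
      (fun s hs => (laplace_mul_numberProfile h0 h1 hs).1) k (hpos w hw)).comp w
      (hasDerivAt_add_rpow hw)
    have hd' := (hg w hw).congr_of_eventuallyEq (f₁ := (fun s => ∫ x in Ioi 0,
      x ^ k * Real.exp (-(s * x)) * (x * numberProfile ρ x)) ∘ fun w : ℝ => w + w ^ (1 + ρ)) (by
        filter_upwards [Ioi_mem_nhds hw] with y hy using hfw y hy)
    have := hd.unique hd'
    have hne : 1 + (1 + ρ) * w ^ ρ ≠ 0 := by positivity
    rw [eq_mul_inv_iff_mul_eq₀ hne]
    linarith

/-- The mass density of the self-similar profile is nonnegative because its Laplace transform is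
completely monotone. -/
theorem numberProfile_nonneg {ρ : ℝ} (h0 : 0 < ρ) (h1 : ρ ≤ 1) {x : ℝ} (hx : 0 < x) :
    0 ≤ numberProfile ρ x := by
  have := nonneg_of_integral_pow_mul_exp_nonneg (q := fun x => x * numberProfile ρ x)
    (continuousOn_id.mul (continuousOn_numberProfile h0 h1))
    (fun s hs => (laplace_mul_numberProfile h0 h1 hs).1) (fun k s hs => ?_) hx
  · exact nonneg_of_mul_nonneg_right this hx
  · obtain ⟨w, hw, rfl⟩ := exists_pos_add_rpow_eq h0 hs
    obtain ⟨f, hf, hfw⟩ := exists_alternating_moment h0 h1 k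
    rw [hfw w hw]
    exact (hf 0).nonneg w hw

/-! ### The mass distribution of the profile -/

/-- The mass distribution `x n_ρ(x) dx` of the self-similar profile. -/
noncomputable def profileMeasure (ρ : ℝ) : Measure ℝ :=
  (volume.restrict (Ioi 0)).withDensity fun x => ENNReal.ofReal (x * numberProfile ρ x)

lemma aemeasurable_numberProfile {ρ : ℝ} (h0 : 0 < ρ) (h1 : ρ ≤ 1) :
    AEMeasurable (numberProfile ρ) (volume.restrict (Ioi 0)) :=
  (continuousOn_numberProfile h0 h1).aemeasurable measurableSet_Ioi

lemma aemeasurable_mul_numberProfile {ρ : ℝ} (h0 : 0 < ρ) (h1 : ρ ≤ 1) :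
    AEMeasurable (fun x => x * numberProfile ρ x) (volume.restrict (Ioi 0)) :=
  aemeasurable_id'.mul (aemeasurable_numberProfile h0 h1)

lemma integral_profileMeasure {ρ : ℝ} (h0 : 0 < ρ) (h1 : ρ ≤ 1) (g : ℝ → ℝ) :
    ∫ x, g x ∂(profileMeasure ρ) = ∫ x in Ioi 0, x * numberProfile ρ x * g x := by
  rw [profileMeasure, integral_withDensity_eq_integral_toReal_smul₀
    (aemeasurable_mul_numberProfile h0 h1).ennreal_ofReal
    (ae_of_all _ fun x => ENNReal.ofReal_lt_top)]
  refine setIntegral_congr_fun measurableSet_Ioi fun x hx => ?_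
  rw [ENNReal.toReal_ofReal (mul_nonneg (mem_Ioi.1 hx).le (numberProfile_nonneg h0 h1 hx)),
    smul_eq_mul]

/-- The profile has unit mass, by monotone convergence of its Laplace transform as `s → 0`. -/
lemma lintegral_mul_numberProfile {ρ : ℝ} (h0 : 0 < ρ) (h1 : ρ ≤ 1) :
    ∫⁻ x in Ioi 0, ENNReal.ofReal (x * numberProfile ρ x) = 1 := by
  have hα : 0 < 1 + ρ := by linarith
  set w : ℕ → ℝ := fun n => 1 / ((n : ℝ) + 1) with hw
  have hw0 : ∀ n, 0 < w n := fun n => by simp only [hw]; positivity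
  have hwlim : Tendsto w atTop (𝓝 0) := tendsto_one_div_add_atTop_nhds_zero_nat
  set s : ℕ → ℝ := fun n => w n + w n ^ (1 + ρ) with hs
  have hs0 : ∀ n, 0 < s n := fun n => by
    have := hw0 n
    simp only [hs]; positivity
  have hslim : Tendsto s atTop (𝓝 0) := by
    have := hwlim.add ((Real.continuousAt_rpow_const 0 (1 + ρ) (Or.inr hα.le)).tendsto.comp hwlim)
    simpa [Real.zero_rpow hα.ne', hs] using this
  have hanti : Antitone s := by
    intro a b hab
    have hww : w b ≤ w a := one_div_le_one_div_of_le (by positivity) (by simpa using hab)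
    exact add_le_add hww (Real.rpow_le_rpow (hw0 b).le hww hα.le)
  have hq0 : ∀ x, 0 < x → 0 ≤ x * numberProfile ρ x := fun x hx =>
    mul_nonneg hx.le (numberProfile_nonneg h0 h1 hx)
  have hlim : Tendsto (fun n => ∫⁻ x in Ioi 0,
      ENNReal.ofReal (Real.exp (-(s n * x)) * (x * numberProfile ρ x))) atTop
      (𝓝 (∫⁻ x in Ioi 0, ENNReal.ofReal (x * numberProfile ρ x))) := by
    refine lintegral_tendsto_of_tendsto_of_monotone (fun n => ?_) ?_ ?_
    · exact ((by fun_prop : Measurable fun x => Real.exp (-(s n * x))).aemeasurable.mul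
        (aemeasurable_mul_numberProfile h0 h1)).ennreal_ofReal
    · filter_upwards [ae_restrict_mem measurableSet_Ioi] with x hx a b hab
      have := hq0 x hx
      have hx0 : (0 : ℝ) < x := hx
      exact ENNReal.ofReal_le_ofReal (mul_le_mul_of_nonneg_right (Real.exp_le_exp.2
        (neg_le_neg (mul_le_mul_of_nonneg_right (hanti hab) hx0.le))) this)
    · filter_upwards with x
      refine ENNReal.tendsto_ofReal ?_
      have h2 : Tendsto (fun n => Real.exp (-(s n * x))) atTop (𝓝 (Real.exp (-(0 * x)))) :=
        (Real.continuous_exp.tendsto _).comp ((hslim.mul_const x).neg)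
      simpa using h2.mul_const (x * numberProfile ρ x)
  have hval : ∀ n, ∫⁻ x in Ioi 0, ENNReal.ofReal (Real.exp (-(s n * x)) *
      (x * numberProfile ρ x)) = ENNReal.ofReal (1 + (1 + ρ) * w n ^ ρ)⁻¹ := by
    intro n
    rw [← laplace_mul_numberProfile_eq h0 h1 (hw0 n), ofReal_integral_eq_lintegral_ofReal
      (laplace_mul_numberProfile h0 h1 (hs0 n)).1]
    filter_upwards [ae_restrict_mem measurableSet_Ioi] with x hx
    exact mul_nonneg (Real.exp_pos _).le (hq0 x hx)
  simp_rw [hval] at hlim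
  refine tendsto_nhds_unique hlim ?_
  have h3 : Tendsto (fun n => (1 + (1 + ρ) * w n ^ ρ)⁻¹) atTop (𝓝 (1 + (1 + ρ) * 0)⁻¹) := by
    refine Tendsto.inv₀ (Tendsto.const_add _ (Tendsto.const_mul _ ?_)) (by simp)
    have := (Real.continuousAt_rpow_const 0 ρ (Or.inr h0.le)).tendsto.comp hwlim
    simpa [Real.zero_rpow h0.ne', Function.comp_def] using this
  simpa using ENNReal.tendsto_ofReal h3

lemma isProbabilityMeasure_profileMeasure {ρ : ℝ} (h0 : 0 < ρ) (h1 : ρ ≤ 1) :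
    IsProbabilityMeasure (profileMeasure ρ) :=
  ⟨by rw [profileMeasure, withDensity_apply _ MeasurableSet.univ, Measure.restrict_univ,
    lintegral_mul_numberProfile h0 h1]⟩

lemma profileMeasure_absolutelyContinuous (ρ : ℝ) : profileMeasure ρ ≪ volume :=
  (withDensity_absolutelyContinuous _ _).trans Measure.restrict_le_self.absolutelyContinuous

lemma profileMeasure_null (ρ : ℝ) : profileMeasure ρ (Iic 0) = 0 := by
  have h : (volume.restrict (Ioi (0 : ℝ))) (Iic 0) = 0 := by
    rw [Measure.restrict_apply measurableSet_Iic]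
    rw [Iic_inter_Ioi, Ioc_self, measure_empty]
  exact withDensity_absolutelyContinuous _ _ h

lemma profileMeasure_singleton (ρ x : ℝ) : profileMeasure ρ {x} = 0 :=
  profileMeasure_absolutelyContinuous ρ (by simp)

lemma lapTr_profileMeasure {ρ : ℝ} (h0 : 0 < ρ) (h1 : ρ ≤ 1) (s : ℝ) :
    lapTr (profileMeasure ρ) s =
      ∫ x in Ioi 0, Real.exp (-(s * x)) * (x * numberProfile ρ x) := by
  rw [lapTr, integral_profileMeasure h0 h1]
  simp_rw [mul_comm]

lemma lapExp_profileMeasure {ρ : ℝ} (h0 : 0 < ρ) (h1 : ρ ≤ 1) (s : ℝ) :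
    lapExp (profileMeasure ρ) s = phiProfile ρ s := by
  rw [lapExp, integral_profileMeasure h0 h1, phiProfile]
  refine setIntegral_congr_fun measurableSet_Ioi fun x hx => ?_
  have hx0 : x ≠ 0 := (mem_Ioi.1 hx).ne'
  rw [neg_mul]
  field_simp

/-- The exponent of the profile inverts `w ↦ w + w ^ (1 + ρ)`, because the two functions have
reciprocal derivatives. -/
theorem lapExp_profileMeasure_add_rpow {ρ : ℝ} (h0 : 0 < ρ) (h1 : ρ ≤ 1) {w : ℝ} (hw : 0 < w) :
    lapExp (profileMeasure ρ) (w + w ^ (1 + ρ)) = w := by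
  have hα : 0 < 1 + ρ := by linarith
  have hp := isProbabilityMeasure_profileMeasure h0 h1
  have hm := profileMeasure_null ρ
  set f : ℝ → ℝ := fun w => lapExp (profileMeasure ρ) (w + w ^ (1 + ρ)) - w with hf
  have hc : ContinuousOn f (Icc 0 w) := by
    refine ContinuousOn.sub ((continuousOn_lapExp hm).comp
      (continuous_id.add (Real.continuous_rpow_const hα.le)).continuousOn fun x hx => ?_)
      continuousOn_id
    have := Real.rpow_nonneg hx.1 (1 + ρ)
    exact mem_Ici.2 (add_nonneg hx.1 this)
  have hd : ∀ x ∈ Ioo 0 w, HasDerivAt f 0 x := by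
    intro x hx
    have hx0 : 0 < x := hx.1
    have hpos : 0 < 1 + (1 + ρ) * x ^ ρ := by positivity
    have h2 := ((hasDerivAt_lapExp hm (show 0 < x + x ^ (1 + ρ) by positivity)).comp x
      (hasDerivAt_add_rpow hx0)).sub (hasDerivAt_id x)
    refine h2.congr_deriv ?_
    rw [lapTr_profileMeasure h0 h1, laplace_mul_numberProfile_eq h0 h1 hx0,
      inv_mul_cancel₀ hpos.ne', sub_self]
  obtain ⟨c, hc1, hc2⟩ := exists_hasDerivAt_eq_slope f (fun _ => 0) hw hc hd
  rw [eq_comm, div_eq_zero_iff, or_iff_left (by linarith)] at hc2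
  simp only [hf, Real.zero_rpow hα.ne', add_zero, lapExp_zero] at hc2
  linarith

lemma massTerm_succ {ρ : ℝ} (h0 : 0 < ρ) (x : ℝ) (k : ℕ) :
    massTerm ρ x (k + 1) =
      1 / Real.pi * (stableCoeff ρ k * (x ^ (((k : ℝ) + 1) * beta ρ) / ((k + 1) * beta ρ))) := by
  have hβ := beta_pos h0
  rw [massTerm, stableCoeff]
  push_cast
  field_simp

lemma summable_massTerm {ρ : ℝ} (h0 : 0 < ρ) (h1 : ρ ≤ 1) {x : ℝ} (hx : 0 ≤ x) :
    Summable fun k : ℕ => |massTerm ρ x (k + 1)| := by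
  have hβ := beta_pos h0
  refine Summable.of_nonneg_of_le (fun k => abs_nonneg _) (fun k => ?_)
    ((summable_stableCoeff h0 h1 (x ^ beta ρ)).abs.mul_left (1 / Real.pi * (x ^ beta ρ / beta ρ)))
  have hxk : x ^ (((k : ℝ) + 1) * beta ρ) = x ^ beta ρ * (x ^ beta ρ) ^ k := by
    rw [← pow_succ', ← Real.rpow_natCast, ← Real.rpow_mul hx]
    congr 1; push_cast; ring
  rw [massTerm_succ h0 x, hxk, abs_mul (1 / Real.pi), abs_mul (stableCoeff ρ k),
    abs_mul (stableCoeff ρ k), abs_div (_ * _), abs_mul (x ^ beta ρ),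
    abs_of_pos (show 0 < 1 / Real.pi by positivity),
    abs_of_nonneg (show 0 ≤ x ^ beta ρ by positivity),
    abs_of_pos (show 0 < ((k : ℝ) + 1) * beta ρ by positivity)]
  have : x ^ beta ρ * |(x ^ beta ρ) ^ k| / (((k : ℝ) + 1) * beta ρ) ≤
      x ^ beta ρ * |(x ^ beta ρ) ^ k| / (1 * beta ρ) := by
    gcongr
    linarith [k.cast_nonneg (α := ℝ)]
  calc _ ≤ 1 / Real.pi * (|stableCoeff ρ k| *
        (x ^ beta ρ * |(x ^ beta ρ) ^ k| / (1 * beta ρ))) := by gcongr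
    _ = _ := by ring

/-- The series for `M_ρ` is obtained from that for `n_ρ` by termwise integration. -/
lemma massProfile_eq {ρ : ℝ} (h0 : 0 < ρ) (h1 : ρ ≤ 1) {x : ℝ} (hx : 0 ≤ x) :
    massProfile ρ x = (profileMeasure ρ).real (Iic x) := by
  have hβ := beta_pos h0
  have hq0 : ∀ y ∈ Ioc 0 x, 0 ≤ y * numberProfile ρ y := fun y hy =>
    mul_nonneg hy.1.le (numberProfile_nonneg h0 h1 hy.1)
  have hprof : (profileMeasure ρ).real (Iic x) = ∫ y in Ioc 0 x, y * numberProfile ρ y := by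
    rw [measureReal_def, profileMeasure, withDensity_apply _ measurableSet_Iic,
      Measure.restrict_restrict measurableSet_Iic, Iic_inter_Ioi, integral_eq_lintegral_of_nonneg_ae
      ((ae_restrict_mem measurableSet_Ioc).mono hq0)
      ((aemeasurable_mul_numberProfile h0 h1).mono_measure
        (Measure.restrict_mono Ioc_subset_Ioi_self le_rfl)).aestronglyMeasurable]
  set F : ℕ → ℝ → ℝ := fun k y =>
    1 / Real.pi * (stableCoeff ρ k * y ^ (((k : ℝ) + 1) * beta ρ - 1)) with hF
  have hk : ∀ k : ℕ, (-1 : ℝ) < ((k : ℝ) + 1) * beta ρ - 1 := fun k => by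
    have : 0 < ((k : ℝ) + 1) * beta ρ := by positivity
    linarith
  have hpow : ∀ k : ℕ, ∫ y in Ioc 0 x, y ^ (((k : ℝ) + 1) * beta ρ - 1) =
      x ^ (((k : ℝ) + 1) * beta ρ) / ((k + 1) * beta ρ) := by
    intro k
    rw [← intervalIntegral.integral_of_le hx, integral_rpow (Or.inl (hk k)), sub_add_cancel,
      Real.zero_rpow (by positivity), sub_zero]
  have hint : ∀ k, IntegrableOn (F k) (Ioc 0 x) := fun k =>
    (((intervalIntegral.intervalIntegrable_rpow' (hk k)).1).const_mul _).const_mul _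
  have hval : ∀ k, ∫ y in Ioc 0 x, F k y = massTerm ρ x (k + 1) := by
    intro k
    simp only [hF]
    rw [integral_const_mul, integral_const_mul, hpow, massTerm_succ h0 x]
  have hnorm : ∀ k, ∫ y in Ioc 0 x, ‖F k y‖ = |massTerm ρ x (k + 1)| := by
    intro k
    have : ∀ y ∈ Ioc 0 x, ‖F k y‖ =
        1 / Real.pi * (|stableCoeff ρ k| * y ^ (((k : ℝ) + 1) * beta ρ - 1)) := by
      intro y hy
      simp only [hF]
      rw [norm_mul, norm_mul, Real.norm_of_nonneg (by positivity : 0 ≤ 1 / Real.pi),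
        Real.norm_eq_abs, Real.norm_of_nonneg (Real.rpow_nonneg hy.1.le _)]
    rw [setIntegral_congr_fun measurableSet_Ioc this, integral_const_mul, integral_const_mul, hpow,
      massTerm_succ h0 x, abs_mul, abs_mul, abs_of_pos (by positivity : 0 < 1 / Real.pi),
      abs_of_nonneg (show 0 ≤ x ^ (((k : ℝ) + 1) * beta ρ) / ((k + 1) * beta ρ) by positivity)]
  have hsum := hasSum_integral_of_summable_integral_norm hint
    (by simpa only [hnorm] using summable_massTerm h0 h1 hx)
  rw [hprof, massProfile]
  simp only [hval] at hsum
  rw [hsum.tsum_eq]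
  refine setIntegral_congr_fun measurableSet_Ioc fun y hy => ?_
  have hy0 : 0 < y := hy.1
  simp only [hF]
  rw [numberProfile, tsum_mul_left, mul_left_comm y, ← tsum_mul_left (a := y)]
  refine congrArg (1 / Real.pi * ·) (tsum_congr fun k => ?_)
  rw [numberTerm_succ ρ hy0, Real.rpow_sub_one hy0.ne', Real.rpow_sub hy0, add_one_mul,
    Real.rpow_add hy0, mul_comm (k : ℝ), Real.rpow_mul hy0.le, Real.rpow_natCast, Real.rpow_two]
  field_simp

/-! ### The weak form for Lipschitz functions -/

/-- `f` vanishes at `0⁺` and has Lipschitz constant `C` on `(0, ∞)`. -/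
def SlopeBound (f : ℝ → ℝ) (C : ℝ) : Prop :=
  ∀ x, 0 < x → |f x| ≤ C * x ∧ ∀ y, 0 < y → |f (x + y) - f x| ≤ C * y

lemma SlopeBound.add {f g : ℝ → ℝ} {C D : ℝ} (hf : SlopeBound f C) (hg : SlopeBound g D) :
    SlopeBound (fun x => f x + g x) (C + D) := fun x hx =>
  ⟨(abs_add_le _ _).trans (by linarith [(hf x hx).1, (hg x hx).1]), fun y hy => by
    rw [add_sub_add_comm]
    exact (abs_add_le _ _).trans (by linarith [(hf x hx).2 y hy, (hg x hx).2 y hy])⟩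

lemma SlopeBound.const_mul {f : ℝ → ℝ} {C : ℝ} (hf : SlopeBound f C) (a : ℝ) :
    SlopeBound (fun x => a * f x) (|a| * C) := fun x hx =>
  ⟨by rw [abs_mul, mul_assoc]; exact mul_le_mul_of_nonneg_left (hf x hx).1 (abs_nonneg a),
    fun y hy => by
      rw [← mul_sub, abs_mul, mul_assoc]
      exact mul_le_mul_of_nonneg_left ((hf x hx).2 y hy) (abs_nonneg a)⟩

lemma SlopeBound.increment {f : ℝ → ℝ} {C : ℝ} (hf : SlopeBound f C) {x y : ℝ} (hx : 0 < x)
    (hy : 0 < y) : |(f (x + y) - f x - f y) * (x + y)| ≤ 4 * C * (x * y) := by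
  have h1 : |f (x + y) - f x - f y| ≤ 2 * C * y :=
    (abs_sub _ _).trans (by linarith [(hf x hx).2 y hy, (hf y hy).1])
  have h2 : |f (x + y) - f x - f y| ≤ 2 * C * x := by
    rw [add_comm x y, sub_right_comm]
    exact (abs_sub _ _).trans (by linarith [(hf y hy).2 x hx, (hf x hx).1])
  rw [abs_mul, abs_of_pos (add_pos hx hy)]
  nlinarith

lemma slopeBound_of_deriv {f f' : ℝ → ℝ} {C : ℝ} (hf : ∀ x, 0 < x → HasDerivAt f (f' x) x)
    (hf' : ∀ x, 0 < x → |f' x| ≤ C) (h0 : Tendsto f (𝓝[>] 0) (𝓝 0)) : SlopeBound f C := by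
  have hlip : ∀ x y, 0 < x → 0 < y → |f y - f x| ≤ C * |y - x| := fun x y hx hy =>
    (convex_Ioi (0 : ℝ)).norm_image_sub_le_of_norm_hasDerivWithin_le
      (fun z hz => (hf z hz).hasDerivWithinAt) hf' hx hy
  refine fun x hx => ⟨?_, fun y hy => ?_⟩
  · have h1 : Tendsto (fun z => |f x - f z|) (𝓝[>] 0) (𝓝 |f x - 0|) := (h0.const_sub _).abs
    have h2 : Tendsto (fun z : ℝ => C * |x - z|) (𝓝[>] 0) (𝓝 (C * |x - 0|)) :=
      (tendsto_nhdsWithin_of_tendsto_nhds tendsto_id).const_sub x |>.abs.const_mul C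
    have := le_of_tendsto_of_tendsto h1 h2
      (by filter_upwards [self_mem_nhdsWithin] with z hz using hlip z x hz hx)
    simpa [abs_of_pos hx] using this
  · have := hlip x (x + y) hx (by linarith)
    simpa [abs_of_pos hy] using this

section
variable {ν : Measure ℝ}

lemma aestronglyMeasurable_of_continuousOn (h0 : ν (Iic 0) = 0) {f : ℝ → ℝ}
    (hf : ContinuousOn f (Ioi 0)) : AEStronglyMeasurable f ν := by
  rw [← Measure.restrict_eq_self_of_ae_mem (ae_pos_of_null_Iic h0)]
  exact hf.aestronglyMeasurable measurableSet_Ioi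

lemma SlopeBound.norm_ae_le {f : ℝ → ℝ} {C : ℝ} (hf : SlopeBound f C) (h0 : ν (Iic 0) = 0) :
    ∀ᵐ x ∂ν, ‖f x‖ ≤ C * x := (ae_pos_of_null_Iic h0).mono fun x hx => (hf x hx).1

lemma SlopeBound.integrable {f : ℝ → ℝ} {C : ℝ} (hf : SlopeBound f C)
    (hc : ContinuousOn f (Ioi 0)) (h0 : ν (Iic 0) = 0) (h1 : totalMass ν = 1) :
    Integrable f ν :=
  ((integrable_id_of_totalMass h0 (by rw [h1]; exact ENNReal.one_lt_top)).const_mul C).mono'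
    (aestronglyMeasurable_of_continuousOn h0 hc) (hf.norm_ae_le h0)

lemma integral_id_of_totalMass (h0 : ν (Iic 0) = 0) (h1 : totalMass ν = 1) : ∫ x, x ∂ν = 1 := by
  rw [integral_eq_lintegral_of_nonneg_ae ((ae_pos_of_null_Iic h0).mono fun x hx => hx.le)
    measurable_id'.aestronglyMeasurable]
  rw [totalMass] at h1
  rw [h1, ENNReal.toReal_one]

lemma SlopeBound.abs_integral_le {f : ℝ → ℝ} {C : ℝ} (hf : SlopeBound f C)
    (h0 : ν (Iic 0) = 0) (h1 : totalMass ν = 1) : |∫ x, f x ∂ν| ≤ C := by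
  have := norm_integral_le_of_norm_le ((integrable_id_of_totalMass h0
    (by rw [h1]; exact ENNReal.one_lt_top)).const_mul C) (hf.norm_ae_le h0)
  rwa [integral_const_mul, integral_id_of_totalMass h0 h1, mul_one] at this

lemma ae_prod_pos (h0 : ν (Iic 0) = 0) : ∀ᵐ p ∂(ν.prod ν), 0 < p.1 ∧ 0 < p.2 :=
  (Measure.quasiMeasurePreserving_fst.ae (ae_pos_of_null_Iic h0)).and
    (Measure.quasiMeasurePreserving_snd.ae (ae_pos_of_null_Iic h0))

lemma SlopeBound.integrable_increment {f : ℝ → ℝ} {C : ℝ} (hf : SlopeBound f C)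
    (hc : ContinuousOn f (Ioi 0)) (h0 : ν (Iic 0) = 0) (h1 : totalMass ν = 1) :
    Integrable (fun p : ℝ × ℝ => (f (p.1 + p.2) - f p.1 - f p.2) * (p.1 + p.2)) (ν.prod ν) := by
  have hid := integrable_id_of_totalMass h0 (by rw [h1]; exact ENNReal.one_lt_top)
  refine ((hid.mul_prod hid).const_mul (4 * C)).mono' ?_ ?_
  · rw [← Measure.restrict_eq_self_of_ae_mem (s := {p : ℝ × ℝ | 0 < p.1 ∧ 0 < p.2})
      (ae_prod_pos h0)]
    refine ContinuousOn.aestronglyMeasurable ?_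
      ((measurableSet_lt measurable_const measurable_fst).inter
        (measurableSet_lt measurable_const measurable_snd))
    refine ContinuousOn.mul (ContinuousOn.sub (ContinuousOn.sub ?_ ?_) ?_) (by fun_prop)
    · exact hc.comp (by fun_prop) fun p hp => mem_Ioi.2 (add_pos hp.1 hp.2)
    · exact hc.comp (by fun_prop) fun p hp => hp.1
    · exact hc.comp (by fun_prop) fun p hp => hp.2
  · filter_upwards [ae_prod_pos h0] with p hp using hf.increment hp.1 hp.2

variable [SFinite ν]

lemma SlopeBound.coagulation_eq {f : ℝ → ℝ} {C : ℝ} (hf : SlopeBound f C)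
    (hc : ContinuousOn f (Ioi 0)) (h0 : ν (Iic 0) = 0) (h1 : totalMass ν = 1) :
    coagulation f ν =
      1 / 2 * ∫ p, (f (p.1 + p.2) - f p.1 - f p.2) * (p.1 + p.2) ∂(ν.prod ν) := by
  rw [coagulation, integral_prod _ (hf.integrable_increment hc h0 h1)]

lemma SlopeBound.abs_coagulation_le {f : ℝ → ℝ} {C : ℝ} (hf : SlopeBound f C)
    (hc : ContinuousOn f (Ioi 0)) (h0 : ν (Iic 0) = 0) (h1 : totalMass ν = 1) :
    |coagulation f ν| ≤ 2 * C := by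
  have hid := integrable_id_of_totalMass h0 (by rw [h1]; exact ENNReal.one_lt_top)
  have := norm_integral_le_of_norm_le ((hid.mul_prod hid).const_mul (4 * C))
    (f := fun p : ℝ × ℝ => (f (p.1 + p.2) - f p.1 - f p.2) * (p.1 + p.2))
    ((ae_prod_pos h0).mono fun p hp => hf.increment hp.1 hp.2)
  rw [integral_const_mul, integral_prod_mul (fun x => x) (fun x => x),
    integral_id_of_totalMass h0 h1, Real.norm_eq_abs] at this
  rw [hf.coagulation_eq hc h0 h1, abs_mul, abs_of_pos (by norm_num : (0 : ℝ) < 1 / 2)]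
  linarith

lemma SlopeBound.coagulation_add {f g : ℝ → ℝ} {C D : ℝ} (hf : SlopeBound f C)
    (hg : SlopeBound g D) (hfc : ContinuousOn f (Ioi 0)) (hgc : ContinuousOn g (Ioi 0))
    (h0 : ν (Iic 0) = 0) (h1 : totalMass ν = 1) :
    coagulation (fun x => f x + g x) ν = coagulation f ν + coagulation g ν := by
  rw [hf.coagulation_eq hfc h0 h1, hg.coagulation_eq hgc h0 h1,
    (hf.add hg).coagulation_eq (hfc.add hgc) h0 h1, ← mul_add, ← integral_add
    (hf.integrable_increment hfc h0 h1) (hg.integrable_increment hgc h0 h1)]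
  congr 2
  ext p
  ring

end

lemma coagulation_const_mul {ν : Measure ℝ} (f : ℝ → ℝ) (a : ℝ) :
    coagulation (fun x => a * f x) ν = a * coagulation f ν := by
  simp only [coagulation]
  rw [mul_left_comm, ← integral_const_mul]
  simp_rw [← integral_const_mul]
  congr 2
  ext x
  congr 1
  ext y
  ring

/-- The weak form of the coagulation equation for one function `f`, together with the regularity
that makes it linear in `f`. -/
structure WeakIdentity (ν : ℝ → Measure ℝ) (f : ℝ → ℝ) : Prop where
  cont : ContinuousOn f (Ioi 0)
  slope : ∃ C, SlopeBound f C
  coag_int : ∀ t, 0 ≤ t → IntervalIntegrable (fun τ => coagulation f (ν τ)) volume 0 t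
  weak : ∀ t, 0 ≤ t →
    ∫ x, f x ∂(ν t) = ∫ x, f x ∂(ν 0) + ∫ τ in (0 : ℝ)..t, coagulation f (ν τ)

lemma WeakIdentity.add {ν : ℝ → Measure ℝ} [∀ t, SFinite (ν t)] (h0 : ∀ t, ν t (Iic 0) = 0)
    (h1 : ∀ t, totalMass (ν t) = 1) {f g : ℝ → ℝ} (hf : WeakIdentity ν f) (hg : WeakIdentity ν g) :
    WeakIdentity ν fun x => f x + g x := by
  obtain ⟨C, hC⟩ := hf.slope
  obtain ⟨D, hD⟩ := hg.slope
  have hcoag : (fun τ => coagulation (fun x => f x + g x) (ν τ)) =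
      fun τ => coagulation f (ν τ) + coagulation g (ν τ) :=
    funext fun τ => hC.coagulation_add hD hf.cont hg.cont (h0 τ) (h1 τ)
  refine ⟨hf.cont.add hg.cont, ⟨_, hC.add hD⟩, fun t ht => ?_, fun t ht => ?_⟩
  · rw [hcoag]
    exact (hf.coag_int t ht).add (hg.coag_int t ht)
  · rw [hcoag, intervalIntegral.integral_add (hf.coag_int t ht) (hg.coag_int t ht),
      integral_add (hC.integrable hf.cont (h0 t) (h1 t)) (hD.integrable hg.cont (h0 t) (h1 t)),
      integral_add (hC.integrable hf.cont (h0 0) (h1 0)) (hD.integrable hg.cont (h0 0) (h1 0)),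
      hf.weak t ht, hg.weak t ht]
    ring

lemma WeakIdentity.const_mul {ν : ℝ → Measure ℝ} {f : ℝ → ℝ} (hf : WeakIdentity ν f) (a : ℝ) :
    WeakIdentity ν fun x => a * f x := by
  obtain ⟨C, hC⟩ := hf.slope
  refine ⟨continuousOn_const.mul hf.cont, ⟨_, hC.const_mul a⟩, fun t ht => ?_, fun t ht => ?_⟩
  · simp_rw [coagulation_const_mul]
    exact (hf.coag_int t ht).const_mul a
  · simp_rw [coagulation_const_mul]
    rw [integral_const_mul, integral_const_mul, intervalIntegral.integral_const_mul, hf.weak t ht]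
    ring

lemma weakIdentity_zero {ν : ℝ → Measure ℝ} : WeakIdentity ν fun _ => 0 :=
  ⟨continuousOn_const, ⟨0, fun x hx => by simp⟩, fun t ht => by simp [coagulation],
    fun t ht => by simp [coagulation]⟩

/-- The weak form passes to limits with respect to the Lipschitz norm. -/
lemma WeakIdentity.of_tendsto {ν : ℝ → Measure ℝ} [∀ t, SFinite (ν t)]
    (h0 : ∀ t, ν t (Iic 0) = 0) (h1 : ∀ t, totalMass (ν t) = 1) {f : ℝ → ℝ} {C : ℝ} (hf : SlopeBound f C)
    (hc : ContinuousOn f (Ioi 0))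
    (happ : ∀ ε, 0 < ε → ∃ g, WeakIdentity ν g ∧ SlopeBound (fun x => f x + -1 * g x) ε) {t : ℝ}
    (ht : 0 ≤ t) :
    ∫ x, f x ∂(ν t) = ∫ x, f x ∂(ν 0) + ∫ τ in (0 : ℝ)..t, coagulation f (ν τ) := by
  choose g hg hgf using fun n : ℕ => happ (1 / ((n : ℝ) + 1)) (by positivity)
  have hε : Tendsto (fun n : ℕ => 1 / ((n : ℝ) + 1)) atTop (𝓝 0) :=
    tendsto_one_div_add_atTop_nhds_zero_nat
  have hgc : ∀ n, ContinuousOn (fun x => f x + -1 * g n x) (Ioi 0) := fun n =>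
    hc.add (continuousOn_const.mul (hg n).cont)
  have hint : ∀ s, Tendsto (fun n => ∫ x, g n x ∂(ν s)) atTop (𝓝 (∫ x, f x ∂(ν s))) := by
    intro s
    rw [tendsto_iff_norm_sub_tendsto_zero]
    refine squeeze_zero (fun _ => norm_nonneg _) (fun n => ?_) hε
    obtain ⟨D, hD⟩ := (hg n).slope
    have := (hgf n).abs_integral_le (h0 s) (h1 s)
    rw [integral_add (hf.integrable hc (h0 s) (h1 s))
      ((hD.integrable (hg n).cont (h0 s) (h1 s)).const_mul _), integral_const_mul] at this
    rw [Real.norm_eq_abs, abs_sub_comm]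
    convert this using 2
    ring
  have hdiff : ∀ n s, |coagulation f (ν s) - coagulation (g n) (ν s)| ≤
      2 * (1 / ((n : ℝ) + 1)) := by
    intro n s
    obtain ⟨D, hD⟩ := (hg n).slope
    have := (hgf n).abs_coagulation_le (hgc n) (h0 s) (h1 s)
    rw [hf.coagulation_add (hD.const_mul (-1)) hc (continuousOn_const.mul (hg n).cont) (h0 s)
      (h1 s), coagulation_const_mul] at this
    convert this using 2
    ring
  have hcoag : Tendsto (fun n => ∫ τ in (0 : ℝ)..t, coagulation (g n) (ν τ)) atTop
      (𝓝 (∫ τ in (0 : ℝ)..t, coagulation f (ν τ))) := by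
    refine intervalIntegral.tendsto_integral_filter_of_dominated_convergence
      (fun _ => 2 * C + 2) (Eventually.of_forall fun n => ?_) (Eventually.of_forall fun n => ?_)
      intervalIntegrable_const (ae_of_all _ fun τ _ => ?_)
    · rw [uIoc_of_le ht]
      exact ((hg n).coag_int t ht).1.aestronglyMeasurable
    · refine ae_of_all _ fun τ _ => ?_
      have h3 := hdiff n τ
      have h4 := hf.abs_coagulation_le hc (h0 τ) (h1 τ)
      have h5 : 1 / ((n : ℝ) + 1) ≤ 1 := by
        rw [div_le_one (by positivity)]; linarith [n.cast_nonneg (α := ℝ)]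
      have h6 := abs_sub_abs_le_abs_sub (coagulation (g n) (ν τ)) (coagulation f (ν τ))
      rw [abs_sub_comm] at h6
      rw [Real.norm_eq_abs]
      linarith
    · rw [tendsto_iff_norm_sub_tendsto_zero]
      refine squeeze_zero (fun _ => norm_nonneg _) (fun n => ?_) (by simpa only [mul_zero] using hε.const_mul 2)
      rw [Real.norm_eq_abs, abs_sub_comm]
      exact hdiff n τ
  refine tendsto_nhds_unique (hint t) ?_
  simp_rw [fun n => (hg n).weak t ht]
  exact (hint 0).add hcoag

/-! ### Approximation of test functions by exponentials -/

lemma IsTestFunction.hasDerivAt {f : ℝ → ℝ} (hf : IsTestFunction f) {x : ℝ} (hx : 0 < x) :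
    HasDerivAt f (deriv f x) x :=
  ((hf.contDiffOn.differentiableOn one_ne_zero).differentiableAt (Ioi_mem_nhds hx)).hasDerivAt

lemma IsTestFunction.exists_slopeBound {f : ℝ → ℝ} (hf : IsTestFunction f) :
    ∃ C, SlopeBound f C := by
  obtain ⟨C, α, hα, hC⟩ := hf.deriv_decay
  have hC0 : 0 ≤ C := by
    have := (abs_nonneg _).trans (hC 1 one_pos)
    exact nonneg_of_mul_nonneg_left this (Real.exp_pos _)
  refine ⟨C, slopeBound_of_deriv (fun x hx => hf.hasDerivAt hx) (fun x hx => (hC x hx).trans ?_)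
    hf.tendsto_zero⟩
  refine mul_le_of_le_one_right hC0 (Real.exp_le_one_iff.2 ?_)
  nlinarith

lemma tendsto_neg_log_nhdsGT_zero : Tendsto (fun u => -Real.log u) (𝓝[>] 0) atTop :=
  tendsto_neg_atBot_atTop.comp Real.tendsto_log_nhdsGT_zero

lemma tendsto_neg_log_nhdsLT_one : Tendsto (fun u => -Real.log u) (𝓝[<] 1) (𝓝[>] 0) := by
  refine tendsto_nhdsWithin_iff.2 ⟨?_, ?_⟩
  · have : Tendsto (fun u => -Real.log u) (𝓝 1) (𝓝 (-Real.log 1)) :=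
      (Real.continuousAt_log one_ne_zero).neg.tendsto
    rw [Real.log_one, neg_zero] at this
    exact this.mono_left nhdsWithin_le_nhds
  · filter_upwards [Ioo_mem_nhdsLT (zero_lt_one' ℝ)] with u hu
    exact mem_Ioi.2 (neg_pos.2 (Real.log_neg hu.1 hu.2))

/-- Test functions are approximated in the Lipschitz norm by combinations of the functions
`1 - e ^ (-k x)`: the derivative is a continuous function of `e ^ (-x)` on `[0, 1]` vanishing at
`0`, and hence a uniform limit of polynomials without constant term. -/
lemma IsTestFunction.exists_approx {f : ℝ → ℝ} (hf : IsTestFunction f) {ε : ℝ} (hε : 0 < ε) :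
    ∃ (N : ℕ) (a : ℕ → ℝ), SlopeBound (fun x => f x +
      -1 * ∑ k ∈ Finset.range N, a k * (1 - Real.exp (-(((k : ℝ) + 1) * x)))) ε := by
  obtain ⟨l, hl⟩ := hf.deriv_limit_zero
  obtain ⟨C, α, hα, hC⟩ := hf.deriv_decay
  have htop : Tendsto (deriv f) atTop (𝓝 0) := by
    have h1 : Tendsto (fun x => C * Real.exp (-α * x)) atTop (𝓝 (C * 0)) := by
      refine Tendsto.const_mul C (Real.tendsto_exp_atBot.comp ?_)
      exact tendsto_id.const_mul_atTop_of_neg (neg_lt_zero.2 hα)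
    rw [mul_zero] at h1
    exact squeeze_zero_norm' ((eventually_gt_atTop 0).mono hC) h1
  set h : ℝ → ℝ := fun u => deriv f (-Real.log u) with hh
  have hcont : ContinuousOn h (Ioo 0 1) := by
    refine (hf.contDiffOn.continuousOn_deriv_of_isOpen isOpen_Ioi le_rfl).comp
      (Real.continuousOn_log.neg.mono fun u hu => hu.1.ne') fun u hu => ?_
    exact mem_Ioi.2 (neg_pos.2 (Real.log_neg hu.1 hu.2))
  have hlim0 : Tendsto h (𝓝[>] 0) (𝓝 0) := htop.comp tendsto_neg_log_nhdsGT_zero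
  have hlim1 : Tendsto h (𝓝[<] 1) (𝓝 l) := hl.comp tendsto_neg_log_nhdsLT_one
  set g := extendFrom (Ioo 0 1) h with hg
  have hgc : ContinuousOn g (Icc 0 1) :=
    continuousOn_Icc_extendFrom_Ioo hcont hlim0 hlim1
  have hg0 : g 0 = 0 := eq_lim_at_left_extendFrom_Ioo one_pos hlim0
  have hgh : ∀ u ∈ Ioo (0 : ℝ) 1, g u = h u := fun u hu =>
    extendFrom_extends hcont u hu
  obtain ⟨p, hp⟩ := exists_polynomial_near_of_continuousOn 0 1 g hgc (ε / 2) (by linarith)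
  set q := p.divX
  have hpq : ∀ u, p.eval u = u * q.eval u + p.eval 0 := by
    intro u
    conv_lhs => rw [← p.divX_mul_X_add]
    simp only [Polynomial.eval_add, Polynomial.eval_mul, Polynomial.eval_X, Polynomial.eval_C,
      Polynomial.coeff_zero_eq_eval_zero]
    ring
  -- dropping the constant term of `p` costs at most another `ε / 2`
  have hp0 : |p.eval 0| < ε / 2 := by
    simpa [hg0] using hp 0 ⟨le_rfl, zero_le_one⟩
  refine ⟨q.natDegree + 1, fun k => q.coeff k / (k + 1),
    slopeBound_of_deriv (f' := fun x => deriv f x + -1 * (Real.exp (-x) * q.eval (Real.exp (-x))))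
      (fun x hx => ?_) (fun x hx => ?_) ?_⟩
  · refine (hf.hasDerivAt hx).add (HasDerivAt.const_mul (-1) ?_)
    have hk : ∀ k ∈ Finset.range (q.natDegree + 1), HasDerivAt
        (fun x => q.coeff k / ((k : ℝ) + 1) * (1 - Real.exp (-(((k : ℝ) + 1) * x))))
        (Real.exp (-x) * (q.coeff k * Real.exp (-x) ^ k)) x := by
      intro k _
      have h1 : HasDerivAt (fun x => 1 - Real.exp (-(((k : ℝ) + 1) * x)))
          (-(Real.exp (-(((k : ℝ) + 1) * x)) * -(((k : ℝ) + 1) * 1))) x :=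
        (((hasDerivAt_id x).const_mul ((k : ℝ) + 1)).neg.exp).const_sub 1
      refine (h1.const_mul (q.coeff k / ((k : ℝ) + 1))).congr_deriv ?_
      have h2 : Real.exp (-(((k : ℝ) + 1) * x)) = Real.exp (-x) * Real.exp (-x) ^ k := by
        rw [← Real.exp_nat_mul, ← Real.exp_add]; congr 1; ring
      rw [h2]
      field_simp
    rw [Polynomial.eval_eq_sum_range, Finset.mul_sum]
    exact HasDerivAt.fun_sum hk
  · set u := Real.exp (-x) with hu
    have hu01 : u ∈ Ioo (0 : ℝ) 1 := ⟨Real.exp_pos _, Real.exp_lt_one_iff.2 (by linarith)⟩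
    have h1 := hp u (Ioo_subset_Icc_self hu01)
    rw [hgh u hu01] at h1
    simp only [hh, hu, Real.log_exp, neg_neg] at h1
    rw [← hu, hpq] at h1
    have : deriv f x + -1 * (u * q.eval u) =
        -(u * q.eval u + p.eval 0 - deriv f x) + p.eval 0 := by ring
    rw [this]
    refine (abs_add_le _ _).trans ?_
    rw [abs_neg]
    linarith
  · have hc : Continuous fun x => -1 * ∑ k ∈ Finset.range (q.natDegree + 1),
        q.coeff k / ((k : ℝ) + 1) * (1 - Real.exp (-(((k : ℝ) + 1) * x))) := by fun_prop
    have h1 := hf.tendsto_zero.add ((hc.tendsto 0).mono_left (nhdsWithin_le_nhds (s := Ioi 0)))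
    simpa using h1

/-- A family of measures of unit mass satisfying the weak form for all functions `1 - e ^ (-k x)`
satisfies it for all test functions. -/
lemma weak_of_exp {ν : ℝ → Measure ℝ} [∀ t, SFinite (ν t)] (h0 : ∀ t, ν t (Iic 0) = 0)
    (h1 : ∀ t, totalMass (ν t) = 1)
    (hexp : ∀ k : ℕ, WeakIdentity ν fun x => 1 - Real.exp (-(((k : ℝ) + 1) * x)))
    {f : ℝ → ℝ} (hf : IsTestFunction f) {t : ℝ} (ht : 0 ≤ t) :
    ∫ x, f x ∂(ν t) = ∫ x, f x ∂(ν 0) + ∫ τ in (0 : ℝ)..t, coagulation f (ν τ) := by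
  obtain ⟨C, hC⟩ := hf.exists_slopeBound
  refine WeakIdentity.of_tendsto h0 h1 hC hf.contDiffOn.continuousOn (fun ε hε => ?_) ht
  obtain ⟨N, a, ha⟩ := hf.exists_approx hε
  refine ⟨_, ?_, ha⟩
  clear ha
  induction N with
  | zero => simpa using weakIdentity_zero
  | succ N ih =>
    simp_rw [Finset.sum_range_succ]
    exact ih.add h0 h1 ((hexp N).const_mul (a N))

/-! ### The self-similar solution -/

instance (ρ t : ℝ) : SFinite (selfSimilar ρ t) := by
  unfold selfSimilar; infer_instance

lemma selfSimilar_null (ρ t : ℝ) : selfSimilar ρ t (Iic 0) = 0 := by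
  have h : (volume.restrict (Ioi (0 : ℝ))) (Iic 0) = 0 := by
    rw [Measure.restrict_apply measurableSet_Iic]
    rw [Iic_inter_Ioi, Ioc_self, measure_empty]
  exact withDensity_absolutelyContinuous _ _ h

/-- The mass distribution of the self-similar solution is a dilation of the profile. -/
lemma massMeasure_selfSimilar {ρ : ℝ} (h0 : 0 < ρ) (h1 : ρ ≤ 1) (t : ℝ) :
    massMeasure (selfSimilar ρ t) = rescale (profileMeasure ρ) (Real.exp (-t / beta ρ)) := by
  set c := Real.exp (-t / beta ρ) with hc
  have hc0 : 0 < c := Real.exp_pos _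
  have hcc : Real.exp (-2 * t / beta ρ) = c * c := by
    rw [hc, ← Real.exp_add]; congr 1; ring
  have hd : AEMeasurable (fun x => ENNReal.ofReal
      (Real.exp (-2 * t / beta ρ) * numberProfile ρ (c * x))) (volume.restrict (Ioi 0)) := by
    refine (AEMeasurable.const_mul (ContinuousOn.aemeasurable ?_ measurableSet_Ioi) _).ennreal_ofReal
    exact (continuousOn_numberProfile h0 h1).comp (by fun_prop)
      fun x hx => mem_Ioi.2 (mul_pos hc0 hx)
  rw [massMeasure, selfSimilar, ← withDensity_mul₀ hd (by fun_prop)]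
  ext A hA
  set Q : ℝ → ℝ≥0∞ := fun y => ENNReal.ofReal (y * numberProfile ρ y) with hQ
  set S : Set ℝ := (fun x => x / c) ⁻¹' A ∩ Ioi 0 with hS
  have hSm : MeasurableSet S := (hA.preimage (by fun_prop)).inter measurableSet_Ioi
  have hpre : (fun x => c * x) ⁻¹' S = A ∩ Ioi 0 := by
    ext x
    simp [hS, mul_div_cancel_left₀ x hc0.ne', hc0]
  have hR : rescale (profileMeasure ρ) c A = ∫⁻ y in S, Q y := by
    rw [rescale, Measure.map_apply (by fun_prop) hA, profileMeasure,
      withDensity_apply _ (hA.preimage (by fun_prop)),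
      Measure.restrict_restrict (hA.preimage (by fun_prop))]
  have hL : ∫⁻ x in A ∩ Ioi 0, Q (c * x) = ENNReal.ofReal c⁻¹ * ∫⁻ y in S, Q y := by
    have he := measurableEmbedding_mulLeft₀ (G₀ := ℝ) hc0.ne'
    rw [← hpre, ← he.lintegral_map, ← Measure.restrict_map he.measurable hSm,
      Real.map_volume_mul_left hc0.ne', abs_of_pos (inv_pos.2 hc0), Measure.restrict_smul,
      lintegral_smul_measure, smul_eq_mul]
  rw [withDensity_apply _ hA, Measure.restrict_restrict hA, hR]
  calc _ = ∫⁻ x in A ∩ Ioi 0, ENNReal.ofReal c * Q (c * x) := by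
        refine setLIntegral_congr_fun (hA.inter measurableSet_Ioi) fun x hx => ?_
        have hx0 : (0 : ℝ) < x := hx.2
        have hn := numberProfile_nonneg h0 h1 (mul_pos hc0 hx0)
        simp only [Pi.mul_apply, hQ]
        rw [hcc, ← ENNReal.ofReal_mul hc0.le, ← ENNReal.ofReal_mul (by positivity)]
        congr 1
        ring
    _ = _ := by
        rw [lintegral_const_mul' _ _ ENNReal.ofReal_ne_top, hL, ← mul_assoc,
          ← ENNReal.ofReal_mul hc0.le, mul_inv_cancel₀ hc0.ne', ENNReal.ofReal_one, one_mul]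

lemma totalMass_selfSimilar {ρ : ℝ} (h0 : 0 < ρ) (h1 : ρ ≤ 1) (t : ℝ) :
    totalMass (selfSimilar ρ t) = 1 := by
  have hp := isProbabilityMeasure_profileMeasure h0 h1
  have h : massMeasure (selfSimilar ρ t) univ = totalMass (selfSimilar ρ t) := by
    rw [massMeasure, withDensity_apply _ MeasurableSet.univ, Measure.restrict_univ, totalMass]
  rw [← h, massMeasure_selfSimilar h0 h1, rescale, Measure.map_apply (by fun_prop)
    MeasurableSet.univ, preimage_univ, measure_univ]

lemma massDist_selfSimilar {ρ : ℝ} (h0 : 0 < ρ) (h1 : ρ ≤ 1) (t : ℝ) {x : ℝ} (hx : 0 ≤ x) :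
    massDist (selfSimilar ρ t) x = massProfile ρ (Real.exp (-t / beta ρ) * x) := by
  rw [massDist_eq (selfSimilar_null ρ t), massMeasure_selfSimilar h0 h1,
    rescale_Iic (Real.exp_pos _), massProfile_eq h0 h1 (by positivity)]

/-- Finiteness on compact sets follows from Markov's inequality. -/
lemma isRadonOnPos_of_totalMass {ν : Measure ℝ} (h0 : ν (Iic 0) = 0) (h1 : totalMass ν < ∞) :
    IsRadonOnPos ν := by
  refine ⟨h0, fun B hB hB0 => ?_⟩
  rcases B.eq_empty_or_nonempty with rfl | hne
  · simp
  obtain ⟨a, ha, hamin⟩ := hB.exists_isLeast hne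
  have ha0 : 0 < a := hB0 ha
  have hsub : B ⊆ {x | ENNReal.ofReal a ≤ ENNReal.ofReal x} := fun x hx =>
    ENNReal.ofReal_le_ofReal (hamin hx)
  have hm := (mul_meas_ge_le_lintegral (μ := ν) (f := fun x => ENNReal.ofReal x) (by fun_prop)
    (ENNReal.ofReal a)).trans_lt h1
  refine (measure_mono hsub).trans_lt ?_
  by_contra! htop
  rw [top_le_iff.1 htop, ENNReal.mul_top (by simpa using ha0)] at hm
  exact lt_irrefl _ hm

/-- The density is modified outside `(0, ∞)` so as to be jointly measurable in time and size. -/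
lemma measurable_selfSimilar {ρ : ℝ} (h0 : 0 < ρ) (h1 : ρ ≤ 1) {B : Set ℝ} (hB : MeasurableSet B) :
    Measurable fun t => selfSimilar ρ t B := by
  classical
  set n : ℝ → ℝ := (Ioi (0 : ℝ)).piecewise (numberProfile ρ) 0 with hn
  have hnm : Measurable n := (continuousOn_numberProfile h0 h1).measurable_piecewise
    continuousOn_const measurableSet_Ioi
  have heq : ∀ t, selfSimilar ρ t B = ∫⁻ x in B ∩ Ioi 0,
      ENNReal.ofReal (Real.exp (-2 * t / beta ρ) * n (Real.exp (-t / beta ρ) * x)) := by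
    intro t
    rw [selfSimilar, withDensity_apply _ hB, Measure.restrict_restrict hB]
    refine setLIntegral_congr_fun (hB.inter measurableSet_Ioi) fun x hx => ?_
    have : Real.exp (-t / beta ρ) * x ∈ Ioi (0 : ℝ) := mul_pos (Real.exp_pos _) hx.2
    simp only [hn]
    rw [piecewise_eq_of_mem _ _ _ this]
  simp_rw [heq]
  refine Measurable.lintegral_prod_right' (f := fun p : ℝ × ℝ => ENNReal.ofReal
    (Real.exp (-2 * p.1 / beta ρ) * n (Real.exp (-p.1 / beta ρ) * p.2))) ?_
  exact ((by fun_prop : Measurable fun p : ℝ × ℝ => Real.exp (-2 * p.1 / beta ρ)).mul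
    (hnm.comp (by fun_prop))).ennreal_ofReal

/-- The differential equation for the Laplace exponent that expresses self-similarity. -/
lemma mul_lapTr_profile_sub {ρ : ℝ} (h0 : 0 < ρ) (h1 : ρ ≤ 1) {u : ℝ} (hu : 0 < u) :
    u * lapTr (profileMeasure ρ) u - lapExp (profileMeasure ρ) u =
      -(beta ρ * (lapExp (profileMeasure ρ) u * (1 - lapTr (profileMeasure ρ) u))) := by
  obtain ⟨w, hw, rfl⟩ := exists_pos_add_rpow_eq h0 hu
  have hpos : 0 < 1 + (1 + ρ) * w ^ ρ := by positivity
  rw [lapExp_profileMeasure_add_rpow h0 h1 hw, lapTr_profileMeasure h0 h1,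
    laplace_mul_numberProfile_eq h0 h1 hw, Real.rpow_add hw, Real.rpow_one, beta]
  field_simp
  ring

lemma integral_mul_one_sub_exp {ν : Measure ℝ} (h0 : ν (Iic 0) = 0) (h1 : totalMass ν = 1) {s : ℝ}
    (hs : 0 < s) :
    ∫ x, x * (1 - Real.exp (-(s * x))) ∂ν = 1 - lapTr (massMeasure ν) s := by
  have hfin : totalMass ν < ∞ := by rw [h1]; exact ENNReal.one_lt_top
  have h2 := integral_sub (integrable_id_of_totalMass h0 hfin) (integrable_mul_one_sub_exp h0 hfin hs)
  rw [integral_id_of_totalMass h0 h1] at h2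
  have h3 : lapTr (massMeasure ν) s = ∫ x, (x - x * (1 - Real.exp (-(s * x)))) ∂ν := by
    rw [lapTr_massMeasure h0]
    congr 1
    ext x
    ring
  rw [h3, h2]
  ring

/-- The integrals and the coagulation functional of `1 - e^{-sx}` are explicit in terms of the
Laplace exponent of the profile, and the weak form becomes `mul_lapTr_profile_sub`. -/
lemma weakIdentity_exp_selfSimilar {ρ : ℝ} (h0 : 0 < ρ) (h1 : ρ ≤ 1) {s : ℝ} (hs : 0 < s) :
    WeakIdentity (selfSimilar ρ) fun x => 1 - Real.exp (-(s * x)) := by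
  have hβ := beta_pos h0
  have hp := isProbabilityMeasure_profileMeasure h0 h1
  have hm := profileMeasure_null ρ
  have hnull := selfSimilar_null ρ
  have hmass := totalMass_selfSimilar h0 h1
  have hfin : ∀ t, totalMass (selfSimilar ρ t) < ∞ := fun t => by
    rw [hmass t]; exact ENNReal.one_lt_top
  set c : ℝ → ℝ := fun t => Real.exp (-t / beta ρ) with hc
  have hc0 : ∀ t, 0 < c t := fun t => Real.exp_pos _
  set Φ := lapExp (profileMeasure ρ) with hΦ
  set Ψ := lapTr (profileMeasure ρ) with hΨ
  have hint : ∀ t, ∫ x, (1 - Real.exp (-(s * x))) ∂(selfSimilar ρ t) = c t * Φ (s / c t) := by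
    intro t
    rw [← lapExp_massMeasure (hnull t), massMeasure_selfSimilar h0 h1, lapExp_rescale]
  have hcoag : ∀ t, coagulation (fun x => 1 - Real.exp (-(s * x))) (selfSimilar ρ t) =
      -(c t * Φ (s / c t) * (1 - Ψ (s / c t))) := by
    intro t
    rw [coagulation_exp (hnull t) (hfin t) hs, hint, integral_mul_one_sub_exp (hnull t) (hmass t) hs,
      massMeasure_selfSimilar h0 h1, lapTr_rescale]
  have hcc : Continuous c := by simp only [hc]; fun_prop
  have hu : Continuous fun t => s / c t := continuous_const.div hcc fun t => (hc0 t).ne'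
  have hu0 : ∀ t, 0 < s / c t := fun t => div_pos hs (hc0 t)
  have hcont : Continuous fun t => -(c t * Φ (s / c t) * (1 - Ψ (s / c t))) :=
    ((hcc.mul ((continuousOn_lapExp hm).comp_continuous hu fun t => (hu0 t).le)).mul
      (continuous_const.sub ((continuousOn_lapTr hm).comp_continuous hu fun t => (hu0 t).le))).neg
  have hderiv : ∀ t, HasDerivAt (fun t => c t * Φ (s / c t))
      (-(c t * Φ (s / c t) * (1 - Ψ (s / c t)))) t := by
    intro t
    have hcd : HasDerivAt c (c t * (-1 / beta ρ)) t :=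
      (((hasDerivAt_id t).neg).div_const (beta ρ)).exp
    have hud : HasDerivAt (fun t => s / c t) (s / c t / beta ρ) t := by
      refine ((hasDerivAt_const t s).div hcd (hc0 t).ne').congr_deriv ?_
      have := hc0 t
      field_simp
      ring
    refine (hcd.mul ((hasDerivAt_lapExp hm (hu0 t)).comp t hud)).congr_deriv ?_
    have key := mul_lapTr_profile_sub h0 h1 (hu0 t)
    rw [← hΦ, ← hΨ] at key
    calc _ = c t / beta ρ * (s / c t * Ψ (s / c t) - Φ (s / c t)) := by
          simp only [Function.comp_apply]
          ring
      _ = _ := by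
          rw [key]
          field_simp
  refine ⟨Continuous.continuousOn (by fun_prop), ⟨s, ?_⟩, fun t ht => ?_, fun t ht => ?_⟩
  · refine slopeBound_of_deriv (f' := fun x => s * Real.exp (-(s * x))) (fun x hx => ?_)
      (fun x hx => ?_) (isTestFunction_exp hs).tendsto_zero
    · refine ((((hasDerivAt_id x).const_mul s).neg.exp).const_sub 1).congr_deriv ?_
      simp only [Pi.neg_apply, id]
      ring
    · rw [abs_of_pos (by positivity)]
      refine mul_le_of_le_one_right hs.le (Real.exp_le_one_iff.2 ?_)
      nlinarith
  · simp_rw [hcoag]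
    exact hcont.intervalIntegrable _ _
  · simp_rw [hcoag]
    rw [hint, hint, intervalIntegral.integral_eq_sub_of_hasDerivAt (fun τ _ => hderiv τ)
      (hcont.intervalIntegrable _ _)]
    ring

theorem isSolution_selfSimilar {ρ : ℝ} (h0 : 0 < ρ) (h1 : ρ ≤ 1) :
    IsSolution (selfSimilar ρ) := by
  have hnull := selfSimilar_null ρ
  have hmass := totalMass_selfSimilar h0 h1
  have hfin : ∀ t, totalMass (selfSimilar ρ t) < ∞ := fun t => by
    rw [hmass t]; exact ENNReal.one_lt_top
  refine ⟨fun t _ => isRadonOnPos_of_totalMass (hnull t) (hfin t), hfin 0, fun B hB _ => ?_,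
    fun t _ => ?_, fun f hf t _ => ?_, fun f hf t ht => ?_⟩
  · exact (measurable_selfSimilar h0 h1 hB.measurableSet).comp measurable_subtype_coe
  · simp [hmass]
  · obtain ⟨C, hC⟩ := hf.exists_slopeBound
    exact hC.integrable hf.contDiffOn.continuousOn (hnull t) (hmass t)
  · exact weak_of_exp hnull hmass
      (fun k => weakIdentity_exp_selfSimilar h0 h1 (by positivity)) hf ht

end Smoluchowski

theorem mainTheorem2 :
    (∀ ν : ℝ → Measure ℝ, Smoluchowski.IsSolution ν → Smoluchowski.totalMass (ν 0) = 1 →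
      -- a nontrivial scaling limit forces regular variation of the initial second moment
      (∀ (scale : ℝ → ℝ) (F : ℝ → ℝ), Tendsto scale atTop atTop →
        Smoluchowski.IsNontrivialDistribution F →
        (∀ x : ℝ, 0 < x → ContinuousAt F x →
          Tendsto (fun t => Smoluchowski.massDist (ν t) (scale t * x)) atTop (𝓝 (F x))) →
        ∃ (ρ : ℝ) (L : ℝ → ℝ), 0 < ρ ∧ ρ ≤ 1 ∧ Smoluchowski.SlowlyVarying L ∧
          Smoluchowski.truncSecondMoment (ν 0) ~[atTop] fun x => x ^ (1 - ρ) * L x) ∧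
      -- regular variation of the initial second moment implies convergence to the profile
      (∀ (ρ : ℝ) (L : ℝ → ℝ), 0 < ρ → ρ ≤ 1 → Smoluchowski.SlowlyVarying L →
        (Smoluchowski.truncSecondMoment (ν 0) ~[atTop] fun x => x ^ (1 - ρ) * L x) →
        ∃ scale : ℝ → ℝ, StrictMonoOn scale (Ici 0) ∧ (∀ t : ℝ, 0 < t → 0 < scale t) ∧
          Tendsto scale atTop atTop ∧
          ∀ x : ℝ, 0 ≤ x →
            Tendsto (fun t => Smoluchowski.massDist (ν t) (scale t * x)) atTop
              (𝓝 (Smoluchowski.massProfile ρ x)))) ∧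
    -- the profile is the mass distribution of a self-similar solution
    (∀ ρ : ℝ, 0 < ρ → ρ ≤ 1 →
      (∀ x : ℝ, 0 ≤ x → Summable fun k : ℕ => Smoluchowski.massTerm ρ x (k + 1)) ∧
      (∀ x : ℝ, 0 < x → Summable fun k : ℕ => Smoluchowski.numberTerm ρ x (k + 1)) ∧
      (∀ x : ℝ, 0 < x → 0 ≤ Smoluchowski.numberProfile ρ x) ∧
      Smoluchowski.IsSolution (Smoluchowski.selfSimilar ρ) ∧
      (∀ t : ℝ, 0 ≤ t → Smoluchowski.totalMass (Smoluchowski.selfSimilar ρ t) = 1 ∧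
        ∀ x : ℝ, 0 ≤ x → Smoluchowski.massDist (Smoluchowski.selfSimilar ρ t) x =
          Smoluchowski.massProfile ρ (Real.exp (-t / Smoluchowski.beta ρ) * x)) ∧
      -- implicit description through the Laplace transform
      (∀ s : ℝ, 0 ≤ s → 0 ≤ Smoluchowski.phiProfile ρ s ∧
        s = Smoluchowski.phiProfile ρ s + Smoluchowski.phiProfile ρ s ^ (1 + ρ)) ∧
      (∀ s : ℝ, 0 < s → HasDerivAt (Smoluchowski.phiProfile ρ)
        (∫ x in Ioi 0, Real.exp (-s * x) * (x * Smoluchowski.numberProfile ρ x)) s) ∧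
      -- relation to the maximally skewed stable density
      (∀ x : ℝ, 0 < x → x * Smoluchowski.numberProfile ρ x =
        x ^ (Smoluchowski.beta ρ - 1) *
          Smoluchowski.stableDensity (1 + ρ) (1 - ρ) (x ^ Smoluchowski.beta ρ))) := by
  refine ⟨fun ν hν hmass => ⟨fun scale F hscale hF hconv => ?_, fun ρ L h0 h1 hL hequiv => ?_⟩,
    fun ρ h0 h1 => ?_⟩
  · exact hν.exists_isEquivalent hmass hscale hF hconv
  · have := Smoluchowski.isProbabilityMeasure_profileMeasure h0 h1
    obtain ⟨scale, h2, h3, h4, h5⟩ := hν.exists_scale hmass h0 h1 hL hequiv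
      (Smoluchowski.profileMeasure_null ρ) (Smoluchowski.profileMeasure_singleton ρ)
      (fun w hw => Smoluchowski.lapExp_profileMeasure_add_rpow h0 h1 hw)
    refine ⟨scale, h2, h3, h4, fun x hx => ?_⟩
    rw [Smoluchowski.massProfile_eq h0 h1 hx]
    exact h5 x
  · have hp := Smoluchowski.isProbabilityMeasure_profileMeasure h0 h1
    have hm := Smoluchowski.profileMeasure_null ρ
    refine ⟨fun x hx => (Smoluchowski.summable_massTerm h0 h1 hx).of_abs,
      fun x hx => Smoluchowski.summable_numberTerm h0 h1 hx,
      fun x hx => Smoluchowski.numberProfile_nonneg h0 h1 hx,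
      Smoluchowski.isSolution_selfSimilar h0 h1,
      fun t _ => ⟨Smoluchowski.totalMass_selfSimilar h0 h1 t,
        fun x hx => Smoluchowski.massDist_selfSimilar h0 h1 t hx⟩,
      fun s hs => ⟨?_, ?_⟩, fun s hs => ?_, fun x hx => Smoluchowski.mul_numberProfile_eq h0 h1 hx⟩
    · rw [← Smoluchowski.lapExp_profileMeasure h0 h1]
      exact Smoluchowski.lapExp_nonneg hm hs
    · rw [← Smoluchowski.lapExp_profileMeasure h0 h1]
      rcases hs.eq_or_lt with rfl | hs
      · rw [Smoluchowski.lapExp_zero, Real.zero_rpow (by linarith), add_zero]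
      · obtain ⟨w, hw, rfl⟩ := Smoluchowski.exists_pos_add_rpow_eq h0 hs
        rw [Smoluchowski.lapExp_profileMeasure_add_rpow h0 h1 hw]
    · rw [← funext (Smoluchowski.lapExp_profileMeasure h0 h1)]
      simp_rw [neg_mul]
      rw [← Smoluchowski.lapTr_profileMeasure h0 h1]
      exact Smoluchowski.hasDerivAt_lapExp hm hs
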